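/- All spaces are pointed, maps and homotopies preserve base points, suspensions, cones and smash products are reduced, and products are taken in compactly generated spaces. For a closed inclusion $i_A\colon A\hookrightarrow X$ of pointed spaces let $J_n(X,A)$ be the quotient of $X\times A^{n-1}$ that identifies $(x,a_1,\dots,a_{n-1})$ with $(x',a_1',\dots,a_{n-1}')$ when the words $x a_1\cdots a_{n-1}$ and $x'a_1'\cdots a_{n-1}'$ agree after deletion of all letters $*$ (the words of length at most $n$ in the James construction $J(X)$ whose letters after the first lie in $A$). Let $I_n\colon J_{n-1}(X,A)\to J_n(X,A)$ append the letter $*$, and let $j_X\colon X\to J_{n-1}(X,A)$ be the canonical inclusion of the one-letter words. For pointed CW complexes $X_1,\dots,X_n$ ($n\ge 2$) let $T_1(\Sigma X_1,\dots,\Sigma X_n)\subset\Sigma X_1\times\dots\times\Sigma X_n$ be the fat wedge (at least one coordinate is $*$), with canonical injections $k_j\colon \Sigma X_j\to T_1$, and let $W_n\colon\Sigma^{n-1}X_1\wedge\dots\wedge X_n\to T_1(\Sigma X_1,\dots,\Sigma X_n)$ be the universal Whitehead product: $W_n=\rho\circ q^{-1}$ up to homotopy, where $Q=\bigcup_j CX_1\times\dots\times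 X_j\times\dots\times CX_n\subset\prod_j CX_j$, $\rho\colon Q\to T_1$ is induced by the projections $CX_j\to\Sigma X_j$, and $q\colon Q\to\Sigma^{n-1}X_1\wedge\dots\wedge X_n$, $([t_j,x_j])_j\mapsto[t_2,\dots,t_n;x_1\wedge\dots\wedge x_n]$, is a homotopy equivalence. For $f_j\colon\Sigma X_j\to Y$ the set of $n$-th order Whitehead products is $[f_1,\dots,f_n]=\{F W_n \mid F\colon T_1(\Sigma X_1,\dots,\Sigma X_n)\to Y,\ Fk_j\simeq f_j \text{ for all } j\}$. **Theorem.** Let $n\ge 2$. To every CW pair $(X,A)$ with $X=\Sigma X'$ and $A=\Sigma A'$, where $X'$ and $A'$ are CW complexes with a vertex as base point, with inclusion $i_A\colon A\hookrightarrow X$, one can assign a map $$\gamma_n\colon \Sigma^{n-1}X'\wedge A'^{\wedge(n-1)}\to J_{n-1}(X,A)$$ and a map $\varphi\colon J_{n-1}(X,A)\cup_{\gamma_n}C\big(\Sigma^{n-1}X'\wedge A'^{\wedge(n-1)}\big)\to J_n(X,A)$ such that 1. $\gamma_n$ is an element of the set of $n$-th order Whitehead products $[j_X,\,j_Xi_A,\dots,j_Xi_A]$;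 2. $\Sigma^{n-1}X'\wedge A'^{\wedge(n-1)}\xrightarrow{\gamma_n}J_{n-1}(X,A)\xrightarrow{I_n}J_n(X,A)$ is a principal cofibration sequence: $I_n$ is a closed embedding, and $\varphi$ restricts to $I_n$ on $J_{n-1}(X,A)$ and is a homotopy equivalence under $J_{n-1}(X,A)$ from the mapping cone of $\gamma_n$ to $J_n(X,A)$; 3. the sequence is natural: for maps $f'\colon X_1'\to X_2'$ and $g'\colon A_1'\to A_2'$ with $\Sigma f'\circ i_{A_1}=i_{A_2}\circ\Sigma g'$ (for example, those given by a map of pairs $(X_1',A_1')\to(X_2',A_2')$), the induced maps on $J_{n-1}$ and $J_n$ commute strictly with $I_n$, and there is a homotopy $H\colon J_{n-1}(\Sigma f',\Sigma g')\circ\gamma_n\simeq\gamma_n\circ\Sigma^{n-1}(f'\wedge g'^{\wedge(n-1)})$ such that the map of mapping cones induced by $H$ corresponds under $\varphi$ to $J_n(\Sigma f',\Sigma g')$, up to a homotopy relative to $J_{n-1}(X_1,A_1)$. For $n=2$ this is Gray's description $J_2(X,A)\simeq X\cup_{\gamma_2}C(X\wedge A')$ with $\gamma_2\in[\mathrm{id}_X,i_A]$.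 -/

import Mathlib

open Set Topology unitInterval

universe u

noncomputable section

/-! ## Two facts on compactly generated spaces

`CompactlyCoherentSpace` is Mathlib's class of spaces whose topology is determined by the compact
subsets (k-spaces), and `CompactCoherentification` is the k-ification. -/

instance CompactlyCoherentSpace.prod_of_locallyCompact {K X : Type*} [TopologicalSpace K]
    [LocallyCompactSpace K] [TopologicalSpace X] [CompactlyCoherentSpace X] :
    CompactlyCoherentSpace (K × X) := by
  refine CompactlyCoherentSpace.of_isOpen fun U hU => isOpen_iff_mem_nhds.2 ?_
  have key : ∀ (L : Set K) (M : Set X), IsCompact L → IsCompact M →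
      ∃ W : Set (K × X), IsOpen W ∧ ∀ s ∈ L, ∀ y ∈ M, ((s, y) ∈ W ↔ (s, y) ∈ U) := by
    intro L M hL hM
    obtain ⟨W, hW, hWU⟩ := isOpen_induced_iff.1 (hU (L ×ˢ M) (hL.prod hM))
    refine ⟨W, hW, fun s hs y hy => ?_⟩
    have := Set.ext_iff.1 hWU ⟨(s, y), hs, hy⟩
    simpa using this
  rintro ⟨t, x⟩ h
  have hS : {s | (s, x) ∈ U} ∈ 𝓝 t := by
    obtain ⟨L, hL, hLt⟩ := exists_compact_mem_nhds t
    obtain ⟨W, hW, hWU⟩ := key L {x} hL isCompact_singleton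
    have h1 : {s | (s, x) ∈ W} ∈ 𝓝 t := by
      refine (hW.preimage (by fun_prop : Continuous fun s : K => (s, x))).mem_nhds ?_
      exact (hWU t (mem_of_mem_nhds hLt) x rfl).2 h
    filter_upwards [h1, hLt] with s hs hsL
    exact (hWU s hsL x rfl).1 hs
  obtain ⟨N, hNt, hNS, hN⟩ := local_compact_nhds hS
  have hV : IsOpen {y | ∀ s ∈ N, (s, y) ∈ U} := by
    rw [CompactlyCoherentSpace.isOpen_iff]
    intro M hM
    obtain ⟨W, hW, hWU⟩ := key N M hN hM
    rw [isOpen_iff_mem_nhds]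
    rintro ⟨y, hy⟩ hyV
    obtain ⟨u, v, -, hv, hNu, hyv, huv⟩ := generalized_tube_lemma hN (isCompact_singleton (x := y))
      hW (by
        rintro ⟨s, z⟩ ⟨hs, hz⟩
        obtain rfl : z = y := hz
        exact (hWU s hs z hy).2 (hyV s hs))
    refine Filter.mem_of_superset ((hv.preimage continuous_subtype_val).mem_nhds (hyv rfl)) ?_
    rintro ⟨z, hz⟩ hzv s hs
    exact (hWU s hs z hz).1 (huv ⟨hNu hs, hzv⟩)
  refine Filter.mem_of_superset (prod_mem_nhds hNt (hV.mem_nhds (fun s hs => hNS hs))) ?_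
  rintro ⟨s, y⟩ ⟨hs, hy⟩
  exact hy s hs

instance CompactlyCoherentSpace.quot {X : Type*} [TopologicalSpace X] [CompactlyCoherentSpace X]
    (r : X → X → Prop) : CompactlyCoherentSpace (Quot r) := by
  refine CompactlyCoherentSpace.of_isOpen_forall_compactSpace fun s hs => ?_
  rw [← isQuotientMap_quot_mk.isOpen_preimage, CompactlyCoherentSpace.isOpen_iff_forall_compactSpace]
  intro K _ _ f hf
  exact hs K (Quot.mk r ∘ f) (continuous_quot_mk.comp hf)

theorem CompactCoherentification.continuous_mk_comp {Z Y : Type*} [TopologicalSpace Z]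
    [CompactlyCoherentSpace Z] [TopologicalSpace Y] {f : Z → Y} (hf : Continuous f) :
    Continuous fun z => CompactCoherentification.mk Y (f z) :=
  (CompactCoherentification.continuous_map_of_continuous hf).comp
    CompactCoherentification.continuous_mk

/-! ## Pointed spaces and pointed maps -/

/-- A pointed topological space. -/
structure PtdSpace where
  carrier : Type u
  [top : TopologicalSpace carrier]
  pt : carrier

namespace PtdSpace

instance : CoeSort PtdSpace.{u} (Type u) := ⟨PtdSpace.carrier⟩

instance (X : PtdSpace.{u}) : TopologicalSpace X := X.top

end PtdSpace

/-- A continuous map that preserves the base points. -/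
structure PtdMap (X Y : PtdSpace.{u}) where
  map : C(X, Y)
  map_pt : map X.pt = Y.pt

namespace PtdMap

variable {X Y Z : PtdSpace.{u}}

instance : CoeFun (PtdMap X Y) (fun _ => X → Y) := ⟨fun f => f.map⟩

theorem continuous (f : PtdMap X Y) : Continuous f := f.map.continuous

/-- The identity. -/
def id (X : PtdSpace.{u}) : PtdMap X X := ⟨ContinuousMap.id X, rfl⟩

/-- The composite `g ∘ f`. -/
def comp (g : PtdMap Y Z) (f : PtdMap X Y) : PtdMap X Z :=
  ⟨g.map.comp f.map, by rw [ContinuousMap.comp_apply, f.map_pt, g.map_pt]⟩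

/-- A homotopy from `f` to `g` through pointed maps. -/
abbrev Homotopy (f g : PtdMap X Y) : Type u := f.map.HomotopyRel g.map {X.pt}

/-- Homotopy of pointed maps, relative to the base point. -/
def Homotopic (f g : PtdMap X Y) : Prop := f.map.HomotopicRel g.map {X.pt}

end PtdMap

/-! ## Pointed CW complexes -/

/-- `X` is a (Hausdorff) CW complex whose base point is a `0`-cell. -/
class IsPtdCW (X : PtdSpace.{u}) : Prop where
  t2 : T2Space X
  exists_cw : ∃ (_ : CWComplex (univ : Set X)) (e : RelCWComplex.cell (univ : Set X) 0),
    RelCWComplex.map 0 e ![] = X.pt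

/-- The image of `i : A → X` is a subcomplex of a CW structure on `X`, and `i` is a homeomorphism
onto it: thus `(X, A)` is a CW pair with inclusion `i`. -/
structure IsCWPairIncl {A X : PtdSpace.{u}} (i : PtdMap A X) : Prop where
  isEmbedding : IsEmbedding i
  exists_subcomplex : ∃ (_ : CWComplex (univ : Set X))
    (E : RelCWComplex.Subcomplex (univ : Set X)), (E : Set X) = range i

theorem IsPtdCW.compactlyCoherentSpace (X : PtdSpace.{u}) [h : IsPtdCW X] :
    CompactlyCoherentSpace X := by
  have := h.t2
  obtain ⟨_, -, -⟩ := h.exists_cw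
  refine CompactlyCoherentSpace.of_isClosed fun A hA => ?_
  rw [CWComplex.closed (univ : Set X) A (subset_univ A)]
  intro n j
  have hc : IsCompact (RelCWComplex.closedCell (C := (univ : Set X)) n j) :=
    RelCWComplex.isCompact_closedCell
  rw [inter_comm, ← Subtype.image_preimage_coe]
  exact hc.isClosed.isClosedMap_subtype_val _ (hA _ hc)

/-! ## Collapsing, cones, suspensions, products, smash products -/

/-- The quotient space of `X` obtained by identifying the points of `C` with each other. -/
abbrev Collapse (X : Type*) (C : Set X) : Type _ := Quot fun p q : X => p ∈ C ∧ q ∈ C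

namespace Collapse

variable {X Y : Type*} {C : Set X} {D : Set Y}

theorem mk_eq {p q : X} (hp : p ∈ C) (hq : q ∈ C) :
    (Quot.mk _ p : Collapse X C) = Quot.mk _ q := Quot.sound ⟨hp, hq⟩

theorem mk_eq_iff {p q : X} :
    (Quot.mk _ p : Collapse X C) = Quot.mk _ q ↔ p = q ∨ (p ∈ C ∧ q ∈ C) := by
  refine ⟨fun h => ?_, ?_⟩
  · let φ : Collapse X C → Prop := Quot.lift (fun z => z = q ∨ (z ∈ C ∧ q ∈ C)) (by
      rintro a b ⟨ha, hb⟩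
      refine propext ⟨?_, ?_⟩
      · rintro (rfl | ⟨-, h⟩)
        · exact Or.inr ⟨hb, ha⟩
        · exact Or.inr ⟨hb, h⟩
      · rintro (rfl | ⟨-, h⟩)
        · exact Or.inr ⟨ha, hb⟩
        · exact Or.inr ⟨ha, h⟩)
    have h1 : φ (Quot.mk _ q) := Or.inl rfl
    rw [← h] at h1
    exact h1
  · rintro (rfl | ⟨hp, hq⟩)
    · rfl
    · exact mk_eq hp hq

/-- A continuous map that sends `C` into `D` induces a map of the quotients. -/
def map [TopologicalSpace X] [TopologicalSpace Y] (f : C(X, Y)) (h : MapsTo f C D) :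
    C(Collapse X C, Collapse Y D) where
  toFun := Quot.map f fun _ _ hpq => ⟨h hpq.1, h hpq.2⟩
  continuous_toFun := continuous_quot_lift _ (continuous_quot_mk.comp f.continuous)

end Collapse

/-- The reduced cone `C X = I × X / ({0} × X ∪ I × {*})`; its base is `t = 1`. -/
def cone (X : PtdSpace.{u}) : PtdSpace.{u} where
  carrier := Collapse (I × X) {p | p.1 = 0 ∨ p.2 = X.pt}
  pt := Quot.mk _ (0, X.pt)

/-- The point `[t, x]` of the cone. -/
def cone.mk {X : PtdSpace.{u}} (t : I) (x : X) : cone X := Quot.mk _ (t, x)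

/-- The reduced suspension `Σ X = I × X / ({0, 1} × X ∪ I × {*})`. -/
def susp (X : PtdSpace.{u}) : PtdSpace.{u} where
  carrier := Collapse (I × X) {p | p.1 = 0 ∨ p.1 = 1 ∨ p.2 = X.pt}
  pt := Quot.mk _ (0, X.pt)

/-- The point `[t, x]` of the suspension. -/
def susp.mk {X : PtdSpace.{u}} (t : I) (x : X) : susp X := Quot.mk _ (t, x)

/-- The suspension of a pointed map. -/
def susp.map {X Y : PtdSpace.{u}} (f : PtdMap X Y) : PtdMap (susp X) (susp Y) where
  map := Collapse.map ((ContinuousMap.id I).prodMap f.map) (by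
    rintro ⟨t, x⟩ (h | h | h)
    · exact Or.inl h
    · exact Or.inr (Or.inl h)
    · exact Or.inr (Or.inr ((congrArg f h).trans f.map_pt)))
  map_pt := Collapse.mk_eq (Or.inl rfl) (Or.inl rfl)

instance susp.compactlyCoherentSpace (X : PtdSpace.{u}) [CompactlyCoherentSpace X] :
    CompactlyCoherentSpace (susp X) :=
  CompactlyCoherentSpace.quot _

theorem susp.continuous_mk (X : PtdSpace.{u}) :
    Continuous fun p : I × X => (susp.mk p.1 p.2 : susp X) :=
  continuous_quot_mk

/-- The product of a finite family of spaces, in the category of compactly generated spaces: the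
k-ification of the product topology. -/
abbrev KProd {n : ℕ} (E : Fin n → PtdSpace.{u}) : Type u :=
  CompactCoherentification (∀ i, E i)

namespace KProd

variable {n : ℕ} {E F : Fin n → PtdSpace.{u}}

/-- The point of the product with the given coordinates. -/
def mk (p : ∀ i, E i) : KProd E := CompactCoherentification.mk _ p

/-- The `i`-th coordinate. -/
def coord (p : KProd E) (i : Fin n) : E i := (CompactCoherentification.mk _).symm p i

@[simp] theorem coord_mk (p : ∀ i, E i) (i : Fin n) : (mk p).coord i = p i := by
  simp [mk, coord]

theorem continuous_coord (i : Fin n) : Continuous fun p : KProd E => p.coord i :=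
  (continuous_apply i).comp CompactCoherentification.continuous_mk_symm

theorem continuous_mk {Z : Type*} [TopologicalSpace Z] [CompactlyCoherentSpace Z]
    {f : Z → ∀ i, E i} (hf : ∀ i, Continuous fun z => f z i) :
    Continuous fun z => (mk (f z) : KProd E) :=
  CompactCoherentification.continuous_mk_comp (continuous_pi hf)

/-- The product of a family of maps. -/
def map (f : ∀ i, PtdMap (E i) (F i)) : C(KProd E, KProd F) where
  toFun p := mk fun i => f i (p.coord i)
  continuous_toFun := continuous_mk fun i => (f i).continuous.comp (continuous_coord i)

end KProd

/-- The smash product `E₁ ∧ ⋯ ∧ Eₙ`: the product modulo the fat wedge. -/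
def smash {n : ℕ} (E : Fin n → PtdSpace.{u}) : PtdSpace.{u} where
  carrier := Collapse (KProd E) {p | ∃ i, p.coord i = (E i).pt}
  pt := Quot.mk _ (KProd.mk fun i => (E i).pt)

/-- The smash product of a family of pointed maps. -/
def smash.map {n : ℕ} {E F : Fin n → PtdSpace.{u}} (f : ∀ i, PtdMap (E i) (F i)) :
    PtdMap (smash E) (smash F) where
  map := Collapse.map (KProd.map f) (by
    rintro p ⟨i, hi⟩
    refine ⟨i, ?_⟩
    change (KProd.mk fun i => f i (p.coord i)).coord i = _
    rw [KProd.coord_mk, hi, (f i).map_pt])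
  map_pt := by
    change Quot.mk _ (KProd.mk fun i => f i ((KProd.mk _).coord i)) = Quot.mk _ _
    simp only [KProd.coord_mk, (f _).map_pt]

/-- The `m`-fold reduced suspension
`Σᵐ Z = Iᵐ × Z / (∂Iᵐ × Z ∪ Iᵐ × {*})`. -/
def iterSusp (m : ℕ) (Z : PtdSpace.{u}) : PtdSpace.{u} where
  carrier := Collapse ((Fin m → I) × Z) {p | (∃ i, p.1 i = 0 ∨ p.1 i = 1) ∨ p.2 = Z.pt}
  pt := Quot.mk _ (fun _ => 0, Z.pt)

/-- The `m`-fold suspension of a pointed map. -/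
def iterSusp.map (m : ℕ) {Y Z : PtdSpace.{u}} (f : PtdMap Y Z) :
    PtdMap (iterSusp m Y) (iterSusp m Z) where
  map := Collapse.map ((ContinuousMap.id (Fin m → I)).prodMap f.map) (by
    rintro ⟨t, x⟩ (h | h)
    · exact Or.inl h
    · exact Or.inr ((congrArg f h).trans f.map_pt))
  map_pt := Collapse.mk_eq (Or.inr f.map_pt) (Or.inr rfl)

/-! ## Mapping cones and principal cofibrations -/

/-- The gluing relation on `Y ⊔ I × S` that defines the reduced mapping cone of `γ : S → Y`. -/
inductive mapCone.Rel {S Y : PtdSpace.{u}} (γ : PtdMap S Y) : Y ⊕ (I × S) → Y ⊕ (I × S) → Prop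
  | zero (s : S) : Rel γ (Sum.inr (0, s)) (Sum.inl Y.pt)
  | base (t : I) : Rel γ (Sum.inr (t, S.pt)) (Sum.inl Y.pt)
  | glue (s : S) : Rel γ (Sum.inr (1, s)) (Sum.inl (γ s))

/-- The reduced mapping cone (cofiber) `Y ∪_γ C S` of `γ : S → Y`. -/
def mapCone {S Y : PtdSpace.{u}} (γ : PtdMap S Y) : PtdSpace.{u} where
  carrier := Quot (mapCone.Rel γ)
  pt := Quot.mk _ (Sum.inl Y.pt)

/-- The inclusion `Y → Y ∪_γ C S`. -/
def mapCone.incl {S Y : PtdSpace.{u}} (γ : PtdMap S Y) : PtdMap Y (mapCone γ) where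
  map := ⟨fun y => Quot.mk _ (Sum.inl y), continuous_quot_mk.comp continuous_inl⟩
  map_pt := rfl

/-- The point `[t, s]` of the cone in `Y ∪_γ C S`. -/
def mapCone.mk {S Y : PtdSpace.{u}} (γ : PtdMap S Y) (t : I) (s : S) : mapCone γ :=
  Quot.mk _ (Sum.inr (t, s))

/-- The map of mapping cones induced by `f : S₁ → S₂`, `g : Y₁ → Y₂` and a homotopy `H` from
`g ∘ γ₁` to `γ₂ ∘ f`: it is `g` on `Y₁`, and on the cone it sends `[t, s]` to `[2 t, f s]` if
`t ≤ 1 / 2` and to `H (2 - 2 t, s)` otherwise. -/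
def mapCone.map {S₁ Y₁ S₂ Y₂ : PtdSpace.{u}} {γ₁ : PtdMap S₁ Y₁} {γ₂ : PtdMap S₂ Y₂}
    {f : PtdMap S₁ S₂} {g : PtdMap Y₁ Y₂} (H : PtdMap.Homotopy (g.comp γ₁) (γ₂.comp f)) :
    PtdMap (mapCone γ₁) (mapCone γ₂) where
  map :=
    { toFun := Quot.lift
        (Sum.elim (fun y => mapCone.incl γ₂ (g y)) fun p : I × S₁ =>
          if (p.1 : ℝ) ≤ 1 / 2 then
            mapCone.mk γ₂ (projIcc 0 1 zero_le_one (2 * (p.1 : ℝ))) (f p.2)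
          else mapCone.incl γ₂ (H (projIcc 0 1 zero_le_one (2 - 2 * (p.1 : ℝ)), p.2)))
        (by
          rintro _ _ (s | t | s)
          · have h0 : projIcc (0 : ℝ) 1 zero_le_one (2 * ((0 : I) : ℝ)) = 0 := by
              simp
            simp only [Sum.elim_inr, Sum.elim_inl]
            rw [if_pos (by simp), h0, g.map_pt]
            exact Quot.sound (mapCone.Rel.zero _)
          · simp only [Sum.elim_inr, Sum.elim_inl]
            rw [g.map_pt]
            split_ifs with h
            · rw [f.map_pt]
              exact Quot.sound (mapCone.Rel.base _)
            · rw [H.eq_fst _ (mem_singleton _), (g.comp γ₁).map_pt]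
          · have h0 : projIcc (0 : ℝ) 1 zero_le_one (2 - 2 * ((1 : I) : ℝ)) = 0 := by
              simp
            simp only [Sum.elim_inr, Sum.elim_inl]
            rw [if_neg (by norm_num), h0, H.apply_zero]
            rfl)
      continuous_toFun := by
        refine continuous_quot_lift _ (Continuous.sumElim ?_ ?_)
        · exact (mapCone.incl γ₂).continuous.comp g.continuous
        · refine Continuous.if_le ?_ ?_ (by fun_prop) continuous_const ?_
          · refine continuous_quot_mk.comp (continuous_inr.comp (Continuous.prodMk ?_
              (f.continuous.comp continuous_snd)))
            exact continuous_projIcc.comp (by fun_prop)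
          · refine (mapCone.incl γ₂).continuous.comp (H.continuous.comp
              (Continuous.prodMk ?_ continuous_snd))
            exact continuous_projIcc.comp (by fun_prop)
          · rintro ⟨t, s⟩ ht
            have h1 : projIcc (0 : ℝ) 1 zero_le_one (2 * (t : ℝ)) = 1 := by
              apply projIcc_of_right_le
              linarith
            have h2 : projIcc (0 : ℝ) 1 zero_le_one (2 - 2 * (t : ℝ)) = 1 := by
              apply projIcc_of_right_le
              linarith
            rw [h1, h2, H.apply_one]
            exact Quot.sound (mapCone.Rel.glue _) }
  map_pt := congrArg (mapCone.incl γ₂) g.map_pt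

/-- Given maps `a : B → C` and `b : B → D`, the map `φ : C → D` satisfies `φ ∘ a = b` and is a
homotopy equivalence under `B`: it has an inverse `ψ` with `ψ ∘ b = a` up to homotopies that are
stationary on the image of `B`. -/
def IsHomotopyEquivUnder {B C D : PtdSpace.{u}} (a : PtdMap B C) (b : PtdMap B D)
    (φ : PtdMap C D) : Prop :=
  φ.comp a = b ∧ ∃ ψ : PtdMap D C, ψ.comp b = a ∧
    (ψ.comp φ).map.HomotopicRel (PtdMap.id C).map (range a) ∧
    (φ.comp ψ).map.HomotopicRel (PtdMap.id D).map (range b)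

/-! ## Higher order Whitehead products -/

section Whitehead

variable {n : ℕ} (E : Fin (n + 2) → PtdSpace.{u})

/-- The fat wedge `T₁(E₁, …, Eₙ₊₂)`: the points of the product with at least one coordinate at the
base point. -/
def fatWedge : PtdSpace.{u} where
  carrier := {p : KProd E // ∃ i, p.coord i = (E i).pt}
  pt := ⟨KProd.mk fun i => (E i).pt, 0, KProd.coord_mk _ _⟩

/-- The canonical injection `k_j : E_j → T₁(E₁, …, Eₙ₊₂)`. -/
def fatWedge.inj (j : Fin (n + 2)) [CompactlyCoherentSpace (E j)] :
    PtdMap (E j) (fatWedge E) where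
  map :=
    { toFun := fun x => ⟨KProd.mk (Function.update (fun i => (E i).pt) j x), by
        obtain ⟨i, hi⟩ := exists_ne j
        exact ⟨i, by rw [KProd.coord_mk, Function.update_of_ne hi]⟩⟩
      continuous_toFun := by
        refine Continuous.subtype_mk (KProd.continuous_mk fun i => ?_) _
        have h : Continuous fun x : E j => Function.update (fun i => (E i).pt) j x :=
          continuous_const.update j continuous_id
        exact (continuous_apply i).comp h }
  map_pt := Subtype.ext (congrArg KProd.mk (Function.update_eq_self j fun i => (E i).pt))

/-- The points `t` of the cube with some coordinate equal to `1`. -/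
abbrev outerFaces (n : ℕ) : Type := {t : Fin (n + 2) → I // ∃ i, t i = 1}

instance (n : ℕ) : CompactSpace (outerFaces n) := by
  refine isCompact_iff_compactSpace.1 (IsClosed.isCompact ?_)
  have h : {t : Fin (n + 2) → I | ∃ i, t i = 1} = ⋃ i, {t | t i = 1} := by
    ext t
    simp
  change IsClosed {t : Fin (n + 2) → I | ∃ i, t i = 1}
  rw [h]
  exact isClosed_iUnion_of_finite fun i => isClosed_eq (continuous_apply i) continuous_const

/-- Two pairs `(t, x)` are related if the points `([tᵢ, xᵢ])ᵢ` of `C E₁ × ⋯ × C Eₙ₊₂` agree. -/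
def coneBoundary.Rel (a b : outerFaces n × KProd E) : Prop :=
  ∀ i, cone.mk (a.1.1 i) (a.2.coord i) = cone.mk (b.1.1 i) (b.2.coord i)

/-- The subspace `Q(E) = ⋃ᵢ C E₁ × ⋯ × Eᵢ × ⋯ × C Eₙ₊₂` of `C E₁ × ⋯ × C Eₙ₊₂`, which consists
of the points `([tᵢ, xᵢ])ᵢ` with some `tᵢ = 1`. -/
def coneBoundary : PtdSpace.{u} where
  carrier := Quot (coneBoundary.Rel E)
  pt := Quot.mk _ (⟨fun _ => 1, 0, rfl⟩, KProd.mk fun i => (E i).pt)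

variable {E} in
theorem coneBoundary.Rel.cases {a b : outerFaces n × KProd E} (h : coneBoundary.Rel E a b) :
    (∀ i, a.1.1 i = b.1.1 i ∧ a.2.coord i = b.2.coord i) ∨
      ∃ i, (a.1.1 i = 0 ∨ a.2.coord i = (E i).pt) ∧ (b.1.1 i = 0 ∨ b.2.coord i = (E i).pt) := by
  by_cases hc : ∀ i, a.1.1 i = b.1.1 i ∧ a.2.coord i = b.2.coord i
  · exact Or.inl hc
  · push Not at hc
    obtain ⟨i, hi⟩ := hc
    refine Or.inr ⟨i, ?_⟩
    rcases Collapse.mk_eq_iff.1 (h i) with h' | h'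
    · exact absurd (Prod.ext_iff.1 h').2 (hi (Prod.ext_iff.1 h').1)
    · exact h'

/-- The map `ρ : Q(E) → T₁(Σ E₁, …, Σ Eₙ₊₂)`, the restriction of the product of the
projections `C Eᵢ → C Eᵢ / Eᵢ = Σ Eᵢ`. -/
def coneBoundary.toFatWedge : PtdMap (coneBoundary E) (fatWedge fun i => susp (E i)) where
  map :=
    { toFun := Quot.lift
        (fun a => ⟨KProd.mk fun i => susp.mk (a.1.1 i) (a.2.coord i), by
          obtain ⟨i, hi⟩ := a.1.2
          refine ⟨i, ?_⟩
          rw [KProd.coord_mk, hi]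
          exact Collapse.mk_eq (Or.inr (Or.inl rfl)) (Or.inl rfl)⟩)
        (by
          intro a b h
          refine Subtype.ext (congrArg KProd.mk (funext fun i => ?_))
          rcases Collapse.mk_eq_iff.1 (h i) with h' | ⟨h1, h2⟩
          · exact congrArg₂ susp.mk (Prod.ext_iff.1 h').1 (Prod.ext_iff.1 h').2
          · exact Collapse.mk_eq (h1.imp_right Or.inr) (h2.imp_right Or.inr))
      continuous_toFun := by
        refine continuous_quot_lift _ (Continuous.subtype_mk (KProd.continuous_mk fun i => ?_) _)
        have h1 : Continuous fun a : outerFaces n × KProd E => a.1.1 i :=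
          (continuous_apply i).comp (continuous_subtype_val.comp continuous_fst)
        have h2 : Continuous fun a : outerFaces n × KProd E => a.2.coord i :=
          (KProd.continuous_coord i).comp continuous_snd
        exact (susp.continuous_mk (E i)).comp (h1.prodMk h2) }
  map_pt := by
    refine Subtype.ext (congrArg KProd.mk (funext fun i => ?_))
    exact Collapse.mk_eq (Or.inr (Or.inl rfl)) (Or.inl rfl)

/-- The map `q : Q(E) → Σⁿ⁺¹ (E₁ ∧ ⋯ ∧ Eₙ₊₂)` that sends `([tᵢ, xᵢ])ᵢ` to
`[t₂, …, tₙ₊₂; x₁ ∧ ⋯ ∧ xₙ₊₂]`. It collapses the contractible subspace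
`C E₁ × Q(E₂, …, Eₙ₊₂) ∪ {*} × C E₂ × ⋯ × C Eₙ₊₂` to a point and is injective elsewhere;
it is a homotopy equivalence for pointed CW complexes. -/
def coneBoundary.toSusp : PtdMap (coneBoundary E) (iterSusp (n + 1) (smash E)) where
  map :=
    { toFun := Quot.lift
        (fun a => Quot.mk _ (fun i : Fin (n + 1) => a.1.1 i.succ, Quot.mk _ a.2))
        (by
          have key : ∀ a : outerFaces n × KProd E,
              (∃ i, a.1.1 i = 0 ∨ a.2.coord i = (E i).pt) →
              ((fun i : Fin (n + 1) => a.1.1 i.succ, (Quot.mk _ a.2 : smash E)) :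
                (Fin (n + 1) → I) × smash E) ∈ {p : (Fin (n + 1) → I) × smash E |
                (∃ i, p.1 i = 0 ∨ p.1 i = 1) ∨ p.2 = (smash E).pt} := by
            rintro a ⟨i, hi | hi⟩
            · refine Or.inl ?_
              rcases Fin.eq_zero_or_eq_succ i with rfl | ⟨j, rfl⟩
              · obtain ⟨k, hk⟩ := a.1.2
                rcases Fin.eq_zero_or_eq_succ k with rfl | ⟨j, rfl⟩
                · exact absurd (hi.symm.trans hk) zero_ne_one
                · exact ⟨j, Or.inr hk⟩
              · exact ⟨j, Or.inl hi⟩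
            · exact Or.inr (Collapse.mk_eq ⟨i, hi⟩ ⟨i, KProd.coord_mk _ _⟩)
          intro a b h
          rcases h.cases with h | ⟨i, h1, h2⟩
          · have h1 : a.1 = b.1 := Subtype.ext (funext fun i => (h i).1)
            have h2 : a.2 = b.2 :=
              (CompactCoherentification.mk _).symm.injective (funext fun i => (h i).2)
            rw [h1, h2]
          · exact Collapse.mk_eq (key a ⟨i, h1⟩) (key b ⟨i, h2⟩))
      continuous_toFun := by
        refine continuous_quot_lift _ (continuous_quot_mk.comp (Continuous.prodMk ?_
          (continuous_quot_mk.comp continuous_snd)))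
        exact continuous_pi fun i =>
          (continuous_apply i.succ).comp (continuous_subtype_val.comp continuous_fst) }
  map_pt := Collapse.mk_eq (Or.inr rfl) (Or.inr rfl)

/-- `W : Σⁿ⁺¹ (E₁ ∧ ⋯ ∧ Eₙ₊₂) → T₁(Σ E₁, …, Σ Eₙ₊₂)` is (up to homotopy) the universal Whitehead
product, the composite of a homotopy inverse of `q` with `ρ`. -/
def IsUniversalWhitehead (W : PtdMap (iterSusp (n + 1) (smash E)) (fatWedge fun i => susp (E i))) :
    Prop :=
  (W.comp (coneBoundary.toSusp E)).Homotopic (coneBoundary.toFatWedge E)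

variable {E} in
/-- The set `[f₁, …, fₙ₊₂]` of `(n + 2)`-th order Whitehead products of maps `f_j : Σ E_j → Y`: the
maps homotopic to `F ∘ W`, where `F : T₁(Σ E₁, …, Σ Eₙ₊₂) → Y` satisfies `F ∘ k_j ≃ f_j` for
every `j` and `W` is the universal Whitehead product. -/
def whiteheadProducts [∀ j, CompactlyCoherentSpace (E j)] {Y : PtdSpace.{u}}
    (f : ∀ j, PtdMap (susp (E j)) Y) : Set (PtdMap (iterSusp (n + 1) (smash E)) Y) :=
  {γ | ∃ F : PtdMap (fatWedge fun i => susp (E i)) Y,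
    (∀ j, (F.comp (fatWedge.inj (fun i => susp (E i)) j)).Homotopic (f j)) ∧
    ∃ W, IsUniversalWhitehead E W ∧ γ.Homotopic (F.comp W)}

end Whitehead

/-! ## The relative James construction -/

/-- The family `X, A, …, A` with `n` members. -/
def letters (X A : PtdSpace.{u}) : (n : ℕ) → Fin n → PtdSpace.{u}
  | _, ⟨0, _⟩ => X
  | _, ⟨_ + 1, _⟩ => A

/-- The family of maps `f, g, …, g`. -/
def letters.map {X₁ A₁ X₂ A₂ : PtdSpace.{u}} (f : PtdMap X₁ X₂) (g : PtdMap A₁ A₂) :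
    {n : ℕ} → (k : Fin n) → PtdMap (letters X₁ A₁ n k) (letters X₂ A₂ n k)
  | _, ⟨0, _⟩ => f
  | _, ⟨_ + 1, _⟩ => g

namespace RelJames

variable {X A : PtdSpace.{u}} (i : PtdMap A X)

/-- A letter of a word, as a point of `X`. -/
def letter : {n : ℕ} → (k : Fin n) → letters X A n k → X
  | _, ⟨0, _⟩, x => x
  | _, ⟨_ + 1, _⟩, a => i a

theorem letter_pt {n : ℕ} (k : Fin n) : letter i k (letters X A n k).pt = X.pt := by
  obtain ⟨_ | k, hk⟩ := k
  · rfl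
  · exact i.map_pt

open Classical in
/-- The reduced word `x a₁ ⋯ aₙ₋₁`: the element of the free monoid on `X` with unit `*`
represented by a point of `X × A × ⋯ × A`, that is, the list of its letters different
from `*`. -/
def word {n : ℕ} (p : KProd (letters X A n)) : List X :=
  (List.ofFn fun k => letter i k (p.coord k)).filter fun x => decide (x ≠ X.pt)

end RelJames

/-- The `n`-th filtration `J_n(X, A)` of the relative James construction of `i : A → X`: the
words of length at most `n` on `X` whose letters after the first are in `A`, with the quotient
topology from `X × A × ⋯ × A`. -/
def RelJames {X A : PtdSpace.{u}} (i : PtdMap A X) (n : ℕ) : PtdSpace.{u} where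
  carrier := Quot fun p q : KProd (letters X A n) => RelJames.word i p = RelJames.word i q
  pt := Quot.mk _ (KProd.mk fun k => (letters X A n k).pt)

namespace RelJames

variable {X A : PtdSpace.{u}} (i : PtdMap A X)

/-- The coordinates of the point `(x, a₁, …, aₙ₋₁, *)`. -/
def append {n : ℕ} (p : ∀ k, letters X A n k) : (k : Fin (n + 1)) → letters X A (n + 1) k
  | ⟨0, _⟩ => if h : 0 < n then p ⟨0, h⟩ else X.pt
  | ⟨k + 1, _⟩ => if h : k + 1 < n then p ⟨k + 1, h⟩ else A.pt

theorem word_append {n : ℕ} (p : KProd (letters X A n)) :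
    word i (KProd.mk (append p.coord)) = word i p := by
  have h1 : ∀ k : Fin n, letter i k.castSucc (append p.coord k.castSucc) =
      letter i k (p.coord k) := by
    rintro ⟨_ | k, hk⟩
    · exact dif_pos hk
    · exact congrArg i (dif_pos hk)
  have h2 : letter i (Fin.last n) (append p.coord (Fin.last n)) = X.pt := by
    rcases n with _ | n
    · rfl
    · exact (congrArg i (dif_neg (lt_irrefl _))).trans i.map_pt
  simp only [word, KProd.coord_mk, List.ofFn_succ', List.concat_eq_append, List.filter_append, h1,
    h2]
  simp

/-- The inclusion `I_{n+1} : J_n(X, A) → J_{n+1}(X, A)` that appends the letter `*`. -/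
def incl (n : ℕ) : PtdMap (RelJames i n) (RelJames i (n + 1)) where
  map :=
    { toFun := Quot.map (fun p => KProd.mk (append p.coord)) fun p q h => by
        rw [word_append, word_append, h]
      continuous_toFun := by
        refine continuous_quot_lift _ (continuous_quot_mk.comp (KProd.continuous_mk ?_))
        rintro ⟨_ | k, hk⟩
        · by_cases h : 0 < n
          · exact (KProd.continuous_coord (E := letters X A n) ⟨0, h⟩).congr
              fun p => by symm; exact dif_pos h
          · exact (continuous_const (y := X.pt)).congr fun p => by symm; exact dif_neg h
        · by_cases h : k + 1 < n
          · exact (KProd.continuous_coord (E := letters X A n) ⟨k + 1, h⟩).congr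
              fun p => by symm; exact dif_pos h
          · exact (continuous_const (y := A.pt)).congr fun p => by symm; exact dif_neg h }
  map_pt := by
    refine congrArg (fun p => Quot.mk _ (KProd.mk p)) (funext ?_)
    rintro ⟨_ | k, hk⟩
    · by_cases h : 0 < n
      · exact (dif_pos h).trans (KProd.coord_mk (E := letters X A n) _ ⟨0, h⟩)
      · exact dif_neg h
    · by_cases h : k + 1 < n
      · exact (dif_pos h).trans (KProd.coord_mk (E := letters X A n) _ ⟨k + 1, h⟩)
      · exact dif_neg h

/-- The coordinates of the point `(x, *, …, *)`. -/
def single {n : ℕ} (x : X) : (k : Fin n) → letters X A n k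
  | ⟨0, _⟩ => x
  | ⟨_ + 1, _⟩ => A.pt

/-- The canonical map `j_X : X → J_n(X, A)`, the inclusion of the one-letter words for `n ≥ 1`. -/
def ofX [CompactlyCoherentSpace X] (n : ℕ) : PtdMap X (RelJames i n) where
  map :=
    { toFun := fun x => Quot.mk _ (KProd.mk (single x))
      continuous_toFun := by
        refine continuous_quot_mk.comp (KProd.continuous_mk ?_)
        rintro ⟨_ | k, hk⟩
        · exact continuous_id
        · exact continuous_const }
  map_pt := by
    refine congrArg (fun p => Quot.mk _ (KProd.mk p)) (funext ?_)
    rintro ⟨_ | k, hk⟩ <;> rfl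

section map

variable {X₁ A₁ X₂ A₂ : PtdSpace.{u}} {i₁ : PtdMap A₁ X₁} {i₂ : PtdMap A₂ X₂}

theorem word_map (f : PtdMap X₁ X₂) (g : PtdMap A₁ A₂) (h : f.comp i₁ = i₂.comp g) {n : ℕ}
    {p q : KProd (letters X₁ A₁ n)} (hpq : word i₁ p = word i₁ q) :
    word i₂ (KProd.map (letters.map f g) p) = word i₂ (KProd.map (letters.map f g) q) := by
  classical
  have h1 : ∀ (k : Fin n) (x : letters X₁ A₁ n k),
      letter i₂ k (letters.map f g k x) = f (letter i₁ k x) := by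
    rintro ⟨_ | k, hk⟩ x
    · rfl
    · exact (congrArg (fun F : PtdMap A₁ X₂ => F x) h).symm
  have h2 : ∀ l : List X₁, (l.map f).filter (fun x => decide (x ≠ X₂.pt)) =
      ((l.filter fun x => decide (x ≠ X₁.pt)).map f).filter fun x => decide (x ≠ X₂.pt) := by
    intro l
    induction l with
    | nil => rfl
    | cons a l ih =>
      by_cases ha : a = X₁.pt
      · subst ha
        simpa [f.map_pt] using ih
      · by_cases hb : f a = X₂.pt
        · simpa [ha, hb] using ih
        · simpa [ha, hb] using ih
  have h3 : ∀ p : KProd (letters X₁ A₁ n), word i₂ (KProd.map (letters.map f g) p) =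
      ((word i₁ p).map f).filter fun x => decide (x ≠ X₂.pt) := by
    intro p
    have h4 : (List.ofFn fun k => letter i₂ k ((KProd.map (letters.map f g) p).coord k)) =
        (List.ofFn fun k => letter i₁ k (p.coord k)).map f := by
      rw [List.map_ofFn]
      congr 1
      funext k
      change letter i₂ k ((KProd.mk fun i => letters.map f g i (p.coord i)).coord k) = _
      rw [KProd.coord_mk, h1]
      rfl
    unfold word
    rw [h4, h2]
  rw [h3, h3, hpq]

/-- The map `J_n(X₁, A₁) → J_n(X₂, A₂)` induced by a map `(f, g)` of pairs, which acts on each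
letter. -/
def map (f : PtdMap X₁ X₂) (g : PtdMap A₁ A₂) (h : f.comp i₁ = i₂.comp g) (n : ℕ) :
    PtdMap (RelJames i₁ n) (RelJames i₂ n) where
  map :=
    { toFun := Quot.map (KProd.map (letters.map f g)) fun _ _ hpq => word_map f g h hpq
      continuous_toFun := continuous_quot_lift _
        (continuous_quot_mk.comp (KProd.map (letters.map f g)).continuous) }
  map_pt := by
    change Quot.mk _ (KProd.mk fun k => letters.map f g k ((KProd.mk _).coord k)) = Quot.mk _ _
    simp only [KProd.coord_mk, (letters.map f g _).map_pt]

end map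

end RelJames

/-! ## CW pairs of suspensions -/

/-- A CW pair `(X, A)` with `X = Σ X'` and `A = Σ A'` for pointed CW complexes `X'` and `A'`. -/
structure SuspCWPair where
  X' : PtdSpace.{u}
  A' : PtdSpace.{u}
  [cwX' : IsPtdCW X']
  [cwA' : IsPtdCW A']
  incl : PtdMap (susp A') (susp X')
  isCWPairIncl : IsCWPairIncl incl

namespace SuspCWPair

attribute [instance] SuspCWPair.cwX' SuspCWPair.cwA'

variable (P : SuspCWPair.{u})

instance : CompactlyCoherentSpace P.X' := IsPtdCW.compactlyCoherentSpace _

instance : CompactlyCoherentSpace P.A' := IsPtdCW.compactlyCoherentSpace _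

/-- The filtration `J_n(X, A)`. -/
abbrev J (n : ℕ) : PtdSpace.{u} := RelJames P.incl n

/-- The inclusion `J_n(X, A) → J_{n+1}(X, A)`. -/
abbrev inclJ (n : ℕ) : PtdMap (P.J n) (P.J (n + 1)) := RelJames.incl P.incl n

/-- The inclusion `j_X : X → J_n(X, A)`. -/
abbrev jX (n : ℕ) : PtdMap (susp P.X') (P.J n) := RelJames.ofX P.incl n

/-- The space `Σⁿ⁺¹ (X' ∧ A' ∧ ⋯ ∧ A')` with `n + 1` factors `A'`. -/
abbrev attachDomain (n : ℕ) : PtdSpace.{u} := iterSusp (n + 1) (smash (letters P.X' P.A' (n + 2)))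

instance (n : ℕ) : ∀ k : Fin n, CompactlyCoherentSpace (letters P.X' P.A' n k)
  | ⟨0, _⟩ => inferInstanceAs (CompactlyCoherentSpace P.X')
  | ⟨_ + 1, _⟩ => inferInstanceAs (CompactlyCoherentSpace P.A')

/-- The maps `j_X, j_X ∘ i_A, …, j_X ∘ i_A` into `J_m(X, A)`. -/
def legs (m : ℕ) : {n : ℕ} → (k : Fin n) → PtdMap (susp (letters P.X' P.A' n k)) (P.J m)
  | _, ⟨0, _⟩ => P.jX m
  | _, ⟨_ + 1, _⟩ => (P.jX m).comp P.incl

/-- A map of pairs `(X₁', A₁') → (X₂', A₂')`: maps whose suspensions commute with the inclusions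
of the pairs `(X₁, A₁)` and `(X₂, A₂)`. -/
structure Hom (P₁ P₂ : SuspCWPair.{u}) where
  onX' : PtdMap P₁.X' P₂.X'
  onA' : PtdMap P₁.A' P₂.A'
  comm : (susp.map onX').comp P₁.incl = P₂.incl.comp (susp.map onA')

namespace Hom

variable {P₁ P₂ : SuspCWPair.{u}} (h : Hom P₁ P₂)

/-- The induced map `J_n(X₁, A₁) → J_n(X₂, A₂)`. -/
def J (n : ℕ) : PtdMap (P₁.J n) (P₂.J n) :=
  RelJames.map (susp.map h.onX') (susp.map h.onA') h.comm n

/-- The induced map `Σⁿ⁺¹ (X₁' ∧ A₁' ∧ ⋯ ∧ A₁') → Σⁿ⁺¹ (X₂' ∧ A₂' ∧ ⋯ ∧ A₂')`. -/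
def attachDomain (n : ℕ) : PtdMap (P₁.attachDomain n) (P₂.attachDomain n) :=
  iterSusp.map (n + 1) (smash.map (letters.map h.onX' h.onA'))

end Hom

end SuspCWPair

end

/-!
Write `Q = Q(X', A', …, A')` for the boundary part of the product `D = C X' × C A' × ⋯ × C A'` of
the cones, and `π : D → J_{n+2}(X, A)` for the map that projects every cone onto the suspension and
reads the resulting point of `X × A × ⋯ × A` as a word.

The word of a point of `X × A × ⋯ × A` has fewer than `n + 2` letters exactly if one of the
coordinates is the base point, and such a coordinate can be omitted. Hence there is a map
`F : T₁(X, A, …, A) → J_{n+1}(X, A)` with `I ∘ F = π` on the fat wedge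
(`RelJames.ofFatWedge`, `RelJames.incl_ofFatWedge`); it is continuous since it is so on each of the
finitely many closed sets where a given coordinate is the base point. On the other hand the
coordinates of a point are determined by its word if none of them is the base point. Since finite
products of quotient maps of compactly generated Hausdorff spaces are quotient maps
(`KProd.isQuotientMap_prod`), `J_{n+2}(X, A)` is the space obtained from `J_{n+1}(X, A)` by
attaching `D` along `α = F ∘ ρ : Q → J_{n+1}(X, A)` (`RelJames.isAttaching`).

The space `D` is contractible and `Q ⊆ D` has a neighbourhood that deforms into `Q`, so attaching
`D` along `α` has the same effect, up to a homotopy equivalence under `J_{n+1}(X, A)`, as forming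
the mapping cone of `α` (`IsAttaching.isHomotopyEquivUnder`). The projection
`q : Q → Σⁿ⁺¹ (X' ∧ A' ∧ ⋯ ∧ A')` has a pointed homotopy inverse `r`
(`coneBoundary.exists_toSusp_inverse`), and precomposition with a homotopy equivalence does not
change the mapping cone (`mapCone.isHomotopyEquivUnder_ofSource`). So `γ = α ∘ r = F ∘ (ρ ∘ r)` has
the required mapping cone, and it is a Whitehead product because `ρ ∘ r` is the universal one and
`F` restricts to `j_X, j_X i_A, …, j_X i_A` on the axes. The deformations in `D` and `Q` come from
the fact that the base point of a CW complex is nondegenerate (`IsPtdCW.nonempty_pointDeform`).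

The constructions of `D`, `Q`, `α` and `π` and the contraction of `D` are strictly natural; only
the choice of `r` is not. Therefore a homotopy between the two composites
`Σⁿ⁺¹ (X₁' ∧ A₁' ∧ ⋯ ∧ A₁') → Q(X₂', A₂', …, A₂')` gives all the homotopies needed for naturality
(`SuspCWPair.Hom.exists_homotopy`).
-/

noncomputable section

/-! ### Products of quotient maps in compactly generated spaces -/

/-- The collapse of `C` is Hausdorff if `X` is and `C` has disjoint neighbourhoods from the
points outside `C`. -/
theorem Collapse.t2Space {X : Type*} [TopologicalSpace X] [T2Space X] {C : Set X}
    (h : ∀ p ∉ C, ∃ U V : Set X, IsOpen U ∧ IsOpen V ∧ p ∈ U ∧ C ⊆ V ∧ Disjoint U V) :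
    T2Space (Collapse X C) := by
  have hopen : ∀ U : Set X, IsOpen U → (Disjoint U C ∨ C ⊆ U) →
      IsOpen ((Quot.mk _ : X → Collapse X C) '' U) := by
    intro U hU hUC
    rw [← isQuotientMap_quot_mk.isOpen_preimage]
    convert hU using 1
    ext p
    constructor
    · rintro ⟨q, hq, hqp⟩
      rcases Collapse.mk_eq_iff.1 hqp with rfl | ⟨h1, h2⟩
      · exact hq
      · rcases hUC with h' | h'
        · exact absurd h1 (disjoint_left.1 h' hq)
        · exact h' h2
    · exact fun hp => ⟨p, hp, rfl⟩
  have hdisj : ∀ U V : Set X, Disjoint U V → (Disjoint U C) →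
      Disjoint ((Quot.mk _ : X → Collapse X C) '' U) (Quot.mk _ '' V) := by
    intro U V hUV hUC
    rw [disjoint_left]
    rintro _ ⟨p, hp, rfl⟩ ⟨q, hq, hqp⟩
    rcases Collapse.mk_eq_iff.1 hqp with rfl | ⟨h1, h2⟩
    · exact disjoint_left.1 hUV hp hq
    · exact disjoint_left.1 hUC hp h2
  have key : ∀ p q : X, p ∉ C → (Quot.mk _ p : Collapse X C) ≠ Quot.mk _ q →
      ∃ U V : Set (Collapse X C), IsOpen U ∧ IsOpen V ∧ Quot.mk _ p ∈ U ∧ Quot.mk _ q ∈ V ∧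
        Disjoint U V := by
    intro p q hp hpq
    obtain ⟨U, V, hU, hV, hpU, hCV, hUV⟩ := h p hp
    have hUC : Disjoint U C := hUV.mono_right hCV
    by_cases hq : q ∈ C
    · exact ⟨_, _, hopen U hU (Or.inl hUC), hopen V hV (Or.inr hCV), ⟨p, hpU, rfl⟩,
        ⟨q, hCV hq, rfl⟩, hdisj U V hUV hUC⟩
    · obtain ⟨U', V', hU', hV', hqU', hCV', hUV'⟩ := h q hq
      have hUC' : Disjoint U' C := hUV'.mono_right hCV'
      have hne : p ≠ q := fun h => hpq (by rw [h])
      obtain ⟨S, T, hS, hT, hpS, hqT, hST⟩ := t2_separation hne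
      refine ⟨_, _, hopen (U ∩ S) (hU.inter hS) (Or.inl (hUC.mono_left inter_subset_left)),
        hopen (U' ∩ T) (hU'.inter hT) (Or.inl (hUC'.mono_left inter_subset_left)),
        ⟨p, ⟨hpU, hpS⟩, rfl⟩, ⟨q, ⟨hqU', hqT⟩, rfl⟩, hdisj _ _ ?_ ?_⟩
      · exact hST.mono inter_subset_right inter_subset_right
      · exact hUC.mono_left inter_subset_left
  refine ⟨?_⟩
  rintro ⟨p⟩ ⟨q⟩ hpq
  by_cases hp : p ∈ C
  · by_cases hq : q ∈ C
    · exact absurd (Collapse.mk_eq hp hq) hpq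
    · obtain ⟨U, V, hU, hV, h1, h2, h3⟩ := key q p hq (Ne.symm hpq)
      exact ⟨V, U, hV, hU, h2, h1, h3.symm⟩
  · exact key p q hp hpq

instance susp.t2Space {X : PtdSpace.{u}} [T2Space X] : T2Space (susp X) := by
  refine Collapse.t2Space (X := I × X) fun p hp => ?_
  simp only [mem_ofPred_eq, not_or] at hp
  obtain ⟨h0, h1, hx⟩ := hp
  obtain ⟨U, V, hU, hV, hxU, hV', hUV⟩ := t2_separation hx
  have hc : Continuous fun q : I × X => (q.1 : ℝ) := by fun_prop
  have h0' : 0 < (p.1 : ℝ) := unitInterval.pos_iff_ne_zero.2 h0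
  have h1' : (p.1 : ℝ) < 1 := unitInterval.lt_one_iff_ne_one.2 h1
  refine ⟨{q | (p.1 : ℝ) / 2 < q.1 ∧ (q.1 : ℝ) < (1 + p.1) / 2 ∧ q.2 ∈ U},
    {q | (q.1 : ℝ) < p.1 / 2 ∨ (1 + (p.1 : ℝ)) / 2 < q.1 ∨ q.2 ∈ V}, ?_, ?_, ?_, ?_, ?_⟩
  · exact (isOpen_lt continuous_const hc).inter
      ((isOpen_lt hc continuous_const).inter (hU.preimage continuous_snd))
  · exact (isOpen_lt hc continuous_const).union
      ((isOpen_lt continuous_const hc).union (hV.preimage continuous_snd))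
  · exact ⟨by linarith, by linarith, hxU⟩
  · rintro q (h | h | h)
    · left
      simp [h, h0']
    · right; left
      simp only [h, Icc.coe_one]
      linarith
    · right; right
      rw [h]
      exact hV'
  · rw [disjoint_left]
    rintro q ⟨ha, hb, hc⟩ (h | h | h)
    · linarith
    · linarith
    · exact disjoint_left.1 hUV hc h

instance cone.t2Space {X : PtdSpace.{u}} [T2Space X] : T2Space (cone X) := by
  refine Collapse.t2Space (X := I × X) fun p hp => ?_
  simp only [mem_ofPred_eq, not_or] at hp
  obtain ⟨h0, hx⟩ := hp
  obtain ⟨U, V, hU, hV, hxU, hV', hUV⟩ := t2_separation hx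
  have hc : Continuous fun q : I × X => (q.1 : ℝ) := by fun_prop
  have h0' : 0 < (p.1 : ℝ) := unitInterval.pos_iff_ne_zero.2 h0
  refine ⟨{q | (p.1 : ℝ) / 2 < q.1 ∧ q.2 ∈ U}, {q | (q.1 : ℝ) < p.1 / 2 ∨ q.2 ∈ V},
    ?_, ?_, ?_, ?_, ?_⟩
  · exact (isOpen_lt continuous_const hc).inter (hU.preimage continuous_snd)
  · exact (isOpen_lt hc continuous_const).union (hV.preimage continuous_snd)
  · exact ⟨by linarith, hxU⟩
  · rintro q (h | h)
    · left
      simp [h, h0']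
    · right
      rw [h]
      exact hV'
  · rw [disjoint_left]
    rintro q ⟨ha, hc⟩ (h | h)
    · linarith
    · exact disjoint_left.1 hUV hc h

/-- The product of a quotient map with a locally compact space reflects open sets. -/
theorem Topology.IsQuotientMap.isOpen_of_preimage_prodMk {X Y L : Type*} [TopologicalSpace X]
    [TopologicalSpace Y] [TopologicalSpace L] [LocallyCompactSpace L] {f : X → Y}
    (hf : IsQuotientMap f) {S : Set (Y × L)}
    (hS : IsOpen {p : X × L | (f p.1, p.2) ∈ S}) : IsOpen S := by
  rw [isOpen_iff_continuous_mem] at hS ⊢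
  exact hf.continuous_lift_prod_left (g := fun p => p ∈ S) hS

/-- In compactly generated Hausdorff spaces a finite product of quotient maps is a quotient map.
The coordinates are replaced one at a time; each step takes place over a compact parameter space,
where the product with a quotient map is a quotient map. -/
theorem KProd.isQuotientMap_prod {N : ℕ} {E Z : Fin N → PtdSpace.{u}} [∀ i, T2Space (E i)]
    [∀ i, CompactlyCoherentSpace (E i)] [∀ i, T2Space (Z i)] (p : ∀ i, C(I × E i, Z i))
    (hp : ∀ i, IsQuotientMap (p i)) :
    IsQuotientMap fun a : (Fin N → I) × KProd E =>
      (KProd.mk fun i => p i (a.1 i, a.2.coord i) : KProd Z) := by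
  classical
  refine (isQuotientMap_iff _).2 ⟨isCoinducing_iff.2 fun S => ⟨fun hS => ?_, fun hS =>
    hS.preimage ?_⟩, fun z => ?_⟩
  rotate_left
  · refine KProd.continuous_mk fun i => (p i).continuous.comp (Continuous.prodMk ?_ ?_)
    · exact (continuous_apply i).comp continuous_fst
    · exact (KProd.continuous_coord i).comp continuous_snd
  · choose y hy using fun i => (hp i).surjective (z.coord i)
    refine ⟨(fun i => (y i).1, KProd.mk fun i => (y i).2), ?_⟩
    simp only [KProd.coord_mk, Prod.mk.eta, hy]
    rfl
  rw [CompactCoherentification.isOpen_iff]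
  intro K hK
  have : CompactSpace K := isCompact_iff_compactSpace.1 hK
  -- `A s`: the coordinates in `s` are taken from `K`, the others from the sources of the `p i`.
  let A : Finset (Fin N) → Set (((Fin N → I) × K) × KProd E) := fun s =>
    {a | (KProd.mk fun i => if i ∈ s then a.1.2.1 i else p i (a.1.1 i, a.2.coord i)) ∈ S}
  have hA : ∀ s, IsOpen (A s) := by
    intro s
    induction s using Finset.induction_on with
    | empty =>
      have : Continuous fun a : ((Fin N → I) × K) × KProd E => (a.1.1, a.2) := by fun_prop
      have h := IsOpen.preimage this hS
      simpa [A, preimage] using h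
    | insert j s hj ih =>
      rw [CompactlyCoherentSpace.isOpen_iff]
      intro L hL
      have : CompactSpace L := isCompact_iff_compactSpace.1 hL
      let O : Set (Z j × L) := {q | (KProd.mk fun i => Function.update
        (fun i => if i ∈ s then q.2.1.1.2.1 i else p i (q.2.1.1.1 i, q.2.1.2.coord i)) j q.1 i)
          ∈ S}
      have hO : IsOpen O := by
        refine (hp j).isOpen_of_preimage_prodMk ?_
        -- Overwriting the `j`-th coordinate reduces the claim to the set `A s`.
        let m : (I × E j) × L → ((Fin N → I) × K) × KProd E := fun q =>
          ((Function.update q.2.1.1.1 j q.1.1, q.2.1.1.2),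
            KProd.mk (Function.update (fun i => q.2.1.2.coord i) j q.1.2))
        have hm : Continuous m := by
          have : CompactlyCoherentSpace ((I × E j) × L) := by
            have h1 : CompactlyCoherentSpace ((L × I) × E j) := inferInstance
            refine CompactlyCoherentSpace.of_isOpen_forall_compactSpace fun T hT => ?_
            have e : Continuous fun q : (I × E j) × L => ((q.2, q.1.1), q.1.2) := by fun_prop
            have e' : Continuous fun q : (L × I) × E j => ((q.1.2, q.2), q.1.1) := by fun_prop
            have : IsOpen ((fun q : (L × I) × E j => ((q.1.2, q.2), q.1.1)) ⁻¹' T) :=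
              (CompactlyCoherentSpace.isOpen_iff_forall_compactSpace _).2
                fun M _ _ f hf => hT M _ (e'.comp hf)
            exact this.preimage e
          refine Continuous.prodMk (Continuous.prodMk ?_ (by fun_prop)) ?_
          · exact Continuous.update (by fun_prop) j (by fun_prop)
          · refine KProd.continuous_mk fun i => ?_
            refine (continuous_apply i).comp (Continuous.update ?_ j (by fun_prop))
            refine continuous_pi fun i => (KProd.continuous_coord i).comp (by fun_prop)
        convert ih.preimage hm using 1
        ext q
        simp only [mem_ofPred_eq, O, A, mem_preimage, m]
        refine iff_of_eq (congrArg (fun z => KProd.mk z ∈ S) (funext fun i => ?_))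
        by_cases hi : i = j
        · subst hi
          simp [hj]
        · simp [Function.update_of_ne hi]
      have hc : Continuous fun l : L => ((l.1.1.2.1 j : Z j), l) :=
        Continuous.prodMk ((continuous_apply j).comp (by fun_prop)) continuous_id
      convert hO.preimage hc using 1
      ext l
      simp only [mem_preimage, O, A, mem_ofPred_eq]
      refine iff_of_eq (congrArg (fun z => KProd.mk z ∈ S) (funext fun i => ?_))
      by_cases hi : i = j
      · subst hi
        simp
      · simp [hi]
  have hc : Continuous fun k : K => (((fun _ => 0, k), KProd.mk fun i => (E i).pt) :
      ((Fin N → I) × K) × KProd E) := by fun_prop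
  convert (hA Finset.univ).preimage hc using 1
  ext k
  simp [A, KProd.mk]

theorem isQuotientMap_susp_mk (X : PtdSpace.{u}) :
    IsQuotientMap fun p : I × X => (susp.mk p.1 p.2 : susp X) :=
  isQuotientMap_quot_mk

theorem isQuotientMap_cone_mk (X : PtdSpace.{u}) :
    IsQuotientMap fun p : I × X => (cone.mk p.1 p.2 : cone X) :=
  isQuotientMap_quot_mk

/-! ### CW complexes are well pointed -/

/-- A normalized deformation of a neighbourhood of the base point into the base point, as it exists
for a nondegenerate base point: the homotopy `h` starts at the identity, fixes the base point, and
at time `a < 1` has moved all points with `u ≤ a` to the base point. -/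
structure PointDeform (X : PtdSpace.{u}) where
  u : C(X, ℝ)
  h : C(I × X, X)
  u_nonneg : ∀ x, 0 ≤ u x
  u_pt : u X.pt = 0
  h_zero : ∀ x, h (0, x) = x
  h_pt : ∀ a, h (a, X.pt) = X.pt
  h_eq_pt : ∀ (a : I) x, u x ≤ a → (a : ℝ) < 1 → h (a, x) = X.pt

/-- A retraction of the cylinder `I × X` onto `0 × X ∪ I × {*}` gives a deformation with
`u = sup |a - R₁(a, ·)|` and `h = R₂`. -/
theorem PointDeform.of_retraction {X : PtdSpace.{u}} [T2Space X] (R : C(I × X, I × X))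
    (h0 : ∀ x, R (0, x) = (0, x)) (hpt : ∀ a, R (a, X.pt) = (a, X.pt))
    (hR : ∀ p, (R p).1 = 0 ∨ (R p).2 = X.pt) : Nonempty (PointDeform X) := by
  let d : C(X, C(I, ℝ)) := ContinuousMap.curry
    ⟨fun p : X × I => (p.2 : ℝ) - (R (p.2, p.1)).1, by fun_prop⟩
  refine ⟨⟨fun x => ‖d x‖, by fun_prop⟩, ⟨fun p => (R p).2, by fun_prop⟩,
    fun x => norm_nonneg (d x), ?_, fun x => congrArg Prod.snd (h0 x),
    fun a => congrArg Prod.snd (hpt a), ?_⟩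
  · have : d X.pt = 0 := by
      ext a
      simp [d, hpt]
    simp [this]
  · intro a x hx ha
    have hlt : ∀ b : I, a < b → (R (b, x)).2 = X.pt := by
      intro b hab
      refine (hR (b, x)).resolve_left fun h => ?_
      have h1 : ‖d x b‖ ≤ ‖d x‖ := (d x).norm_coe_le_norm b
      have h2 : d x b = b := by simp [d, h]
      rw [h2, Real.norm_of_nonneg b.2.1] at h1
      exact absurd (h1.trans hx) (not_le.2 hab)
    -- The equation passes to the limit `b → a`.
    have hclosed : IsClosed {b : I | (R (b, x)).2 = X.pt} :=
      isClosed_eq (by fun_prop) continuous_const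
    have ha' : a < 1 := ha
    have : a ∈ closure (Ioi a) := by
      rw [closure_Ioi' (a := a) ⟨1, ha'⟩]
      exact self_mem_Ici
    exact closure_minimal (fun b hb => hlt b hb) hclosed this

/-- A map on the image of a compact set is continuous if its composite with the parametrization
is. -/
theorem IsCompact.continuousOn_image {K Y Z : Type*} [TopologicalSpace K] [TopologicalSpace Y]
    [TopologicalSpace Z] [T2Space Y] {s : Set K} (hs : IsCompact s) {g : K → Y} {f : Y → Z}
    (hg : ContinuousOn g s) (hf : ContinuousOn (f ∘ g) s) : ContinuousOn f (g '' s) := by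
  rw [continuousOn_iff_isClosed]
  intro t ht
  obtain ⟨v, hv, hvt⟩ := continuousOn_iff_isClosed.1 hf t ht
  refine ⟨g '' (v ∩ s), ?_, ?_⟩
  · exact ((hs.inter_left hv).image_of_continuousOn (hg.mono inter_subset_right)).isClosed
  · rw [← hvt]
    ext y
    constructor
    · rintro ⟨hy, x, hx, rfl⟩
      exact ⟨⟨x, ⟨hy, hx⟩, rfl⟩, x, hx, rfl⟩
    · rintro ⟨⟨x, ⟨hx, hxs⟩, rfl⟩, -⟩
      exact ⟨hx, x, hxs, rfl⟩

namespace BallRetract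

/-- The factor of the projection of `I × Dⁿ` from the point `(2, 0)` onto `0 × Dⁿ ∪ I × ∂Dⁿ`,
where `Dⁿ` is the unit ball of the supremum norm. -/
def factor {n : ℕ} (a : I) (y : Fin n → ℝ) : ℝ := (max ((2 - (a : ℝ)) / 2) ‖y‖)⁻¹

variable {n : ℕ} (a : I) (y : Fin n → ℝ)

theorem max_pos : 0 < max ((2 - (a : ℝ)) / 2) ‖y‖ :=
  lt_max_of_lt_left (by linarith [a.2.2])

theorem factor_pos : 0 < factor a y := inv_pos.2 (max_pos a y)

/-- The first component of the projection of `I × Dⁿ` onto `0 × Dⁿ ∪ I × ∂Dⁿ`. -/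
def time : I := projIcc 0 1 zero_le_one (2 - factor a y * (2 - a))

/-- The second component of the projection of `I × Dⁿ` onto `0 × Dⁿ ∪ I × ∂Dⁿ`. -/
def point : Fin n → ℝ := factor a y • y

theorem continuous_factor : Continuous fun p : I × (Fin n → ℝ) => factor p.1 p.2 :=
  Continuous.inv₀ (by fun_prop) fun p => (max_pos p.1 p.2).ne'

theorem continuous_time : Continuous fun p : I × (Fin n → ℝ) => time p.1 p.2 :=
  continuous_projIcc.comp (continuous_const.sub (continuous_factor.mul (by fun_prop)))

theorem continuous_point : Continuous fun p : I × (Fin n → ℝ) => point p.1 p.2 :=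
  continuous_factor.smul continuous_snd

variable {y}

theorem norm_point_le : ‖point a y‖ ≤ 1 := by
  rw [point, norm_smul, Real.norm_of_nonneg (factor_pos a y).le, factor,
    inv_mul_le_iff₀ (max_pos a y), mul_one]
  exact le_max_right _ _

theorem time_eq_zero_or : time a y = 0 ∨ ‖point a y‖ = 1 := by
  rcases le_total ‖y‖ ((2 - (a : ℝ)) / 2) with h | h
  · left
    have : factor a y * (2 - a) = 2 := by
      have : (2 : ℝ) - a ≠ 0 := by linarith [a.2.2]
      rw [factor, max_eq_left h]
      field_simp
    simp [time, this]
  · right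
    have : 0 < ‖y‖ := lt_of_lt_of_le (by linarith [a.2.2]) h
    rw [point, norm_smul, Real.norm_of_nonneg (factor_pos a y).le, factor, max_eq_right h,
      inv_mul_cancel₀ this.ne']

theorem factor_eq_one (h : (a = 0 ∧ ‖y‖ ≤ 1) ∨ ‖y‖ = 1) : factor a y = 1 := by
  rcases h with ⟨rfl, h⟩ | h
  · simp [factor, h]
  · rw [factor, h, max_eq_right (by linarith [a.2.1]), inv_one]

theorem time_eq (h : (a = 0 ∧ ‖y‖ ≤ 1) ∨ ‖y‖ = 1) : time a y = a := by
  simp [time, factor_eq_one a h]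

theorem point_eq (h : (a = 0 ∧ ‖y‖ ≤ 1) ∨ ‖y‖ = 1) : point a y = y := by
  simp [point, factor_eq_one a h]

end BallRetract

namespace CWRetract

open RelCWComplex

variable {X : Type u} [TopologicalSpace X] [CWComplex (univ : Set X)] (x₀ : X)

open Classical in
/-- The retraction of `I × X` onto `0 × X ∪ I × {x₀}` over the cells of dimension less than `n`. On
the cylinder over such a cell other than `x₀` it projects to the base and the wall of
the cylinder and then applies the retraction over the cells of smaller dimension. Over
the points other than `x₀` in cells of dimension at least `n` it is the projection to `0 × X`. -/
def retr : ℕ → I × X → I × X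
  | 0, p => if p.2 = x₀ then p else (0, p.2)
  | n + 1, p =>
    if h : p.2 ≠ x₀ ∧ ∃ e : cell (univ : Set X) n, p.2 ∈ openCell n e then
      let y := (map n h.2.choose).symm p.2
      retr n (BallRetract.time p.1 y, map n h.2.choose (BallRetract.point p.1 y))
    else retr n p

variable {x₀}

theorem retr_succ_cell {n : ℕ} (e : cell (univ : Set X) n) {y : Fin n → ℝ}
    (hy : y ∈ Metric.ball 0 1) (hx : map n e y ≠ x₀) (a : I) :
    retr x₀ (n + 1) (a, map n e y) =
      retr x₀ n (BallRetract.time a y, map n e (BallRetract.point a y)) := by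
  have hmem : map n e y ∈ openCell n e := mem_image_of_mem _ hy
  have h : map n e y ≠ x₀ ∧ ∃ e' : cell (univ : Set X) n, map n e y ∈ openCell n e' :=
    ⟨hx, e, hmem⟩
  rw [retr, dif_pos h]
  have hsame : h.2.choose = e := by
    have := eq_of_not_disjoint_openCell (not_disjoint_iff.2 ⟨_, h.2.choose_spec, hmem⟩)
    simpa using this
  have hinv : (map n e).symm (map n e y) = y := (map n e).left_inv (by rwa [source_eq])
  simp only [hsame, hinv]

theorem retr_succ_of_lt {m n : ℕ} (hmn : m < n) (e : cell (univ : Set X) m) {x : X}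
    (hx : x ∈ openCell m e) (a : I) : retr x₀ (n + 1) (a, x) = retr x₀ n (a, x) := by
  rw [retr, dif_neg]
  rintro ⟨-, e', he'⟩
  have := eq_of_not_disjoint_openCell (not_disjoint_iff.2 ⟨_, hx, he'⟩)
  exact hmn.ne (Sigma.mk.inj this).1

theorem retr_pt (n : ℕ) (a : I) : retr x₀ n (a, x₀) = (a, x₀) := by
  induction n with
  | zero => simp [retr]
  | succ n ih => rw [retr, dif_neg (by simp), ih]

theorem retr_zero (n : ℕ) (x : X) : retr x₀ n (0, x) = (0, x) := by
  induction n generalizing x with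
  | zero => simp [retr]
  | succ n ih =>
    by_cases h : x ≠ x₀ ∧ ∃ e : cell (univ : Set X) n, x ∈ openCell n e
    · obtain ⟨hx, e, y, hy, rfl⟩ := h
      have hy' : ‖y‖ ≤ 1 := by simpa using (Metric.ball_subset_closedBall hy)
      rw [retr_succ_cell e hy hx, BallRetract.time_eq _ (Or.inl ⟨rfl, hy'⟩),
        BallRetract.point_eq _ (Or.inl ⟨rfl, hy'⟩), ih]
    · rw [retr, dif_neg h, ih]

theorem retr_mem (n : ℕ) (p : I × X) : (retr x₀ n p).1 = 0 ∨ (retr x₀ n p).2 = x₀ := by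
  induction n generalizing p with
  | zero =>
    rw [retr]
    split_ifs with h
    · exact Or.inr h
    · exact Or.inl rfl
  | succ n ih =>
    rw [retr]
    split_ifs with h
    · exact ih _
    · exact ih _

theorem exists_openCell_of_mem_closedCell {m : ℕ} (e : cell (univ : Set X) m) {x : X}
    (hx : x ∈ closedCell m e) : ∃ k ≤ m, ∃ e' : cell (univ : Set X) k, x ∈ openCell k e' := by
  rw [← cellFrontier_union_openCell_eq_closedCell] at hx
  rcases hx with hx | hx
  · obtain ⟨J, hJ⟩ := CWComplex.cellFrontier_subset_finite_openCell m e
    obtain ⟨k, hk, e', -, he'⟩ : ∃ k, k < m ∧ ∃ e' : cell (univ : Set X) k, e' ∈ J k ∧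
        x ∈ openCell k e' := by simpa using hJ hx
    exact ⟨k, hk.le, e', he'⟩
  · exact ⟨m, le_rfl, e, hx⟩

theorem retr_succ_of_closedCell {m n : ℕ} (hmn : m < n) (e : cell (univ : Set X) m) {x : X}
    (hx : x ∈ closedCell m e) (a : I) : retr x₀ (n + 1) (a, x) = retr x₀ n (a, x) := by
  obtain ⟨k, hk, e', he'⟩ := exists_openCell_of_mem_closedCell e hx
  exact retr_succ_of_lt (hk.trans_lt hmn) e' he' a

variable [T2Space X]

theorem continuousOn_closedCell {m n : ℕ} {e : cell (univ : Set X) m}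
    (h : ContinuousOn (fun p : I × (Fin m → ℝ) => retr x₀ n (p.1, map m e p.2))
      (univ ×ˢ Metric.closedBall 0 1)) :
    ContinuousOn (retr x₀ n) (univ ×ˢ closedCell m e) := by
  have hs : IsCompact ((univ : Set I) ×ˢ (Metric.closedBall 0 1 : Set (Fin m → ℝ))) :=
    isCompact_univ.prod (isCompact_closedBall _ _)
  have hg : ContinuousOn (fun p : I × (Fin m → ℝ) => (p.1, map m e p.2))
      (univ ×ˢ Metric.closedBall 0 1) :=
    continuous_fst.continuousOn.prodMk ((continuousOn m e).comp continuous_snd.continuousOn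
      fun p hp => hp.2)
  refine (hs.continuousOn_image hg h).mono ?_
  rintro ⟨a, _⟩ ⟨-, y, hy, rfl⟩
  exact ⟨(a, y), ⟨mem_univ _, hy⟩, rfl⟩

theorem continuousOn_cellFrontier {n : ℕ} (ih : ∀ m < n, ∀ e : cell (univ : Set X) m,
    ContinuousOn (retr x₀ n) (univ ×ˢ closedCell m e)) (e : cell (univ : Set X) n) :
    ContinuousOn (retr x₀ n) (univ ×ˢ cellFrontier n e) := by
  obtain ⟨J, hJ⟩ := CWComplex.cellFrontier_subset_finite_closedCell n e
  let ι := Σ m : Fin n, J m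
  have h : ContinuousOn (retr x₀ n)
      (⋃ i : ι, (univ : Set I) ×ˢ closedCell (C := (univ : Set X)) i.1 i.2.1) :=
    (locallyFinite_of_finite _).continuousOn_iUnion
      (fun i => isClosed_univ.prod isClosed_closedCell) fun i => ih _ i.1.2 _
  refine h.mono ?_
  rintro ⟨a, x⟩ ⟨-, hx⟩
  obtain ⟨m, hm, e', he', hx'⟩ : ∃ m, m < n ∧ ∃ e' : cell (univ : Set X) m, e' ∈ J m ∧
      x ∈ closedCell m e' := by simpa using hJ hx
  exact mem_iUnion.2 ⟨⟨⟨m, hm⟩, ⟨e', he'⟩⟩, mem_univ _, hx'⟩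

/-- The retraction over the cells of dimension less than `n` is continuous on the cylinders over
these cells. For a new cell, the retraction over the old ones is continuous on the base and the wall
of the cylinder, to which the cylinder is projected. -/
theorem continuousOn_retr {e₀ : cell (univ : Set X) 0} (he₀ : map 0 e₀ ![] = x₀) (n : ℕ) :
    ∀ m < n, ∀ e : cell (univ : Set X) m,
    ContinuousOn (fun p : I × (Fin m → ℝ) => retr x₀ n (p.1, map m e p.2))
      (univ ×ˢ Metric.closedBall 0 1) := by
  induction n with
  | zero => exact fun m hm => absurd hm (Nat.not_lt_zero m)
  | succ n ih =>
    intro m hm e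
    rcases (Nat.lt_succ_iff_lt_or_eq.1 hm) with hm | rfl
    · refine (ih m hm e).congr ?_
      rintro ⟨a, y⟩ ⟨-, hy⟩
      exact retr_succ_of_closedCell hm e (mem_image_of_mem _ hy) a
    by_cases hx₀ : x₀ ∈ openCell m e
    · -- The cell is the base point.
      have hm0 : m = 0 := by
        have h0 : x₀ ∈ openCell 0 e₀ := by
          rw [openCell_zero_eq_singleton]
          exact he₀.symm
        exact (Sigma.mk.inj (eq_of_not_disjoint_openCell (not_disjoint_iff.2 ⟨_, hx₀, h0⟩))).1
      subst hm0
      have hpt : ∀ y, map 0 e y = x₀ := by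
        intro y
        obtain ⟨y', -, hy'⟩ := hx₀
        rw [Subsingleton.elim y y', hy']
      simp only [hpt, retr_pt]
      fun_prop
    -- Elsewhere the new part is the old one composed with the projection of `I × Dᵐ`.
    let T : Set (I × (Fin m → ℝ)) := {0} ×ˢ Metric.closedBall 0 1 ∪ univ ×ˢ Metric.sphere 0 1
    have hT : ContinuousOn (fun p : I × (Fin m → ℝ) => retr x₀ m (p.1, map m e p.2)) T := by
      refine ContinuousOn.union_of_isClosed ?_ ?_ ?_ ?_
      · refine ContinuousOn.congr (f := fun p : I × (Fin m → ℝ) => (0, map m e p.2)) ?_ ?_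
        · exact continuousOn_const.prodMk ((continuousOn m e).comp continuous_snd.continuousOn
            fun p hp => hp.2)
        · rintro ⟨a, y⟩ ⟨ha, -⟩
          obtain rfl : a = 0 := ha
          exact retr_zero _ _
      · refine (continuousOn_cellFrontier (fun k hk e' => continuousOn_closedCell (ih k hk e'))
          e).comp (continuous_fst.continuousOn.prodMk ((continuousOn m e).comp
            continuous_snd.continuousOn fun p hp => Metric.sphere_subset_closedBall hp.2)) ?_
        rintro ⟨a, y⟩ ⟨-, hy⟩
        exact ⟨mem_univ _, mem_image_of_mem _ hy⟩
      · exact isClosed_singleton.prod Metric.isClosed_closedBall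
      · exact isClosed_univ.prod Metric.isClosed_sphere
    have hcomp := hT.comp (t := T) (s := univ ×ˢ Metric.closedBall 0 1)
      (f := fun p : I × (Fin m → ℝ) => (BallRetract.time p.1 p.2, BallRetract.point p.1 p.2))
      (BallRetract.continuous_time.prodMk BallRetract.continuous_point).continuousOn (by
        rintro ⟨a, y⟩ -
        rcases BallRetract.time_eq_zero_or a (y := y) with h | h
        · exact Or.inl ⟨h, by simpa using BallRetract.norm_point_le a⟩
        · exact Or.inr ⟨mem_univ _, by simpa using h⟩)
    refine hcomp.congr ?_
    rintro ⟨a, y⟩ ⟨-, hy⟩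
    have hy' : ‖y‖ ≤ 1 := by simpa using hy
    rcases hy'.lt_or_eq with h | h
    · have hyb : y ∈ Metric.ball (0 : Fin m → ℝ) 1 := by simpa using h
      refine retr_succ_cell e hyb (fun hx => hx₀ ?_) a
      rw [← hx]
      exact mem_image_of_mem _ hyb
    · have hfr : map m e y ∈ cellFrontier m e := mem_image_of_mem _ (by simpa using h)
      obtain ⟨J, hJ⟩ := CWComplex.cellFrontier_subset_finite_openCell m e
      obtain ⟨k, hk, e', -, he'⟩ : ∃ k, k < m ∧ ∃ e' : cell (univ : Set X) k, e' ∈ J k ∧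
          map m e y ∈ openCell k e' := by simpa using hJ hfr
      simp only [Function.comp, BallRetract.time_eq a (Or.inr h), BallRetract.point_eq a (Or.inr h)]
      exact retr_succ_of_lt hk e' he' a

theorem exists_retraction {e₀ : cell (univ : Set X) 0} (he₀ : map 0 e₀ ![] = x₀) :
    ∃ R : C(I × X, I × X), (∀ x, R (0, x) = (0, x)) ∧ (∀ a, R (a, x₀) = (a, x₀)) ∧
      ∀ p, (R p).1 = 0 ∨ (R p).2 = x₀ := by
  have hdim : ∀ x : X, ∃ n, ∃ e : cell (univ : Set X) n, x ∈ openCell n e := by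
    intro x
    have : x ∈ ⋃ (n : ℕ) (j : cell (univ : Set X) n), openCell n j := by
      rw [CWComplex.iUnion_openCell_eq_complex]
      exact mem_univ x
    simpa using this
  choose dim hd using hdim
  have hstable : ∀ (x : X) (m : ℕ) (e : cell (univ : Set X) m), x ∈ openCell m e → ∀ n, m < n →
      ∀ a, retr x₀ n (a, x) = retr x₀ (dim x + 1) (a, x) := by
    intro x m e hx n hmn a
    obtain ⟨e', he'⟩ := hd x
    obtain rfl : m = dim x :=
      (Sigma.mk.inj (eq_of_not_disjoint_openCell (not_disjoint_iff.2 ⟨_, hx, he'⟩))).1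
    induction n, hmn using Nat.le_induction with
    | base => rfl
    | succ n hn ih => rw [retr_succ_of_lt hn e' he', ih]
  -- Every point is retracted at the stage after its dimension, and the later stages agree.
  let ret : I × X → I × X := fun p => retr x₀ (dim p.2 + 1) p
  have hcell : ∀ n (e : cell (univ : Set X) n), ContinuousOn ret (univ ×ˢ closedCell n e) := by
    intro n e
    refine (continuousOn_closedCell (continuousOn_retr he₀ (n + 1) n (Nat.lt_succ_self n)
      e)).congr ?_
    rintro ⟨a, x⟩ ⟨-, hx⟩
    obtain ⟨k, hk, e', he'⟩ := exists_openCell_of_mem_closedCell e hx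
    exact (hstable x k e' he' (n + 1) (Nat.lt_succ_of_le hk) a).symm
  have hslice : ∀ x, Continuous fun a : I => ret (a, x) := by
    intro x
    obtain ⟨e, he⟩ := hd x
    rw [← continuousOn_univ]
    exact (hcell _ e).comp (by fun_prop) fun a _ => ⟨mem_univ _, openCell_subset_closedCell _ _ he⟩
  -- Continuity is checked on the adjoint map on `X`, since `X` has the weak topology of the cells.
  let G : X → C(I, I × X) := fun x => ⟨_, hslice x⟩
  have hG : Continuous G := by
    refine continuous_iff_isClosed.2 fun t ht => ?_
    rw [CWComplex.closed (univ : Set X) _ (subset_univ _)]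
    intro n e
    have hGe : ContinuousOn G (closedCell n e) := by
      rw [continuousOn_iff_continuous_domRestrict]
      have : Continuous fun p : closedCell (C := (univ : Set X)) n e × I => ret (p.2, p.1) :=
        (hcell n e).comp_continuous (by fun_prop) fun p => ⟨mem_univ _, p.1.2⟩
      exact (ContinuousMap.curry ⟨_, this⟩).continuous
    rw [inter_comm]
    exact hGe.preimage_isClosed_of_isClosed isClosed_closedCell ht
  refine ⟨⟨ret, ?_⟩, fun x => retr_zero _ _, fun a => retr_pt _ _, fun p => retr_mem _ _⟩
  have : Continuous fun p : X × I => G p.1 p.2 :=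
    ContinuousMap.continuous_uncurry_of_continuous ⟨G, hG⟩
  exact this.comp continuous_swap

end CWRetract

theorem IsPtdCW.nonempty_pointDeform (X : PtdSpace.{u}) [h : IsPtdCW X] :
    Nonempty (PointDeform X) := by
  have := h.t2
  obtain ⟨_, e, he⟩ := h.exists_cw
  obtain ⟨R, h0, hpt, hR⟩ := CWRetract.exists_retraction he
  exact PointDeform.of_retraction R h0 hpt hR

/-! ### Homotopies under a space and maps out of mapping cones -/

/-- The retraction of the real line onto the unit interval. -/
abbrev clamp (r : ℝ) : I := projIcc 0 1 zero_le_one r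

theorem clamp_coe (t : I) : clamp t = t := projIcc_val _ t

theorem clamp_of_nonpos {r : ℝ} (h : r ≤ 0) : clamp r = 0 := projIcc_of_le_left _ h

theorem clamp_of_one_le {r : ℝ} (h : 1 ≤ r) : clamp r = 1 := projIcc_of_right_le _ h

theorem continuous_clamp : Continuous clamp := continuous_projIcc

theorem coe_clamp {r : ℝ} (h0 : 0 ≤ r) (h1 : r ≤ 1) : (clamp r : ℝ) = r := by
  rw [clamp, projIcc_of_mem zero_le_one ⟨h0, h1⟩]

theorem ContinuousMap.HomotopicRel.of_map {X Y : Type*} [TopologicalSpace X] [TopologicalSpace Y]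
    {f g : C(X, Y)} {S : Set X} (F : C(I × X, Y)) (h0 : ∀ x, F (0, x) = f x)
    (h1 : ∀ x, F (1, x) = g x) (hS : ∀ t, ∀ x ∈ S, F (t, x) = f x) : f.HomotopicRel g S :=
  ⟨{ toContinuousMap := F, map_zero_left := h0, map_one_left := h1, prop' := hS }⟩

theorem ContinuousMap.HomotopicRel.precomp {W X Y : Type*} [TopologicalSpace W]
    [TopologicalSpace X] [TopologicalSpace Y] {f g : C(X, Y)} {S : Set X}
    (h : f.HomotopicRel g S) (k : C(W, X)) {T : Set W} (hk : MapsTo k T S) :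
    (f.comp k).HomotopicRel (g.comp k) T := by
  obtain ⟨F⟩ := h
  refine .of_map (F.toContinuousMap.comp ((ContinuousMap.id I).prodMap k)) (fun x => ?_)
    (fun x => ?_) fun t x hx => ?_
  · exact F.apply_zero _
  · exact F.apply_one _
  · exact F.eq_fst t (hk hx)

theorem PtdMap.ext {X Y : PtdSpace.{u}} {f g : PtdMap X Y} (h : ∀ x, f x = g x) : f = g := by
  obtain ⟨f, _⟩ := f
  obtain ⟨g, _⟩ := g
  obtain rfl : f = g := ContinuousMap.ext h
  rfl

theorem PtdMap.congr_apply {X Y : PtdSpace.{u}} {f g : PtdMap X Y} (h : f = g) (x : X) :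
    f x = g x := by rw [h]

/-- A homotopy followed by a pointed map. -/
def PtdMap.Homotopy.postcomp {X Y Z : PtdSpace.{u}} {r r' : PtdMap X Y} (γ : PtdMap Y Z)
    (K : PtdMap.Homotopy r r') : PtdMap.Homotopy (γ.comp r) (γ.comp r') :=
  K.compContinuousMap γ.map

namespace mapCone

variable {S Y Z : PtdSpace.{u}} {γ : PtdMap S Y}

theorem continuous_mk : Continuous fun p : I × S => mk γ p.1 p.2 :=
  continuous_quot_mk.comp continuous_inr

theorem mk_zero (s : S) : mk γ 0 s = (mapCone γ).pt := Quot.sound (Rel.zero s)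

theorem mk_pt (t : I) : mk γ t S.pt = (mapCone γ).pt := Quot.sound (Rel.base t)

theorem mk_one (s : S) : mk γ 1 s = incl γ (γ s) := Quot.sound (Rel.glue s)

theorem ind {P : mapCone γ → Prop} (h1 : ∀ y, P (incl γ y)) (h2 : ∀ t s, P (mk γ t s)) (x) :
    P x := by
  obtain ⟨y | ⟨t, s⟩⟩ := x
  · exact h1 y
  · exact h2 t s

/-- The map out of a mapping cone given by a map `u` on the target and a map `N` on the cone. -/
def desc (u : PtdMap Y Z) (N : C(I × S, Z)) (h0 : ∀ s, N (0, s) = Z.pt)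
    (hpt : ∀ t, N (t, S.pt) = Z.pt) (h1 : ∀ s, N (1, s) = u (γ s)) : PtdMap (mapCone γ) Z where
  map :=
    { toFun := Quot.lift (Sum.elim u N) (by
        rintro _ _ (s | t | s)
        · exact (h0 s).trans u.map_pt.symm
        · exact (hpt t).trans u.map_pt.symm
        · exact h1 s)
      continuous_toFun := continuous_quot_lift _ (u.continuous.sumElim N.continuous) }
  map_pt := u.map_pt

/-- Two maps out of a mapping cone that agree on the target `Y` are homotopic relative to `Y` if
their restrictions to the cone are joined by a homotopy with the right boundary values. -/
theorem homotopicRel {f g : PtdMap (mapCone γ) Z} (hY : ∀ y, f (incl γ y) = g (incl γ y))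
    (Θ : C(I × I × S, Z)) (hf : ∀ t s, Θ (0, t, s) = f (mk γ t s))
    (hg : ∀ t s, Θ (1, t, s) = g (mk γ t s)) (h0 : ∀ a s, Θ (a, 0, s) = Z.pt)
    (hpt : ∀ a t, Θ (a, t, S.pt) = Z.pt) (h1 : ∀ a s, Θ (a, 1, s) = f (incl γ (γ s))) :
    f.map.HomotopicRel g.map (range (incl γ)) := by
  let F : I × mapCone γ → Z := fun p => Quot.lift
    (Sum.elim (fun y => f (incl γ y)) fun q : I × S => Θ (p.1, q)) (by
      rintro _ _ (s | t | s)
      · exact (h0 _ s).trans f.map_pt.symm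
      · exact (hpt _ t).trans f.map_pt.symm
      · exact h1 _ s) p.2
  have hF : Continuous F := by
    refine (isQuotientMap_quot_mk (r := Rel γ)).continuous_lift_prod_right ?_
    -- The product of the interval with a sum is a sum of products.
    let G : C(Y ⊕ (I × S), C(I, Z)) :=
      { toFun := Sum.elim (fun y => ContinuousMap.const I (f (incl γ y)))
          (ContinuousMap.curry ⟨fun p : (I × S) × I => Θ (p.2, p.1), by fun_prop⟩)
        continuous_toFun := by
          refine Continuous.sumElim ?_ (ContinuousMap.continuous _)
          exact ContinuousMap.continuous_const'.comp (f.continuous.comp (incl γ).continuous) }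
    have : Continuous fun p : (Y ⊕ (I × S)) × I => G p.1 p.2 :=
      ContinuousMap.continuous_uncurry_of_continuous G
    refine (this.comp continuous_swap).congr ?_
    rintro ⟨a, y | q⟩ <;> rfl
  refine .of_map ⟨F, hF⟩ (fun x => ?_) (fun x => ?_) ?_
  · induction x using ind with
    | h1 y => rfl
    | h2 t s => exact hf t s
  · induction x using ind with
    | h1 y => exact hY y
    | h2 t s => exact hg t s
  · rintro a _ ⟨y, rfl⟩
    rfl

end mapCone

namespace IsHomotopyEquivUnder

variable {B C D E : PtdSpace.{u}} {a : PtdMap B C} {b : PtdMap B D} {c : PtdMap B E}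

theorem mapsTo_range {f : PtdMap C D} (h : f.comp a = b) : MapsTo f (range a) (range b) := by
  rintro _ ⟨x, rfl⟩
  exact ⟨x, (PtdMap.congr_apply h x).symm⟩

/-- A map under `B` with a left inverse and a right inverse up to homotopy under `B` is a homotopy
equivalence under `B`. -/
theorem of_inverses {φ : PtdMap C D} {l r : PtdMap D C} (hφ : φ.comp a = b) (hl : l.comp b = a)
    (hr : r.comp b = a) (h1 : (l.comp φ).map.HomotopicRel (PtdMap.id C).map (range a))
    (h2 : (φ.comp r).map.HomotopicRel (PtdMap.id D).map (range b)) :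
    IsHomotopyEquivUnder a b φ := by
  refine ⟨hφ, l, hl, h1, ?_⟩
  have h3 : l.map.HomotopicRel r.map (range b) := by
    have h4 := h1.precomp r.map (mapsTo_range hr)
    have h5 := h2.comp_continuousMap l.map
    exact h5.symm.trans h4
  exact (h3.comp_continuousMap φ.map).trans h2

theorem comp {φ : PtdMap C D} {ψ : PtdMap D E} (hψ : IsHomotopyEquivUnder b c ψ)
    (hφ : IsHomotopyEquivUnder a b φ) : IsHomotopyEquivUnder a c (ψ.comp φ) := by
  obtain ⟨h1, φ', h2, h3, h4⟩ := hφ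
  obtain ⟨k1, ψ', k2, k3, k4⟩ := hψ
  refine ⟨?_, φ'.comp ψ', ?_, ?_, ?_⟩
  · rw [← k1, ← h1]
    rfl
  · rw [← h2, ← k2]
    rfl
  · exact ((k3.precomp φ.map (mapsTo_range h1)).comp_continuousMap φ'.map).trans h3
  · exact ((h4.precomp ψ'.map (mapsTo_range k2)).comp_continuousMap ψ.map).trans k4

theorem congr {φ φ' : PtdMap C D} (hφ : IsHomotopyEquivUnder a b φ)
    (h : φ.map.HomotopicRel φ'.map (range a)) : IsHomotopyEquivUnder a b φ' := by
  obtain ⟨h1, ψ, h2, h3, h4⟩ := hφ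
  refine ⟨?_, ψ, h2, ?_, ?_⟩
  · rw [← h1]
    exact PtdMap.ext fun x => (h.fst_eq_snd (mem_range_self x)).symm
  · exact (h.symm.comp_continuousMap ψ.map).trans h3
  · exact (h.symm.precomp ψ.map (mapsTo_range h2)).trans h4

/-- If `ψ` and `φ ∘ ψ` are homotopy equivalences under `B`, then so is `φ`. -/
theorem of_comp_right {ψ : PtdMap C D} {φ : PtdMap D E} (hψ : IsHomotopyEquivUnder a b ψ)
    (h : IsHomotopyEquivUnder a c (φ.comp ψ)) : IsHomotopyEquivUnder b c φ := by
  obtain ⟨k1, ψ', k2, k3, k4⟩ := hψ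
  have hψ' : IsHomotopyEquivUnder b a ψ' := ⟨k2, ψ, k1, k4, k3⟩
  refine (h.comp hψ').congr ?_
  exact k4.comp_continuousMap φ.map

end IsHomotopyEquivUnder

/-! ### Mapping cones of homotopic and of equivalent maps -/

namespace mapCone

variable {S S' Y Z : PtdSpace.{u}}

section track

variable {γ γ' : PtdMap S Y} (H : PtdMap.Homotopy γ γ')

/-- The cone of `γ'` followed by the track of a homotopy from `γ` to `γ'`, run backwards, as a map
on `[0, 2] × S`. -/
def track (p : ℝ × S) : mapCone γ' :=
  if p.1 ≤ 1 then mk γ' (clamp p.1) p.2 else incl γ' (H (clamp (2 - p.1), p.2))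

theorem continuous_track : Continuous (track H) := by
  refine Continuous.if_le ?_ ?_ continuous_fst continuous_const ?_
  · exact continuous_mk.comp (f := fun p : ℝ × S => (clamp p.1, p.2))
      ((continuous_clamp.comp continuous_fst).prodMk continuous_snd)
  · refine (incl γ').continuous.comp (H.continuous.comp (Continuous.prodMk ?_ continuous_snd))
    exact continuous_clamp.comp (by fun_prop)
  · rintro ⟨t, s⟩ ht
    obtain rfl : t = 1 := ht
    rw [clamp_of_one_le (r := 2 - 1) (by norm_num), clamp_of_one_le le_rfl, mk_one, H.apply_one]

theorem track_zero (s : S) : track H (0, s) = (mapCone γ').pt := by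
  simp [track, mk_zero]

theorem track_of_le {t : ℝ} (h : t ≤ 1) (s : S) : track H (t, s) = mk γ' (clamp t) s := if_pos h

theorem track_one (s : S) : track H (1, s) = incl γ' (γ' s) := by
  rw [track_of_le H le_rfl, clamp_of_one_le le_rfl, mk_one]

theorem track_of_ge {t : ℝ} (h : 1 ≤ t) (s : S) :
    track H (t, s) = incl γ' (H (clamp (2 - t), s)) := by
  rcases h.eq_or_lt with rfl | h
  · rw [track_one, clamp_of_one_le (r := 2 - 1) (by norm_num), H.apply_one]
  · exact if_neg (not_le.2 h)

theorem track_two (s : S) : track H (2, s) = incl γ' (γ s) := by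
  rw [track_of_ge H one_le_two, clamp_of_nonpos (by norm_num), H.apply_zero]

theorem track_pt (t : ℝ) : track H (t, S.pt) = (mapCone γ').pt := by
  rcases le_total t 1 with h | h
  · rw [track_of_le H h, mk_pt]
  · rw [track_of_ge H h, H.eq_snd _ (mem_singleton _), γ'.map_pt]
    rfl

/-- The map of mapping cones `Y ∪_γ C S → Y ∪_γ' C S` induced by a homotopy from `γ` to `γ'`. -/
def ofHomotopy : PtdMap (mapCone γ) (mapCone γ') :=
  desc (incl γ') ⟨fun p => track H (2 * (p.1 : ℝ), p.2), (continuous_track H).comp (by fun_prop)⟩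
    (fun s => by simp [track_zero]) (fun t => track_pt H _) (fun s => by simp [track_two])

theorem ofHomotopy_mk (t : I) (s : S) :
    ofHomotopy H (mk γ t s) = track H (2 * (t : ℝ), s) := rfl

theorem ofHomotopy_incl (y : Y) : ofHomotopy H (incl γ y) = incl γ' y := rfl

/-- The maps of mapping cones induced by a homotopy and by the reversed homotopy are inverse up to
homotopy: the composite runs along the cone and the track to the end and back, and is contracted
linearly. -/
theorem ofHomotopy_symm_comp :
    ((ofHomotopy H.symm).comp (ofHomotopy H)).map.HomotopicRel (PtdMap.id (mapCone γ)).map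
      (range (incl γ)) := by
  let p : I → ℝ := fun t => min (4 * (t : ℝ)) (3 - 2 * t)
  have hp : Continuous p := by fun_prop
  refine homotopicRel (fun y => rfl) ⟨fun q : I × I × S =>
    track H.symm ((1 - (q.1 : ℝ)) * p q.2.1 + q.1 * q.2.1, q.2.2),
    (continuous_track _).comp (by fun_prop)⟩ (fun t s => ?_) (fun t s => ?_) (fun a s => ?_)
    (fun a t => track_pt _ _) (fun a s => ?_)
  · change track H.symm ((1 - ((0 : I) : ℝ)) * p t + ((0 : I) : ℝ) * t, s) =
      ofHomotopy H.symm (ofHomotopy H (mk γ t s))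
    rw [ofHomotopy_mk]
    simp only [Icc.coe_zero, sub_zero, one_mul, zero_mul, add_zero]
    rcases le_total (t : ℝ) (1 / 2) with h | h
    · rw [track_of_le H (by linarith), ofHomotopy_mk, coe_clamp (by linarith [t.2.1]) (by linarith)]
      congr 2
      rw [show p t = 4 * (t : ℝ) from min_eq_left (by linarith)]
      ring
    · rw [track_of_ge H (by linarith), ofHomotopy_incl,
        show p t = 3 - 2 * (t : ℝ) from min_eq_right (by linarith),
        track_of_ge H.symm (by linarith [t.2.2])]
      change incl γ (H (σ (clamp _), s)) = _
      congr 3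
      ext
      rw [coe_symm_eq, coe_clamp (by linarith) (by linarith [t.2.2]),
        coe_clamp (by linarith [t.2.2]) (by linarith)]
      ring
  · change track H.symm ((1 - ((1 : I) : ℝ)) * p t + ((1 : I) : ℝ) * t, s) = mk γ t s
    simp only [Icc.coe_one, sub_self, zero_mul, one_mul, zero_add]
    rw [track_of_le _ t.2.2, clamp_coe]
  · change track H.symm ((1 - (a : ℝ)) * p 0 + a * ((0 : I) : ℝ), s) = _
    have : p 0 = 0 := by simp [p]
    simp [this, track_zero]
  · change track H.symm ((1 - (a : ℝ)) * p 1 + a * ((1 : I) : ℝ), s) = _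
    have : p 1 = 1 := by norm_num [p]
    simp only [this, Icc.coe_one, mul_one, sub_add_cancel, track_one]
    rfl

theorem isHomotopyEquivUnder_ofHomotopy :
    IsHomotopyEquivUnder (incl γ) (incl γ') (ofHomotopy H) :=
  ⟨rfl, ofHomotopy H.symm, rfl, ofHomotopy_symm_comp H, by
    have h := ofHomotopy_symm_comp H.symm
    rwa [ContinuousMap.HomotopyRel.symm_symm] at h⟩

end track

/-- The map of mapping cones `Y ∪_{γ ∘ r} C S' → Y ∪_γ C S` induced by `r : S' → S`. -/
def ofSource (γ : PtdMap S Y) (r : PtdMap S' S) : PtdMap (mapCone (γ.comp r)) (mapCone γ) :=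
  desc (incl γ) ⟨fun p => mk γ p.1 (r p.2), continuous_mk.comp
    (continuous_fst.prodMk (r.continuous.comp continuous_snd))⟩ (fun _ => mk_zero _)
    (fun t => (congrArg (mk γ t) r.map_pt).trans (mk_pt t)) (fun _ => mk_one _)

theorem ofSource_mk (γ : PtdMap S Y) (r : PtdMap S' S) (t : I) (s : S') :
    ofSource γ r (mk _ t s) = mk γ t (r s) := rfl

/-- Two maps out of a mapping cone that agree on the target are homotopic relative to it if on the
cone they are `[t, s] ↦ N (t, 0, s)` and `[t, s] ↦ N (min 1 (2 t), min 1 (2 - 2 t), s)` for one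
map `N`: the two paths from `{0} × I` to `(1, 0)` in the unit square are joined linearly. -/
theorem homotopicRel_of_square {γ : PtdMap S Y} {f g : PtdMap (mapCone γ) Z}
    (hY : ∀ y, f (incl γ y) = g (incl γ y)) (N : C(I × I × S, Z))
    (h0 : ∀ b s, N (0, b, s) = Z.pt) (hpt : ∀ a b, N (a, b, S.pt) = Z.pt)
    (hg : ∀ t s, g (mk γ t s) = N (t, 0, s))
    (hf : ∀ t s, f (mk γ t s) = N (clamp (2 * (t : ℝ)), clamp (2 - 2 * (t : ℝ)), s)) :
    f.map.HomotopicRel g.map (range (incl γ)) := by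
  refine homotopicRel hY ⟨fun q : I × I × S =>
    N (clamp ((1 - (q.1 : ℝ)) * clamp (2 * (q.2.1 : ℝ)) + q.1 * q.2.1),
      clamp ((1 - (q.1 : ℝ)) * clamp (2 - 2 * (q.2.1 : ℝ))), q.2.2), ?_⟩ (fun t s => ?_)
    (fun t s => ?_) (fun a s => ?_) (fun a t => hpt _ _) (fun a s => ?_)
  · exact N.continuous.comp ((continuous_clamp.comp (by fun_prop)).prodMk
      ((continuous_clamp.comp (by fun_prop)).prodMk (by fun_prop)))
  · simp only [ContinuousMap.coe_mk, Icc.coe_zero, sub_zero, one_mul, zero_mul, add_zero, clamp_coe,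
      hf]
  · simp only [ContinuousMap.coe_mk, Icc.coe_one, sub_self, zero_mul, one_mul, zero_add, clamp_coe,
      hg, clamp_of_nonpos le_rfl]
  · simp only [ContinuousMap.coe_mk, Icc.coe_zero, mul_zero, clamp_of_nonpos le_rfl, add_zero, h0]
  · have h2 : clamp 2 = 1 := clamp_of_one_le (by norm_num)
    have h3 : clamp (2 - 2) = 0 := clamp_of_nonpos (by norm_num)
    rw [← mk_one, hf]
    simp only [ContinuousMap.coe_mk, Icc.coe_one, Icc.coe_zero, mul_zero, mul_one, h2, h3,
      clamp_of_nonpos le_rfl, sub_add_cancel, clamp_of_one_le le_rfl]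

/-- Homotopic maps `r` and `r'` into the source of `γ` induce homotopic maps of mapping cones, up
to the identification of the mapping cones of `γ ∘ r` and `γ ∘ r'`. -/
theorem ofSource_comp_ofHomotopy (γ : PtdMap S Y) {r r' : PtdMap S' S}
    (K : PtdMap.Homotopy r r') :
    ((ofSource γ r').comp (ofHomotopy (K.postcomp γ))).map.HomotopicRel (ofSource γ r).map
      (range (incl (γ.comp r))) := by
  refine homotopicRel_of_square (fun y => rfl) ⟨fun q : I × I × S' => mk γ q.1 (K q.2),
    continuous_mk.comp (continuous_fst.prodMk (K.continuous.comp continuous_snd))⟩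
    (fun _ _ => mk_zero _) (fun a b => ?_) (fun t s => ?_) (fun t s => ?_)
  · change mk γ a (K (b, S'.pt)) = _
    rw [K.eq_fst _ (mem_singleton _), r.map_pt, mk_pt]
  · change mk γ t (r s) = mk γ t (K (0, s))
    rw [K.apply_zero]
  · change ofSource γ r' (ofHomotopy _ (mk _ t s)) = mk γ _ (K (_, s))
    rw [ofHomotopy_mk]
    rcases le_total (t : ℝ) (1 / 2) with h | h
    · rw [track_of_le _ (by linarith), ofSource_mk, clamp_of_one_le (r := 2 - 2 * (t : ℝ))
        (by linarith), K.apply_one]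
    · rw [track_of_ge _ (by linarith), clamp_of_one_le (r := 2 * (t : ℝ)) (by linarith), mk_one]
      rfl

theorem ofSource_id (γ : PtdMap S Y) : ofSource γ (PtdMap.id S) = PtdMap.id (mapCone γ) := by
  refine PtdMap.ext fun x => ?_
  induction x using ind with
  | h1 y => rfl
  | h2 t s => rfl

/-- If `r ∘ q` is homotopic to the identity, then `Y ∪_{γ ∘ r ∘ q} C S → Y ∪_γ C S` is a homotopy
equivalence under `Y`. -/
theorem isHomotopyEquivUnder_ofSource_comp (γ : PtdMap S Y) {r : PtdMap S' S} {q : PtdMap S S'}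
    (h : (r.comp q).Homotopic (PtdMap.id S)) :
    IsHomotopyEquivUnder (incl ((γ.comp r).comp q)) (incl γ)
      ((ofSource γ r).comp (ofSource (γ.comp r) q)) := by
  obtain ⟨K⟩ := h
  have h1 := ofSource_comp_ofHomotopy γ K
  rw [ofSource_id] at h1
  have h2 : (ofSource γ r).comp (ofSource (γ.comp r) q) =
      (ofSource γ (r.comp q) : PtdMap (mapCone ((γ.comp r).comp q)) _) := by
    refine PtdMap.ext fun x => ?_
    induction x using ind with
    | h1 y => rfl
    | h2 t s => rfl
  have h3 := (isHomotopyEquivUnder_ofHomotopy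
    (PtdMap.Homotopy.postcomp (r := r.comp q) (r' := PtdMap.id S) γ K)).congr h1
  exact (congrArg (IsHomotopyEquivUnder _ _) h2).mpr h3

/-- A pointed homotopy equivalence `r` induces a homotopy equivalence of mapping cones
`Y ∪_{γ ∘ r} C S' → Y ∪_γ C S` under `Y`. -/
theorem isHomotopyEquivUnder_ofSource (γ : PtdMap S Y) {r : PtdMap S' S} {q : PtdMap S S'}
    (hrq : (r.comp q).Homotopic (PtdMap.id S)) (hqr : (q.comp r).Homotopic (PtdMap.id S')) :
    IsHomotopyEquivUnder (incl (γ.comp r)) (incl γ) (ofSource γ r) := by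
  -- Write `C r` for the induced map: both `C r ∘ C q` and `C q ∘ C r'` are equivalences, where `r'`
  -- is `r` over `γ ∘ r ∘ q`, so `C q` has inverses on both sides.
  have h1 := isHomotopyEquivUnder_ofSource_comp γ hrq
  have h2 := isHomotopyEquivUnder_ofSource_comp (γ.comp r) hqr
  refine IsHomotopyEquivUnder.of_comp_right (ψ := ofSource (γ.comp r) q) ?_ h1
  obtain ⟨-, e1, a1, b1, -⟩ := h1
  obtain ⟨-, e2, a2, -, c2⟩ := h2
  refine IsHomotopyEquivUnder.of_inverses (l := e1.comp (ofSource γ r))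
    (r := (ofSource ((γ.comp r).comp q) r).comp e2) rfl ?_ ?_ b1 c2
  · exact a1
  · exact congrArg (fun f => (ofSource ((γ.comp r).comp q) r).comp f) a2

end mapCone

/-! ### Attaching a contractible space along a cofibration -/

/-- Data presenting `J` as the result of attaching `D` to `Y` along a map `α : Q → Y`, where `Q` is
a subspace of `D` by way of `j`: the map `π` is a quotient map, and it identifies two points
only if they are equal or lie in `Q` and have the same image under `α`. -/
structure IsAttaching {Q D Y J : PtdSpace.{u}} (j : PtdMap Q D) (α : PtdMap Q Y) (π : PtdMap D J)
    (b : PtdMap Y J) : Prop where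
  isEmbedding : IsEmbedding j
  isQuotientMap : IsQuotientMap π
  surjective : Function.Surjective α
  comm : ∀ z, π (j z) = b (α z)
  eq_or : ∀ d d', π d = π d' → d = d' ∨ ∃ z z', j z = d ∧ j z' = d' ∧ α z = α z'

/-- A pointed contraction of `D`, from the constant map at time `0` to the identity at time `1`. -/
structure PtdContraction (D : PtdSpace.{u}) where
  c : C(I × D, D)
  c_zero : ∀ d, c (0, d) = D.pt
  c_one : ∀ d, c (1, d) = d
  c_pt : ∀ t, c (t, D.pt) = D.pt

/-- A deformation of a closed neighbourhood `w ≤ 1` of the image of `j : Q → D` into the image,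
relative to the image, on which `w` vanishes. -/
structure NbhdDeform {Q D : PtdSpace.{u}} (j : PtdMap Q D) where
  w : C(D, ℝ)
  g : C(I × D, D)
  w_apply : ∀ z, w (j z) = 0
  g_zero : ∀ d, g (0, d) = d
  g_apply : ∀ t z, g (t, j z) = j z
  g_one : ∀ d, w d ≤ 1 → ∃ z, j z = g (1, d)

/-- The map `Y ∪_α C Q → J` that sends `[t, z]` to the class of the point `c (t, z)` on the path
from the base point to `z` in `D`. -/
def PtdContraction.coneMap {Q D Y J : PtdSpace.{u}} {j : PtdMap Q D} {α : PtdMap Q Y}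
    {π : PtdMap D J} {b : PtdMap Y J} (c : PtdContraction D) (h : ∀ z, π (j z) = b (α z)) :
    PtdMap (mapCone α) J :=
  mapCone.desc b ⟨fun p => π (c.c (p.1, j p.2)), π.continuous.comp (c.c.continuous.comp
    (continuous_fst.prodMk (j.continuous.comp continuous_snd)))⟩
    (fun z => (congrArg π (c.c_zero _)).trans π.map_pt)
    (fun t => by
      change π (c.c (t, j Q.pt)) = _
      rw [j.map_pt, c.c_pt, π.map_pt])
    (fun z => (congrArg π (c.c_one _)).trans (h z))

namespace NbhdDeform

variable {Q D Y : PtdSpace.{u}} {j : PtdMap Q D} (n : NbhdDeform j)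

open Classical in
/-- The end point in `Q` of the deformation of a point of the neighbourhood `w ≤ 1`; the value
outside the neighbourhood is not used. -/
def endpoint (d : D) : Q := if h : ∃ z, j z = n.g (1, d) then h.choose else Q.pt

theorem apply_endpoint {d : D} (hd : n.w d ≤ 1) : j (n.endpoint d) = n.g (1, d) := by
  have h := n.g_one d hd
  rw [endpoint, dif_pos h]
  exact h.choose_spec

theorem endpoint_apply (hj : Function.Injective j) (z : Q) : n.endpoint (j z) = z := by
  refine hj ?_
  rw [n.apply_endpoint (by simp [n.w_apply]), n.g_apply]

theorem continuousOn_endpoint (hj : IsEmbedding j) :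
    ContinuousOn n.endpoint {d | n.w d ≤ 1} := by
  rw [hj.continuousOn_iff]
  have : Continuous fun d => n.g (1, d) := by fun_prop
  exact this.continuousOn.congr fun d hd => n.apply_endpoint hd

/-- The family of maps `D → Y ∪_α C Q` that extends `z ↦ [ρ, z]` on `Q`: a point near `Q` is
deformed to `Q` and its level in the cone is scaled by its distance from `Q`. -/
def toMapCone (α : PtdMap Q Y) (p : I × D) : mapCone α :=
  if n.w p.2 ≤ 1 then mapCone.mk α (clamp (p.1 * (1 - n.w p.2))) (n.endpoint p.2)
  else (mapCone α).pt

variable (α : PtdMap Q Y)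

theorem continuous_toMapCone (hj : IsEmbedding j) : Continuous (n.toMapCone α) := by
  refine continuous_if_le (by fun_prop) continuous_const ?_ continuousOn_const ?_
  · refine mapCone.continuous_mk.comp_continuousOn (ContinuousOn.prodMk ?_ ?_)
    · exact (continuous_clamp.comp (by fun_prop)).continuousOn
    · exact (n.continuousOn_endpoint hj).comp continuous_snd.continuousOn fun p hp => hp
  · intro p hp
    simp [hp, mapCone.mk_zero]

theorem toMapCone_apply (hj : Function.Injective j) (t : I) (z : Q) :
    n.toMapCone α (t, j z) = mapCone.mk α t z := by
  simp [toMapCone, n.w_apply, n.endpoint_apply hj]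

theorem toMapCone_zero (d : D) : n.toMapCone α (0, d) = (mapCone α).pt := by
  simp [toMapCone, mapCone.mk_zero]

end NbhdDeform

/-- If `D` is contractible and `Q → D` is a cofibration, then attaching `D` to `Y` along
`α : Q → Y` gives the mapping cone of `α`, up to homotopy equivalence under `Y`. -/
theorem IsAttaching.isHomotopyEquivUnder {Q D Y J : PtdSpace.{u}} {j : PtdMap Q D}
    {α : PtdMap Q Y} {π : PtdMap D J} {b : PtdMap Y J} (h : IsAttaching j α π b)
    (c : PtdContraction D) (n : NbhdDeform j) :
    IsHomotopyEquivUnder (mapCone.incl α) b (c.coneMap h.comm) := by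
  have hj := h.isEmbedding.injective
  let Ψ := n.toMapCone α
  have hΨ : Continuous Ψ := n.continuous_toMapCone α h.isEmbedding
  have hΨQ : ∀ t z, Ψ (t, j z) = mapCone.mk α t z := n.toMapCone_apply α hj
  have hΨpt : ∀ t, Ψ (t, D.pt) = (mapCone α).pt := fun t => by
    rw [← j.map_pt, hΨQ, mapCone.mk_pt]
  -- The inverse is induced by `Ψ (1, ·)`.
  have hdesc : ∀ d d', π d = π d' → Ψ (1, d) = Ψ (1, d') := by
    intro d d' hd
    rcases h.eq_or d d' hd with rfl | ⟨z, z', rfl, rfl, hz⟩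
    · rfl
    · rw [hΨQ, hΨQ, mapCone.mk_one, mapCone.mk_one, hz]
  let s : J → D := Function.surjInv h.isQuotientMap.surjective
  have hs : ∀ x, π (s x) = x := Function.surjInv_eq h.isQuotientMap.surjective
  have hψ : ∀ d, Ψ (1, s (π d)) = Ψ (1, d) := fun d => hdesc _ _ (hs _)
  let ψ : PtdMap J (mapCone α) :=
    { map := ⟨fun x => Ψ (1, s x), by
        refine h.isQuotientMap.continuous_iff.2 ?_
        exact (hΨ.comp (continuous_const.prodMk continuous_id)).congr fun d => (hψ d).symm⟩
      map_pt := by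
        change Ψ (1, s J.pt) = _
        rw [← π.map_pt, hψ, hΨpt] }
  have hψπ : ∀ d, ψ (π d) = Ψ (1, d) := hψ
  have hψb : ψ.comp b = mapCone.incl α := by
    refine PtdMap.ext fun y => ?_
    obtain ⟨z, rfl⟩ := h.surjective y
    change ψ (b (α z)) = _
    rw [← h.comm, hψπ, hΨQ, mapCone.mk_one]
  refine ⟨rfl, ψ, hψb, ?_, ?_⟩
  · -- `ψ ∘ φ` sends `[t, z]` to `Ψ (1, c (t, z))`, the identity sends it to `Ψ (t, c (1, z))`; the
    -- path through `Ψ (t, c (t, z))` keeps the ends of the cone fixed.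
    refine mapCone.homotopicRel (fun y => PtdMap.congr_apply hψb y) ⟨fun q : I × I × Q =>
      Ψ (clamp (max (q.2.1 : ℝ) (1 - 2 * q.1)),
        c.c (clamp (max (q.2.1 : ℝ) (2 * q.1 - 1)), j q.2.2)), ?_⟩ (fun t z => ?_) (fun t z => ?_)
      (fun a z => ?_) (fun a t => ?_) (fun a z => ?_)
    · refine hΨ.comp (Continuous.prodMk (continuous_clamp.comp (by fun_prop))
        (c.c.continuous.comp (Continuous.prodMk (continuous_clamp.comp (by fun_prop)) ?_)))
      exact j.continuous.comp (by fun_prop)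
    · change Ψ (clamp (max (t : ℝ) (1 - 2 * ((0 : I) : ℝ))),
        c.c (clamp (max (t : ℝ) (2 * ((0 : I) : ℝ) - 1)), j z)) = ψ (π (c.c (t, j z)))
      rw [hψπ]
      simp only [Icc.coe_zero, mul_zero, sub_zero, zero_sub]
      rw [clamp_of_one_le (le_max_right _ _), max_eq_left (by linarith [t.2.1]), clamp_coe]
    · change Ψ (clamp (max (t : ℝ) (1 - 2 * ((1 : I) : ℝ))),
        c.c (clamp (max (t : ℝ) (2 * ((1 : I) : ℝ) - 1)), j z)) = mapCone.mk α t z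
      simp only [Icc.coe_one, mul_one]
      rw [max_eq_left (by linarith [t.2.1]), clamp_coe,
        clamp_of_one_le (le_max_of_le_right (by norm_num)), c.c_one, hΨQ]
    · change Ψ (clamp (max ((0 : I) : ℝ) (1 - 2 * a)),
        c.c (clamp (max ((0 : I) : ℝ) (2 * a - 1)), j z)) = _
      rw [Icc.coe_zero]
      rcases le_total (a : ℝ) (1 / 2) with ha | ha
      · rw [clamp_of_nonpos (r := max 0 (2 * (a : ℝ) - 1)) (max_le le_rfl (by linarith)), c.c_zero,
          hΨpt]
      · rw [clamp_of_nonpos (r := max 0 (1 - 2 * (a : ℝ))) (max_le le_rfl (by linarith))]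
        exact n.toMapCone_zero α _
    · change Ψ (_, c.c (_, j Q.pt)) = _
      rw [j.map_pt, c.c_pt, hΨpt]
    · change Ψ (clamp (max ((1 : I) : ℝ) (1 - 2 * a)),
        c.c (clamp (max ((1 : I) : ℝ) (2 * a - 1)), j z)) = ψ (b (α z))
      rw [Icc.coe_one, clamp_of_one_le (le_max_left _ _), clamp_of_one_le (le_max_left _ _),
        c.c_one, ← h.comm, hψπ]
  · -- Descends to `J` from the homotopy that undoes the scaling and the deformation on `D`.
    let Φ : I × D → J := fun p =>
      π (c.c (clamp (max (1 - n.w p.2) p.1), n.g (σ p.1, p.2)))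
    have hΦ : Continuous Φ := π.continuous.comp (c.c.continuous.comp
      (Continuous.prodMk (continuous_clamp.comp (by fun_prop)) (n.g.continuous.comp (by fun_prop))))
    have hΦQ : ∀ t z, Φ (t, j z) = b (α z) := by
      intro t z
      change π (c.c (clamp (max (1 - n.w (j z)) t), n.g (σ t, j z))) = _
      rw [n.w_apply, n.g_apply, sub_zero, clamp_of_one_le (le_max_left _ _), c.c_one, h.comm]
    have hΦs : ∀ t d, Φ (t, s (π d)) = Φ (t, d) := by
      intro t d
      rcases h.eq_or _ _ (hs (π d)) with h' | ⟨z, z', hz, hz', hzz'⟩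
      · rw [h']
      · rw [← hz, ← hz', hΦQ, hΦQ, hzz']
    refine .of_map ⟨fun p : I × J => Φ (p.1, s p.2), ?_⟩ (fun x => ?_) (fun x => ?_) ?_
    · exact h.isQuotientMap.continuous_lift_prod_right (hΦ.congr fun p => (hΦs _ _).symm)
    · obtain ⟨d, rfl⟩ := h.isQuotientMap.surjective x
      change Φ (0, s (π d)) = c.coneMap h.comm (ψ (π d))
      rw [hΦs, hψπ]
      change π (c.c (clamp (max (1 - n.w d) 0), n.g (σ 0, d))) = c.coneMap h.comm (n.toMapCone α _)
      rw [symm_zero, NbhdDeform.toMapCone]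
      by_cases hd : n.w d ≤ 1
      · rw [if_pos hd, max_eq_left (by linarith)]
        change _ = π (c.c (_, j _))
        rw [n.apply_endpoint hd, Icc.coe_one, one_mul]
      · rw [if_neg hd, max_eq_right (by linarith), clamp_of_nonpos le_rfl, c.c_zero, π.map_pt,
          (c.coneMap h.comm).map_pt]
    · obtain ⟨d, rfl⟩ := h.isQuotientMap.surjective x
      change Φ (1, s (π d)) = π d
      rw [hΦs]
      change π (c.c (clamp (max (1 - n.w d) ((1 : I) : ℝ)), n.g (σ 1, d))) = _
      rw [symm_one, n.g_zero, Icc.coe_one, clamp_of_one_le (le_max_right _ _), c.c_one]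
    · rintro t _ ⟨y, rfl⟩
      obtain ⟨z, rfl⟩ := h.surjective y
      change Φ (t, s (b (α z))) = c.coneMap h.comm (ψ (b (α z)))
      rw [← h.comm, hΦs, hΦQ, hψπ, hΨQ, mapCone.mk_one]
      rfl

/-! ### Deformations of a cone near its base and its vertex -/

theorem Topology.IsQuotientMap.prodMap_id {L X Y : Type*} [TopologicalSpace L]
    [LocallyCompactSpace L] [TopologicalSpace X] [TopologicalSpace Y] {f : X → Y}
    (hf : IsQuotientMap f) : IsQuotientMap (Prod.map id f : L × X → L × Y) := by
  refine (isQuotientMap_iff _).2 ⟨isCoinducing_iff.2 fun S => ⟨fun hS => ?_, fun hS =>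
    hS.preimage (continuous_id.prodMap hf.continuous)⟩,
    Function.surjective_id.prodMap hf.surjective⟩
  rw [isOpen_iff_continuous_mem] at hS ⊢
  exact hf.continuous_lift_prod_right (g := fun p => p ∈ S) hS

namespace cone

variable {X : PtdSpace.{u}}

theorem mk_eq_pt_iff {t : I} {x : X} : mk t x = (cone X).pt ↔ t = 0 ∨ x = X.pt := by
  refine Collapse.mk_eq_iff.trans ⟨?_, fun h => Or.inr ⟨h, Or.inl rfl⟩⟩
  rintro (h | h)
  · exact Or.inl (Prod.ext_iff.1 h).1
  · exact h.1

theorem ind {P : cone X → Prop} (h : ∀ t x, P (mk t x)) (c : cone X) : P c := by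
  obtain ⟨t, x⟩ := c
  exact h t x

/-- A point of the cone is on the rim if it lies in the base `X`; this includes the base point,
which is the image of the vertex. -/
def IsRim (c : cone X) : Prop := ∃ x, c = mk 1 x

theorem isRim_mk_one (x : X) : IsRim (mk 1 x) := ⟨x, rfl⟩

theorem isRim_pt : IsRim (cone X).pt := ⟨X.pt, (mk_eq_pt_iff.2 (Or.inr rfl)).symm⟩

theorem isRim_mk_iff {t : I} {x : X} : IsRim (mk t x) ↔ t = 1 ∨ t = 0 ∨ x = X.pt := by
  constructor
  · rintro ⟨y, hy⟩
    rcases Collapse.mk_eq_iff.1 hy with h | h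
    · exact Or.inl (Prod.ext_iff.1 h).1
    · exact Or.inr h.1
  · rintro (rfl | h)
    · exact isRim_mk_one x
    · rw [mk_eq_pt_iff.2 h]
      exact isRim_pt

/-- Scaling of the cone coordinate. -/
def scale : C(I × cone X, cone X) where
  toFun p := Quot.map (fun q : I × X => (p.1 * q.1, q.2)) (fun a b h =>
    ⟨h.1.imp_left fun h => by simp [h], h.2.imp_left fun h => by simp [h]⟩) p.2
  continuous_toFun := by
    refine (isQuotientMap_cone_mk X).continuous_lift_prod_right ?_
    exact (isQuotientMap_cone_mk X).continuous.comp
      (f := fun p : I × (I × X) => (p.1 * p.2.1, p.2.2)) (by fun_prop)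

theorem scale_mk (s t : I) (x : X) : scale (s, mk t x) = mk (s * t) x := rfl

theorem scale_zero (c : cone X) : scale (0, c) = (cone X).pt := by
  induction c using ind with
  | h t x => rw [scale_mk, zero_mul, mk_eq_pt_iff.2 (Or.inl rfl)]

theorem scale_one (c : cone X) : scale (1, c) = c := by
  induction c using ind with
  | h t x => rw [scale_mk, one_mul]

theorem scale_pt (s : I) : scale (s, (cone X).pt) = (cone X).pt := by
  change scale (s, mk 0 X.pt) = _
  rw [scale_mk, mk_eq_pt_iff.2 (Or.inr rfl)]

/-- The cone of a pointed map. -/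
def map {Y : PtdSpace.{u}} (f : PtdMap X Y) : PtdMap (cone X) (cone Y) where
  map := Collapse.map ((ContinuousMap.id I).prodMap f.map) (by
    rintro ⟨t, x⟩ (h | h)
    · exact Or.inl h
    · exact Or.inr ((congrArg f h).trans f.map_pt))
  map_pt := Collapse.mk_eq (Or.inl rfl) (Or.inl rfl)

theorem map_mk {Y : PtdSpace.{u}} (f : PtdMap X Y) (t : I) (x : X) : map f (mk t x) = mk t (f x) :=
  rfl

theorem map_scale {Y : PtdSpace.{u}} (f : PtdMap X Y) (s : I) (c : cone X) :
    map f (scale (s, c)) = scale (s, map f c) := by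
  induction c using ind with
  | h t x => rfl

/-- The expansion of the interval about its midpoint by the factor `1 + 4 a`, cut off at the ends:
it moves the points of distance at most `a ≤ 1 / 4` from an end to that end. -/
def stretch (a t : I) : I := clamp ((1 + 4 * (a : ℝ)) * (t - 1 / 2) + 1 / 2)

theorem continuous_stretch : Continuous fun p : I × I => stretch p.1 p.2 :=
  continuous_clamp.comp (by fun_prop)

theorem stretch_zero_left (t : I) : stretch 0 t = t := by simp [stretch]

theorem stretch_eq_zero {a t : I} (h : t ≤ (a : ℝ)) (ha : (a : ℝ) ≤ 1 / 4) : stretch a t = 0 :=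
  clamp_of_nonpos (by nlinarith [a.2.1])

theorem stretch_eq_one {a t : I} (h : 1 - t ≤ (a : ℝ)) (ha : (a : ℝ) ≤ 1 / 4) : stretch a t = 1 :=
  clamp_of_one_le (by nlinarith [a.2.1])

theorem stretch_zero_right (a : I) : stretch a 0 = 0 :=
  clamp_of_nonpos (by rw [Icc.coe_zero]; nlinarith [a.2.1])

theorem stretch_one_right (a : I) : stretch a 1 = 1 :=
  clamp_of_one_le (by rw [Icc.coe_one]; nlinarith [a.2.1])

end cone

namespace PointDeform

open cone

variable {X : PtdSpace.{u}} (δ : PointDeform X)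

/-- The distance of a point of the cone from the base point. -/
def vertexDist : C(cone X, ℝ) where
  toFun := Quot.lift (fun p => min (p.1 : ℝ) (δ.u p.2)) (by
    have h : ∀ p : I × X, p.1 = 0 ∨ p.2 = X.pt → min (p.1 : ℝ) (δ.u p.2) = 0 := by
      rintro p (h | h)
      · simp [h, δ.u_nonneg]
      · simp [h, δ.u_pt, p.1.2.1]
    intro a b hab
    rw [h a hab.1, h b hab.2])
  continuous_toFun := continuous_quot_lift _ (by fun_prop)

/-- The distance of a point of the cone from the rim. -/
def rimDist : C(cone X, ℝ) where
  toFun := Quot.lift (fun p => min (1 - (p.1 : ℝ)) (min (p.1 : ℝ) (δ.u p.2))) (by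
    have h : ∀ p : I × X, p.1 = 0 ∨ p.2 = X.pt →
        min (1 - (p.1 : ℝ)) (min (p.1 : ℝ) (δ.u p.2)) = 0 := by
      rintro p (h | h)
      · simp [h, δ.u_nonneg]
      · simp [h, δ.u_pt, p.1.2.1, p.1.2.2]
    intro a b hab
    rw [h a hab.1, h b hab.2])
  continuous_toFun := continuous_quot_lift _ (by fun_prop)

/-- The deformation of the cone that moves the points close to the rim into the rim. -/
def coneDeform : C(I × cone X, cone X) where
  toFun p := Quot.map (fun q : I × X => (stretch p.1 q.1, δ.h (p.1, q.2))) (by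
    have h : ∀ q : I × X, q.1 = 0 ∨ q.2 = X.pt →
        stretch p.1 q.1 = 0 ∨ δ.h (p.1, q.2) = X.pt := by
      rintro q (h | h)
      · exact Or.inl (by rw [h, stretch_zero_right])
      · exact Or.inr (by rw [h, δ.h_pt])
    exact fun a b hab => ⟨h a hab.1, h b hab.2⟩) p.2
  continuous_toFun := by
    refine (isQuotientMap_cone_mk X).continuous_lift_prod_right ?_
    refine (isQuotientMap_cone_mk X).continuous.comp
      (f := fun p : I × (I × X) => (stretch p.1 p.2.1, δ.h (p.1, p.2.2))) (Continuous.prodMk ?_ ?_)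
    · exact continuous_stretch.comp (f := fun p : I × (I × X) => (p.1, p.2.1)) (by fun_prop)
    · fun_prop

theorem coneDeform_mk (a t : I) (x : X) :
    δ.coneDeform (a, cone.mk t x) = cone.mk (stretch a t) (δ.h (a, x)) := rfl

theorem coneDeform_zero (c : cone X) : δ.coneDeform (0, c) = c := by
  induction c using cone.ind with
  | h t x => rw [coneDeform_mk, stretch_zero_left, δ.h_zero]

theorem coneDeform_pt (a : I) : δ.coneDeform (a, (cone X).pt) = (cone X).pt := by
  change δ.coneDeform (a, cone.mk 0 X.pt) = _
  rw [coneDeform_mk, δ.h_pt, mk_eq_pt_iff.2 (Or.inr rfl)]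

theorem isRim_coneDeform (a : I) {c : cone X} (hc : IsRim c) : IsRim (δ.coneDeform (a, c)) := by
  obtain ⟨x, rfl⟩ := hc
  rw [coneDeform_mk, stretch_one_right]
  exact isRim_mk_one _

theorem vertexDist_pt : δ.vertexDist (cone X).pt = 0 := by
  change min ((0 : I) : ℝ) (δ.u X.pt) = 0
  simp [δ.u_pt]

theorem vertexDist_nonneg (c : cone X) : 0 ≤ δ.vertexDist c := by
  induction c using cone.ind with
  | h t x => exact le_min t.2.1 (δ.u_nonneg x)

theorem rimDist_nonneg (c : cone X) : 0 ≤ δ.rimDist c := by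
  induction c using cone.ind with
  | h t x => exact le_min (sub_nonneg.2 t.2.2) (le_min t.2.1 (δ.u_nonneg x))

theorem rimDist_eq_zero {c : cone X} (hc : IsRim c) : δ.rimDist c = 0 := by
  obtain ⟨x, rfl⟩ := hc
  change min (1 - ((1 : I) : ℝ)) (min ((1 : I) : ℝ) (δ.u x)) = 0
  simp [δ.u_nonneg]

theorem coneDeform_eq_pt {a : I} (ha : (a : ℝ) ≤ 1 / 4) {c : cone X} (hc : δ.vertexDist c ≤ a) :
    δ.coneDeform (a, c) = (cone X).pt := by
  induction c using cone.ind with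
  | h t x =>
    rw [coneDeform_mk, mk_eq_pt_iff]
    rcases min_le_iff.1 hc with h | h
    · exact Or.inl (stretch_eq_zero h ha)
    · exact Or.inr (δ.h_eq_pt a x h (by linarith))

theorem isRim_coneDeform_of_le {a : I} (ha : (a : ℝ) ≤ 1 / 4) {c : cone X}
    (hc : δ.rimDist c ≤ a) : IsRim (δ.coneDeform (a, c)) := by
  induction c using cone.ind with
  | h t x =>
    rw [coneDeform_mk, isRim_mk_iff]
    rcases min_le_iff.1 hc with h | h
    · exact Or.inl (stretch_eq_one h ha)
    · rcases min_le_iff.1 h with h | h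
      · exact Or.inr (Or.inl (stretch_eq_zero h ha))
      · exact Or.inr (Or.inr (δ.h_eq_pt a x h (by linarith)))

end PointDeform

/-! ### The product of the cones and its boundary -/

section coneProd

open cone

variable {n : ℕ} (E : Fin (n + 2) → PtdSpace.{u})

/-- The product `C E₁ × ⋯ × C Eₙ₊₂` of the cones. -/
def coneProd : PtdSpace.{u} where
  carrier := KProd fun i => cone (E i)
  pt := KProd.mk fun i => (cone (E i)).pt

variable {E}

theorem coneProd.ext {d d' : coneProd E}
    (h : ∀ i, KProd.coord (E := fun i => cone (E i)) d i = KProd.coord d' i) : d = d' :=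
  (CompactCoherentification.mk _).symm.injective (funext h)

instance : CompactlyCoherentSpace (coneProd E) :=
  inferInstanceAs (CompactlyCoherentSpace (KProd fun i => cone (E i)))

/-- The `i`-th coordinate of a point of the product of the cones. -/
abbrev coneProd.coord (d : coneProd E) (i : Fin (n + 2)) : cone (E i) :=
  KProd.coord (E := fun i => cone (E i)) d i

/-- The point of the product of the cones with the given coordinates. -/
abbrev coneProd.mk (c : ∀ i, cone (E i)) : coneProd E := KProd.mk (E := fun i => cone (E i)) c

theorem coneProd.coord_mk (c : ∀ i, cone (E i)) (i : Fin (n + 2)) : (mk c).coord i = c i :=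
  KProd.coord_mk (E := fun i => cone (E i)) c i

theorem coneProd.coord_pt (i : Fin (n + 2)) : (coneProd E).pt.coord i = (cone (E i)).pt :=
  coneProd.coord_mk _ i

theorem coneProd.continuous_coord (i : Fin (n + 2)) :
    Continuous fun d : coneProd E => d.coord i :=
  KProd.continuous_coord (E := fun i => cone (E i)) i

theorem coneProd.continuous_mk {Z : Type*} [TopologicalSpace Z] [CompactlyCoherentSpace Z]
    {f : Z → ∀ i, cone (E i)} (hf : ∀ i, Continuous fun z => f z i) :
    Continuous fun z => (coneProd.mk (f z) : coneProd E) :=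
  KProd.continuous_mk (E := fun i => cone (E i)) hf

/-- The point of the outer faces obtained by changing the `i`-th coordinate to `1`. -/
def outerFaces.set (t : Fin (n + 2) → I) (i : Fin (n + 2)) : outerFaces n :=
  ⟨Function.update t i 1, i, Function.update_self ..⟩

theorem outerFaces.set_self (t : Fin (n + 2) → I) (i : Fin (n + 2)) :
    (outerFaces.set t i).1 i = 1 := Function.update_self ..

theorem outerFaces.set_of_ne (t : Fin (n + 2) → I) {i k : Fin (n + 2)} (h : k ≠ i) :
    (outerFaces.set t i).1 k = t k := Function.update_of_ne h ..

theorem outerFaces.continuous_set (i : Fin (n + 2)) :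
    Continuous fun t : Fin (n + 2) → I => outerFaces.set t i :=
  Continuous.subtype_mk (continuous_id.update i continuous_const) _

/-- The point of `Q(E)` with the coordinates `[tᵢ, xᵢ]`. -/
def coneBoundary.mk (t : outerFaces n) (x : KProd E) : coneBoundary E := Quot.mk _ (t, x)

theorem coneBoundary.ind {P : coneBoundary E → Prop} (h : ∀ t x, P (mk t x)) (z) : P z := by
  obtain ⟨t, x⟩ := z
  exact h t x

theorem coneBoundary.continuous_mk :
    Continuous fun p : outerFaces n × KProd E => (coneBoundary.mk p.1 p.2 : coneBoundary E) :=
  continuous_quot_mk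

variable (E) in
/-- The inclusion of `Q(E)` into the product of the cones. -/
def coneBoundary.toProd : PtdMap (coneBoundary E) (coneProd E) where
  map :=
    { toFun := Quot.lift (fun a => coneProd.mk fun i => cone.mk (a.1.1 i) (a.2.coord i))
        fun a b h => congrArg KProd.mk (funext h)
      continuous_toFun := by
        refine continuous_quot_lift _ (coneProd.continuous_mk fun i => ?_)
        have h1 : Continuous fun a : outerFaces n × KProd E => a.1.1 i :=
          (continuous_apply i).comp (continuous_subtype_val.comp continuous_fst)
        have h2 : Continuous fun a : outerFaces n × KProd E => a.2.coord i :=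
          (KProd.continuous_coord i).comp continuous_snd
        exact (isQuotientMap_cone_mk (E i)).continuous.comp (h1.prodMk h2) }
  map_pt := by
    refine congrArg KProd.mk (funext fun i => ?_)
    exact mk_eq_pt_iff.2 (Or.inr (KProd.coord_mk _ _))

theorem coneBoundary.coord_toProd_mk (t : outerFaces n) (x : KProd E) (i : Fin (n + 2)) :
    (coneBoundary.toProd E (coneBoundary.mk t x)).coord i = cone.mk (t.1 i) (x.coord i) :=
  coneProd.coord_mk _ i

theorem coneBoundary.toProd_injective : Function.Injective (coneBoundary.toProd E) := by
  rintro ⟨a⟩ ⟨b⟩ h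
  refine Quot.sound fun i => ?_
  have := congrArg (fun d : coneProd E => d.coord i) h
  simpa only [coneBoundary.toProd, coneProd.coord_mk] using! this

theorem coneBoundary.isRim_toProd (z : coneBoundary E) :
    ∃ i, IsRim ((coneBoundary.toProd E z).coord i) := by
  induction z using coneBoundary.ind with
  | h t x =>
    obtain ⟨i, hi⟩ := t.2
    refine ⟨i, ?_⟩
    rw [coneBoundary.coord_toProd_mk, hi]
    exact isRim_mk_one _

theorem coneBoundary.exists_toProd_eq {d : coneProd E} (h : ∃ i, IsRim (d.coord i)) :
    ∃ z, coneBoundary.toProd E z = d := by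
  obtain ⟨i, y, hy⟩ := h
  have hsurj : ∀ k, ∃ p : I × E k, cone.mk p.1 p.2 = d.coord k := fun k =>
    (isQuotientMap_cone_mk (E k)).surjective (d.coord k)
  choose p hp using hsurj
  refine ⟨coneBoundary.mk (outerFaces.set (fun k => (p k).1) i)
    (KProd.mk (Function.update (fun k => (p k).2) i y)), coneProd.ext fun k => ?_⟩
  refine (coneBoundary.coord_toProd_mk _ _ k).trans ?_
  rw [KProd.coord_mk]
  by_cases hk : k = i
  · subst hk
    rw [outerFaces.set_self, Function.update_self]
    exact hy.symm
  · rw [outerFaces.set_of_ne _ hk, Function.update_of_ne hk]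
    exact hp k

variable [∀ i, T2Space (E i)] [∀ i, CompactlyCoherentSpace (E i)]

theorem coneProd.isQuotientMap : IsQuotientMap fun a : (Fin (n + 2) → I) × KProd E =>
    (coneProd.mk fun i => cone.mk (a.1 i) (a.2.coord i) : coneProd E) := by
  have : ∀ i, T2Space (cone (E i)) := fun i => cone.t2Space
  exact KProd.isQuotientMap_prod (Z := fun i => cone (E i))
    (fun i => ⟨_, (isQuotientMap_cone_mk (E i)).continuous⟩) fun i => isQuotientMap_cone_mk (E i)

/-- The inclusion of `Q(E)` is a closed embedding: in the cube of all `([tᵢ, xᵢ])ᵢ`, the points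
over a closed subset of `Q(E)` form a finite union of closed sets, one for each face `tᵢ = 1` and
one for each of the sets `[tᵢ, xᵢ] = *`, on which `tᵢ` may be replaced by `1`. -/
theorem coneBoundary.isClosedEmbedding_toProd : IsClosedEmbedding (coneBoundary.toProd E) := by
  refine .of_continuous_injective_isClosedMap (coneBoundary.toProd E).continuous
    coneBoundary.toProd_injective fun C hC => ?_
  rw [← coneProd.isQuotientMap.isClosed_preimage]
  let f : Fin (n + 2) → (Fin (n + 2) → I) × KProd E → coneBoundary E := fun i a =>
    coneBoundary.mk (outerFaces.set a.1 i) a.2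
  let g : Fin (n + 2) → (Fin (n + 2) → I) × KProd E → coneBoundary E := fun i a =>
    coneBoundary.mk (outerFaces.set a.1 i)
      (KProd.mk (Function.update a.2.coord i (E i).pt))
  have hupd : ∀ i, Continuous fun a : (Fin (n + 2) → I) × KProd E => outerFaces.set a.1 i :=
    fun i => (outerFaces.continuous_set i).comp continuous_fst
  have hf : ∀ i, Continuous (f i) := fun i =>
    coneBoundary.continuous_mk.comp ((hupd i).prodMk continuous_snd)
  have hg : ∀ i, Continuous (g i) := by
    refine fun i => coneBoundary.continuous_mk.comp ((hupd i).prodMk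
      (KProd.continuous_mk fun k => (continuous_apply k).comp
        (Continuous.update ?_ i continuous_const)))
    exact continuous_pi fun k => (KProd.continuous_coord k).comp continuous_snd
  have hcl : IsClosed (⋃ i, ({a : (Fin (n + 2) → I) × KProd E | a.1 i = 1} ∩ f i ⁻¹' C ∪
      {a | a.1 i = 0 ∨ a.2.coord i = (E i).pt} ∩ g i ⁻¹' C)) := by
    refine isClosed_iUnion_of_finite fun i => ?_
    have h1 : Continuous fun a : (Fin (n + 2) → I) × KProd E => a.1 i := by fun_prop
    have h2 : Continuous fun a : (Fin (n + 2) → I) × KProd E => a.2.coord i :=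
      (KProd.continuous_coord i).comp continuous_snd
    refine ((isClosed_eq h1 continuous_const).inter (hC.preimage (hf i))).union
      (((isClosed_eq h1 continuous_const).union (isClosed_eq h2 continuous_const)).inter
        (hC.preimage (hg i)))
  convert hcl using 1
  ext a
  simp only [mem_preimage, mem_image, mem_iUnion, mem_union, mem_inter_iff, mem_ofPred_eq]
  constructor
  · rintro ⟨z, hz, hza⟩
    induction z using coneBoundary.ind with
    | h t x =>
      have hk : ∀ k, cone.mk (t.1 k) (x.coord k) = cone.mk (a.1 k) (a.2.coord k) := fun k => by
        rw [← coneBoundary.coord_toProd_mk, hza, coneProd.coord_mk]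
      obtain ⟨i, hi⟩ := t.2
      refine ⟨i, ?_⟩
      have hki := hk i
      rw [hi] at hki
      rcases Collapse.mk_eq_iff.1 hki with h | ⟨h1, h2⟩
      · left
        obtain ⟨h1, h2⟩ := Prod.ext_iff.1 h
        refine ⟨h1.symm, ?_⟩
        have : f i a = coneBoundary.mk t x := by
          refine Quot.sound fun k => ?_
          by_cases hki : k = i
          · subst hki
            change cone.mk ((outerFaces.set a.1 k).1 k) (a.2.coord k) = _
            rw [outerFaces.set_self, hi]
            exact congrArg (cone.mk 1) h2.symm
          · change cone.mk ((outerFaces.set a.1 i).1 k) (a.2.coord k) = _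
            rw [outerFaces.set_of_ne _ hki, hk]
        rw [this]
        exact hz
      · right
        refine ⟨h2, ?_⟩
        have hx : x.coord i = (E i).pt := h1.resolve_left one_ne_zero
        have : g i a = coneBoundary.mk t x := by
          refine Quot.sound fun k => ?_
          change cone.mk ((outerFaces.set a.1 i).1 k)
            ((KProd.mk (Function.update a.2.coord i (E i).pt)).coord k) = _
          rw [KProd.coord_mk]
          by_cases hki : k = i
          · subst hki
            rw [outerFaces.set_self, Function.update_self, hi, hx]
          · rw [outerFaces.set_of_ne _ hki, Function.update_of_ne hki, hk]
        rw [this]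
        exact hz
  · rintro ⟨i, ⟨hi, hC⟩ | ⟨hi, hC⟩⟩
    · refine ⟨_, hC, coneProd.ext fun k => ?_⟩
      refine (coneBoundary.coord_toProd_mk _ _ k).trans ((coneProd.coord_mk _ k).trans ?_).symm
      by_cases hki : k = i
      · subst hki
        rw [outerFaces.set_self, hi]
      · rw [outerFaces.set_of_ne _ hki]
    · refine ⟨_, hC, coneProd.ext fun k => ?_⟩
      refine (coneBoundary.coord_toProd_mk _ _ k).trans ((coneProd.coord_mk _ k).trans ?_).symm
      rw [KProd.coord_mk]
      by_cases hki : k = i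
      · subst hki
        rw [outerFaces.set_self, Function.update_self, mk_eq_pt_iff.2 hi,
          mk_eq_pt_iff.2 (Or.inr rfl)]
      · rw [outerFaces.set_of_ne _ hki, Function.update_of_ne hki]

end coneProd

section coneProd

open cone

variable {n : ℕ} {E : Fin (n + 2) → PtdSpace.{u}}

variable (E) in
/-- The product of the cones contracts to the base point by scaling. -/
def coneProd.contraction : PtdContraction (coneProd E) where
  c := ⟨fun p => coneProd.mk fun i => scale (p.1, p.2.coord i),
    coneProd.continuous_mk fun i => scale.continuous.comp
      (continuous_fst.prodMk ((coneProd.continuous_coord i).comp continuous_snd))⟩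
  c_zero _ := coneProd.ext fun i => (coneProd.coord_mk _ i).trans
    ((scale_zero _).trans (coneProd.coord_pt i).symm)
  c_one _ := coneProd.ext fun i => (coneProd.coord_mk _ i).trans (scale_one _)
  c_pt t := coneProd.ext fun i => (coneProd.coord_mk _ i).trans
    ((congrArg (fun c => scale (t, c)) (coneProd.coord_pt i)).trans
      ((scale_pt t).trans (coneProd.coord_pt i).symm))

variable (δ : ∀ i, PointDeform (E i))

/-- The distance of a point of the product of the cones from `Q(E)`, the least of the distances of
the coordinates from the rim. -/
def coneProd.rimDist (d : coneProd E) : ℝ :=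
  Finset.univ.inf' Finset.univ_nonempty fun i => (δ i).rimDist (d.coord i)

theorem coneProd.continuous_rimDist : Continuous (coneProd.rimDist δ) :=
  Continuous.finset_inf'_apply _ fun i _ =>
    (δ i).rimDist.continuous.comp (coneProd.continuous_coord i)

theorem coneProd.rimDist_nonneg (d : coneProd E) : 0 ≤ coneProd.rimDist δ d :=
  Finset.le_inf' _ _ fun i _ => (δ i).rimDist_nonneg _

theorem coneProd.rimDist_toProd (z : coneBoundary E) :
    coneProd.rimDist δ (coneBoundary.toProd E z) = 0 := by
  obtain ⟨i, hi⟩ := coneBoundary.isRim_toProd z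
  refine le_antisymm ?_ (coneProd.rimDist_nonneg δ _)
  exact (Finset.inf'_le _ (Finset.mem_univ i)).trans ((δ i).rimDist_eq_zero hi).le

/-- A neighbourhood of `Q(E)` in the product of the cones deforms into `Q(E)`. All coordinates are
deformed for a time equal to the distance from `Q(E)`, after which a coordinate that realizes this
distance is on the rim. -/
def coneProd.nbhdDeform : NbhdDeform (coneBoundary.toProd E) where
  -- The deformations of the cones move the points at distance at most `1 / 4` from the rim to it.
  w := ⟨fun d => 4 * coneProd.rimDist δ d,
    continuous_const.mul (coneProd.continuous_rimDist δ)⟩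
  g := ⟨fun p => coneProd.mk fun i => (δ i).coneDeform
      (clamp (p.1 * min (coneProd.rimDist δ p.2) (1 / 4)), p.2.coord i),
    coneProd.continuous_mk fun i => (δ i).coneDeform.continuous.comp (Continuous.prodMk
      (continuous_clamp.comp (Continuous.mul (by fun_prop)
        (((coneProd.continuous_rimDist δ).comp continuous_snd).min continuous_const)))
      ((coneProd.continuous_coord i).comp continuous_snd))⟩
  w_apply z := by
    change 4 * coneProd.rimDist δ (coneBoundary.toProd E z) = 0
    rw [coneProd.rimDist_toProd, mul_zero]
  g_zero d := coneProd.ext fun i => (coneProd.coord_mk _ i).trans (by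
    simp only [Icc.coe_zero, zero_mul, clamp_of_nonpos le_rfl, PointDeform.coneDeform_zero])
  g_apply t z := coneProd.ext fun i => (coneProd.coord_mk _ i).trans (by
    simp only [coneProd.rimDist_toProd]
    rw [clamp_of_nonpos (by simp), PointDeform.coneDeform_zero])
  g_one d hd := by
    change 4 * coneProd.rimDist δ d ≤ 1 at hd
    refine coneBoundary.exists_toProd_eq ?_
    obtain ⟨i, -, hi⟩ := Finset.exists_mem_eq_inf' Finset.univ_nonempty
      fun i => (δ i).rimDist (d.coord i)
    have hi' : coneProd.rimDist δ d = (δ i).rimDist (d.coord i) := hi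
    have hc : (clamp (((1 : I) : ℝ) * min (coneProd.rimDist δ d) (1 / 4)) : ℝ) =
        coneProd.rimDist δ d := by
      rw [Icc.coe_one, one_mul, min_eq_left (by linarith),
        coe_clamp (coneProd.rimDist_nonneg δ d) (by linarith)]
    refine ⟨i, ?_⟩
    rw [ContinuousMap.coe_mk, coneProd.coord_mk]
    exact (δ i).isRim_coneDeform_of_le (by rw [hc]; linarith) (by rw [hc, hi'])

/-! ### The projection of the boundary onto the suspended smash product -/

/-- The points of the product of the cones whose first coordinate is the base point or whose other
coordinates include one on the rim. In `Q(E)` these are the points that the projection to the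
suspended smash product sends to the base point. -/
def coneProd.IsCollapsed (d : coneProd E) : Prop :=
  d.coord 0 = (cone (E 0)).pt ∨ ∃ i : Fin (n + 1), IsRim (d.coord i.succ)

/-- The distance of the coordinates after the first from the rim. -/
def coneProd.tailDist (d : coneProd E) : ℝ :=
  Finset.univ.inf' Finset.univ_nonempty fun i : Fin (n + 1) =>
    (δ i.succ).rimDist (d.coord i.succ)

theorem coneProd.continuous_tailDist : Continuous (coneProd.tailDist δ) :=
  Continuous.finset_inf'_apply _ fun i _ =>
    (δ i.succ).rimDist.continuous.comp (coneProd.continuous_coord i.succ)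

theorem coneProd.tailDist_nonneg (d : coneProd E) : 0 ≤ coneProd.tailDist δ d :=
  Finset.le_inf' _ _ fun i _ => (δ i.succ).rimDist_nonneg _

theorem coneProd.tailDist_eq_zero {d : coneProd E} {i : Fin (n + 1)}
    (hi : IsRim (d.coord i.succ)) : coneProd.tailDist δ d = 0 := by
  refine le_antisymm ?_ (coneProd.tailDist_nonneg δ _)
  exact (Finset.inf'_le _ (Finset.mem_univ i)).trans ((δ i.succ).rimDist_eq_zero hi).le

/-- The factors by which the coordinates are scaled in `coneProd.collapse`. The first coordinate is
scaled only if one of the others has been deformed to the rim, and the others are scaled only if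
the first one has arrived at the base point, so that points of `Q(E)` stay in `Q(E)`. -/
def coneProd.factor (s : I) (d : coneProd E) (i : Fin (n + 2)) : I :=
  if i = 0 then σ (clamp (2 * s - 8 * coneProd.tailDist δ d))
  else σ (clamp (2 * max (s - 4 * (δ 0).vertexDist (d.coord 0))
    (s - 1 / 2 - 4 * coneProd.tailDist δ d)))

theorem coneProd.continuous_factor (i : Fin (n + 2)) :
    Continuous fun p : I × coneProd E => coneProd.factor δ p.1 p.2 i := by
  have h1 : Continuous fun p : I × coneProd E => coneProd.tailDist δ p.2 :=
    (coneProd.continuous_tailDist δ).comp continuous_snd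
  have h2 : Continuous fun p : I × coneProd E => (δ 0).vertexDist (p.2.coord 0) :=
    (δ 0).vertexDist.continuous.comp ((coneProd.continuous_coord 0).comp continuous_snd)
  unfold coneProd.factor
  split_ifs
  · exact continuous_symm.comp (continuous_clamp.comp (by fun_prop))
  · exact continuous_symm.comp (continuous_clamp.comp (by fun_prop))

/-- A homotopy of the product of the cones that starts at the identity, preserves `Q(E)` and the
collapsed points, and ends with the collapsed points at the base point. -/
def coneProd.collapse : C(I × coneProd E, coneProd E) where
  toFun p := coneProd.mk fun i => scale (coneProd.factor δ p.1 p.2 i,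
    (δ i).coneDeform (clamp ((p.1 : ℝ) / 4), p.2.coord i))
  continuous_toFun := coneProd.continuous_mk fun i => scale.continuous.comp (Continuous.prodMk
    (coneProd.continuous_factor δ i) ((δ i).coneDeform.continuous.comp (Continuous.prodMk
      (continuous_clamp.comp (by fun_prop)) ((coneProd.continuous_coord i).comp continuous_snd))))

theorem coneProd.coord_collapse (s : I) (d : coneProd E) (i : Fin (n + 2)) :
    (coneProd.collapse δ (s, d)).coord i = scale (coneProd.factor δ s d i,
      (δ i).coneDeform (clamp ((s : ℝ) / 4), d.coord i)) :=
  coneProd.coord_mk _ i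

theorem coneProd.collapse_zero (d : coneProd E) : coneProd.collapse δ (0, d) = d := by
  refine coneProd.ext fun i => (coneProd.coord_collapse δ 0 d i).trans ?_
  have h : coneProd.factor δ 0 d i = 1 := by
    have h1 := coneProd.tailDist_nonneg δ d
    have h2 := (δ 0).vertexDist_nonneg (d.coord 0)
    unfold coneProd.factor
    split_ifs
    · rw [clamp_of_nonpos (by rw [Icc.coe_zero]; linarith), symm_zero]
    · rw [clamp_of_nonpos, symm_zero]
      rw [Icc.coe_zero]
      have := max_le (a := 0 - 4 * (δ 0).vertexDist (d.coord 0))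
        (b := 0 - 1 / 2 - 4 * coneProd.tailDist δ d) (c := 0) (by linarith) (by linarith)
      linarith
  rw [h, scale_one, clamp_of_nonpos (by simp), PointDeform.coneDeform_zero]

theorem coneProd.collapse_pt (s : I) : coneProd.collapse δ (s, (coneProd E).pt) = (coneProd E).pt :=
  coneProd.ext fun i => by
    refine (coneProd.coord_collapse δ s _ i).trans ?_
    rw [coneProd.coord_pt, PointDeform.coneDeform_pt, scale_pt]

theorem coe_clamp_div_four (s : I) : (clamp ((s : ℝ) / 4) : ℝ) = s / 4 :=
  coe_clamp (by linarith [s.2.1]) (by linarith [s.2.2])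

theorem coneProd.exists_isRim_of_factor_zero {s : I} {d : coneProd E}
    (h : coneProd.factor δ s d 0 ≠ 1) :
    ∃ i : Fin (n + 1), IsRim ((δ i.succ).coneDeform (clamp ((s : ℝ) / 4), d.coord i.succ)) := by
  have hpos : 0 < 2 * (s : ℝ) - 8 * coneProd.tailDist δ d := by
    by_contra hle
    exact h (by rw [coneProd.factor, if_pos rfl, clamp_of_nonpos (not_lt.1 hle), symm_zero])
  obtain ⟨i, -, hi⟩ := Finset.exists_mem_eq_inf' Finset.univ_nonempty
    fun i : Fin (n + 1) => (δ i.succ).rimDist (d.coord i.succ)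
  have hi' : coneProd.tailDist δ d = (δ i.succ).rimDist (d.coord i.succ) := hi
  refine ⟨i, (δ i.succ).isRim_coneDeform_of_le ?_ ?_⟩
  · rw [coe_clamp_div_four]
    linarith [s.2.2]
  · rw [coe_clamp_div_four, ← hi']
    linarith

theorem coneProd.coord_collapse_zero_of_factor {s : I} {d : coneProd E} {i : Fin (n + 2)}
    (hi : i ≠ 0) (h : coneProd.factor δ s d i ≠ 1) :
    (coneProd.collapse δ (s, d)).coord 0 = (cone (E 0)).pt := by
  have hpos : 0 < max (s - 4 * (δ 0).vertexDist (d.coord 0))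
      (s - 1 / 2 - 4 * coneProd.tailDist δ d) := by
    by_contra hle
    exact h (by rw [coneProd.factor, if_neg hi, clamp_of_nonpos (by linarith), symm_zero])
  rw [coneProd.coord_collapse]
  rcases lt_max_iff.1 hpos with h | h
  · rw [(δ 0).coneDeform_eq_pt, scale_pt]
    · rw [coe_clamp_div_four]
      linarith [s.2.2]
    · rw [coe_clamp_div_four]
      linarith
  · rw [coneProd.factor, if_pos rfl, clamp_of_one_le (by linarith), symm_one, scale_zero]

theorem coneProd.isRim_collapse (s : I) {d : coneProd E} (hd : ∃ i, IsRim (d.coord i)) :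
    ∃ i, IsRim ((coneProd.collapse δ (s, d)).coord i) := by
  by_cases h1 : ∃ i, i ≠ 0 ∧ coneProd.factor δ s d i ≠ 1
  · obtain ⟨i, hi, h⟩ := h1
    refine ⟨0, ?_⟩
    rw [coneProd.coord_collapse_zero_of_factor δ hi h]
    exact isRim_pt
  push Not at h1
  by_cases h2 : coneProd.factor δ s d 0 = 1
  · obtain ⟨i, hi⟩ := hd
    refine ⟨i, ?_⟩
    have : coneProd.factor δ s d i = 1 := by
      by_cases hi0 : i = 0
      · rw [hi0, h2]
      · exact h1 i hi0
    rw [coneProd.coord_collapse, this, scale_one]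
    exact (δ i).isRim_coneDeform _ hi
  · obtain ⟨i, hi⟩ := coneProd.exists_isRim_of_factor_zero δ h2
    refine ⟨i.succ, ?_⟩
    rwa [coneProd.coord_collapse, h1 _ (Fin.succ_ne_zero i), scale_one]

theorem coneProd.IsCollapsed.collapse (s : I) {d : coneProd E} (hd : coneProd.IsCollapsed d) :
    coneProd.IsCollapsed (coneProd.collapse δ (s, d)) := by
  rcases hd with hd | ⟨i, hi⟩
  · left
    rw [coneProd.coord_collapse, hd, PointDeform.coneDeform_pt, scale_pt]
  · by_cases h : coneProd.factor δ s d i.succ = 1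
    · right
      refine ⟨i, ?_⟩
      rw [coneProd.coord_collapse, h, scale_one]
      exact (δ i.succ).isRim_coneDeform _ hi
    · exact Or.inl (coneProd.coord_collapse_zero_of_factor δ (Fin.succ_ne_zero i) h)

theorem coneProd.IsCollapsed.collapse_one {d : coneProd E} (hd : coneProd.IsCollapsed d) :
    coneProd.collapse δ (1, d) = (coneProd E).pt := by
  refine coneProd.ext fun i => ?_
  refine (coneProd.coord_collapse δ 1 d i).trans (Eq.trans ?_ (coneProd.coord_pt i).symm)
  by_cases hi : i = 0
  · subst hi
    rcases hd with hd | ⟨k, hk⟩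
    · rw [hd, PointDeform.coneDeform_pt, scale_pt]
    · rw [coneProd.factor, if_pos rfl, coneProd.tailDist_eq_zero δ hk, clamp_of_one_le, symm_one,
        scale_zero]
      rw [Icc.coe_one]
      norm_num
  · have h : 1 ≤ 2 * max (((1 : I) : ℝ) - 4 * (δ 0).vertexDist (d.coord 0))
        (((1 : I) : ℝ) - 1 / 2 - 4 * coneProd.tailDist δ d) := by
      rw [Icc.coe_one]
      rcases hd with hd | ⟨k, hk⟩
      · rw [hd, PointDeform.vertexDist_pt]
        have := le_max_left (1 - 4 * 0 : ℝ) (1 - 1 / 2 - 4 * coneProd.tailDist δ d)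
        linarith
      · rw [coneProd.tailDist_eq_zero δ hk]
        have := le_max_right (1 - 4 * (δ 0).vertexDist (d.coord 0)) (1 - 1 / 2 - 4 * 0 : ℝ)
        linarith
    rw [coneProd.factor, if_neg hi, clamp_of_one_le h, symm_one, scale_zero]

theorem coneBoundary.exists_collapse [∀ i, T2Space (E i)] [∀ i, CompactlyCoherentSpace (E i)] :
    ∃ G : C(I × coneBoundary E, coneBoundary E),
    ∀ s z, coneBoundary.toProd E (G (s, z)) = coneProd.collapse δ (s, coneBoundary.toProd E z) := by
  choose G hG using fun p : I × coneBoundary E => coneBoundary.exists_toProd_eq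
    (coneProd.isRim_collapse δ p.1 (coneBoundary.isRim_toProd p.2))
  refine ⟨⟨G, ?_⟩, fun s z => hG (s, z)⟩
  rw [coneBoundary.isClosedEmbedding_toProd.isEmbedding.continuous_iff]
  have h : Continuous fun p : I × coneBoundary E =>
      coneProd.collapse δ (p.1, coneBoundary.toProd E p.2) :=
    (coneProd.collapse δ).continuous.comp (continuous_fst.prodMk
      ((coneBoundary.toProd E).continuous.comp continuous_snd))
  exact h.congr fun p => (hG p).symm

/-- The projection of the cube of all `(t, x)` onto the suspended smash product. -/
def iterSusp.proj (p : (Fin (n + 1) → I) × KProd E) : iterSusp (n + 1) (smash E) :=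
  Quot.mk _ (p.1, Quot.mk _ p.2)

theorem iterSusp.isQuotientMap_proj :
    IsQuotientMap (iterSusp.proj : (Fin (n + 1) → I) × KProd E → _) :=
  isQuotientMap_quot_mk.comp (IsQuotientMap.prodMap_id isQuotientMap_quot_mk)

/-- The points of the cube that become the base point of the suspended smash product. -/
def iterSusp.IsBase (p : (Fin (n + 1) → I) × KProd E) : Prop :=
  (∃ i, p.1 i = 0 ∨ p.1 i = 1) ∨ ∃ i, p.2.coord i = (E i).pt

theorem smash.mk_eq_pt_iff {x : KProd E} :
    (Quot.mk _ x : smash E) = (smash E).pt ↔ ∃ i, x.coord i = (E i).pt := by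
  refine Collapse.mk_eq_iff.trans ⟨?_, fun h => Or.inr ⟨h, 0, KProd.coord_mk _ _⟩⟩
  rintro (rfl | h)
  · exact ⟨0, KProd.coord_mk _ _⟩
  · exact h.1

theorem iterSusp.proj_eq_iff {p q : (Fin (n + 1) → I) × KProd E} :
    iterSusp.proj p = iterSusp.proj q ↔ p = q ∨ (iterSusp.IsBase p ∧ iterSusp.IsBase q) := by
  have hbase : ∀ p : (Fin (n + 1) → I) × KProd E,
      ((p.1, (Quot.mk _ p.2 : smash E)) : (Fin (n + 1) → I) × smash E) ∈
        {p : (Fin (n + 1) → I) × smash E | (∃ i, p.1 i = 0 ∨ p.1 i = 1) ∨ p.2 = (smash E).pt} ↔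
      iterSusp.IsBase p := fun p => or_congr_right smash.mk_eq_pt_iff
  refine Collapse.mk_eq_iff.trans ?_
  rw [hbase, hbase]
  constructor
  · rintro (h | h)
    · obtain ⟨h1, h2⟩ := Prod.ext_iff.1 h
      rcases Collapse.mk_eq_iff.1 h2 with h2 | ⟨h2, h3⟩
      · exact Or.inl (Prod.ext h1 h2)
      · exact Or.inr ⟨Or.inr h2, Or.inr h3⟩
    · exact Or.inr h
  · rintro (rfl | h)
    · exact Or.inl rfl
    · exact Or.inr h

theorem iterSusp.proj_eq_pt {p : (Fin (n + 1) → I) × KProd E} (h : iterSusp.IsBase p) :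
    iterSusp.proj p = (iterSusp (n + 1) (smash E)).pt :=
  (iterSusp.proj_eq_iff (q := (fun _ => 0, KProd.mk fun i => (E i).pt))).2
    (Or.inr ⟨h, Or.inl ⟨0, Or.inl rfl⟩⟩)

theorem coneBoundary.isCollapsed_mk_iff (t : outerFaces n) (x : KProd E) :
    coneProd.IsCollapsed (coneBoundary.toProd E (coneBoundary.mk t x)) ↔
      iterSusp.IsBase (fun i => t.1 i.succ, x) := by
  rw [coneProd.IsCollapsed, coneBoundary.coord_toProd_mk, mk_eq_pt_iff]
  simp only [coneBoundary.coord_toProd_mk, isRim_mk_iff]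
  constructor
  · rintro ((h | h) | ⟨i, h | h | h⟩)
    · obtain ⟨k, hk⟩ := t.2
      rcases Fin.eq_zero_or_eq_succ k with rfl | ⟨i, rfl⟩
      · exact absurd (h.symm.trans hk) zero_ne_one
      · exact Or.inl ⟨i, Or.inr hk⟩
    · exact Or.inr ⟨0, h⟩
    · exact Or.inl ⟨i, Or.inr h⟩
    · exact Or.inl ⟨i, Or.inl h⟩
    · exact Or.inr ⟨i.succ, h⟩
  · rintro (⟨i, h | h⟩ | ⟨k, h⟩)
    · exact Or.inr ⟨i, Or.inr (Or.inl h)⟩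
    · exact Or.inr ⟨i, Or.inl h⟩
    · rcases Fin.eq_zero_or_eq_succ k with rfl | ⟨i, rfl⟩
      · exact Or.inl (Or.inr h)
      · exact Or.inr ⟨i, Or.inr (Or.inr h)⟩

theorem coneBoundary.toSusp_eq_pt {z : coneBoundary E}
    (h : coneProd.IsCollapsed (coneBoundary.toProd E z)) :
    coneBoundary.toSusp E z = (iterSusp (n + 1) (smash E)).pt := by
  induction z using coneBoundary.ind with
  | h t x => exact iterSusp.proj_eq_pt ((coneBoundary.isCollapsed_mk_iff t x).1 h)

/-- The point of `Q(E)` with first cone coordinate `1`. -/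
def coneBoundary.face (p : (Fin (n + 1) → I) × KProd E) : coneBoundary E :=
  coneBoundary.mk ⟨Fin.cons 1 p.1, 0, rfl⟩ p.2

theorem coneBoundary.continuous_face :
    Continuous (coneBoundary.face : (Fin (n + 1) → I) × KProd E → coneBoundary E) := by
  refine coneBoundary.continuous_mk.comp (Continuous.prodMk (Continuous.subtype_mk ?_ _)
    continuous_snd)
  exact continuous_const.finCons continuous_fst

theorem coneBoundary.isCollapsed_face {p : (Fin (n + 1) → I) × KProd E} (h : iterSusp.IsBase p) :
    coneProd.IsCollapsed (coneBoundary.toProd E (coneBoundary.face p)) :=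
  (coneBoundary.isCollapsed_mk_iff _ _).2 h

theorem coneBoundary.eq_face_or (z : coneBoundary E) : (∃ p, z = coneBoundary.face p) ∨
    coneProd.IsCollapsed (coneBoundary.toProd E z) := by
  induction z using coneBoundary.ind with
  | h t x =>
    obtain ⟨k, hk⟩ := t.2
    rcases Fin.eq_zero_or_eq_succ k with rfl | ⟨i, rfl⟩
    · left
      refine ⟨(fun i => t.1 i.succ, x), congrArg (fun t => coneBoundary.mk t x) (Subtype.ext ?_)⟩
      funext j
      rcases Fin.eq_zero_or_eq_succ j with rfl | ⟨j, rfl⟩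
      · exact hk
      · rfl
    · right
      exact (coneBoundary.isCollapsed_mk_iff t x).2 (Or.inl ⟨i, Or.inr hk⟩)

/-- The projection of `Q(E)` onto the suspended smash product is a pointed homotopy equivalence if
the base points are nondegenerate. Its inverse is induced by the end of a homotopy that preserves
the collapsed subspace and contracts it to the base point. -/
theorem coneBoundary.exists_toSusp_inverse [∀ i, T2Space (E i)]
    [∀ i, CompactlyCoherentSpace (E i)] (δ : ∀ i, PointDeform (E i)) :
    ∃ r : PtdMap (iterSusp (n + 1) (smash E)) (coneBoundary E),
      (r.comp (coneBoundary.toSusp E)).Homotopic (PtdMap.id _) ∧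
      ((coneBoundary.toSusp E).comp r).Homotopic (PtdMap.id _) := by
  obtain ⟨G, hG⟩ := coneBoundary.exists_collapse δ
  have hinj := coneBoundary.toProd_injective (E := E)
  have hG0 : ∀ z, G (0, z) = z := fun z => hinj (by rw [hG, coneProd.collapse_zero])
  have hGpt : ∀ s, G (s, (coneBoundary E).pt) = (coneBoundary E).pt := fun s =>
    hinj (by rw [hG, (coneBoundary.toProd E).map_pt, coneProd.collapse_pt])
  have hG1 : ∀ z, coneProd.IsCollapsed (coneBoundary.toProd E z) →
      G (1, z) = (coneBoundary E).pt := fun z hz =>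
    hinj (by rw [hG, coneProd.IsCollapsed.collapse_one δ hz, (coneBoundary.toProd E).map_pt])
  have hGB : ∀ s z, coneProd.IsCollapsed (coneBoundary.toProd E z) →
      coneBoundary.toSusp E (G (s, z)) = (iterSusp (n + 1) (smash E)).pt := fun s z hz =>
    coneBoundary.toSusp_eq_pt (by rw [hG]; exact coneProd.IsCollapsed.collapse δ s hz)
  let κ : C((Fin (n + 1) → I) × KProd E, iterSusp (n + 1) (smash E)) :=
    ⟨iterSusp.proj, iterSusp.isQuotientMap_proj.continuous⟩
  have hκ : IsQuotientMap κ := iterSusp.isQuotientMap_proj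
  have hκpt : κ (fun _ => 0, KProd.mk fun i => (E i).pt) = (iterSusp (n + 1) (smash E)).pt :=
    iterSusp.proj_eq_pt (Or.inl ⟨0, Or.inl rfl⟩)
  -- The inverse of the projection.
  let rd : C((Fin (n + 1) → I) × KProd E, coneBoundary E) :=
    ⟨fun p => G (1, coneBoundary.face p), G.continuous.comp
      (continuous_const.prodMk coneBoundary.continuous_face)⟩
  have hrd : Function.FactorsThrough rd κ := fun p q h => by
    rcases iterSusp.proj_eq_iff.1 h with rfl | ⟨h1, h2⟩
    · rfl
    · exact (hG1 _ (coneBoundary.isCollapsed_face h1)).trans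
        (hG1 _ (coneBoundary.isCollapsed_face h2)).symm
  let rm : C(iterSusp (n + 1) (smash E), coneBoundary E) := hκ.lift rd hrd
  have hrm : ∀ p, rm (iterSusp.proj p) = G (1, coneBoundary.face p) := fun p =>
    congrArg (fun f : C(_, _) => f p) (hκ.lift_comp rd hrd)
  have hrpt : rm (iterSusp (n + 1) (smash E)).pt = (coneBoundary E).pt := by
    rw [← hκpt]
    exact (hrm _).trans (hG1 _ (coneBoundary.isCollapsed_face (Or.inl ⟨0, Or.inl rfl⟩)))
  have hrq : ∀ z, rm (coneBoundary.toSusp E z) = G (1, z) := by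
    intro z
    rcases coneBoundary.eq_face_or z with ⟨p, rfl⟩ | hz
    · exact hrm p
    · rw [coneBoundary.toSusp_eq_pt hz, hrpt, hG1 z hz]
  refine ⟨⟨rm, hrpt⟩, ContinuousMap.HomotopicRel.symm ?_, ContinuousMap.HomotopicRel.symm ?_⟩
  · refine .of_map G hG0 (fun z => (hrq z).symm) ?_
    rintro s _ rfl
    exact hGpt s
  · -- The homotopy descends to the suspended smash product.
    let Ld : C(I × ((Fin (n + 1) → I) × KProd E), iterSusp (n + 1) (smash E)) :=
      ⟨fun p => coneBoundary.toSusp E (G (p.1, coneBoundary.face p.2)),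
        (coneBoundary.toSusp E).continuous.comp (G.continuous.comp (continuous_fst.prodMk
          (coneBoundary.continuous_face.comp continuous_snd)))⟩
    have hκI : IsQuotientMap ((ContinuousMap.id I).prodMap κ) := hκ.prodMap_id
    have hLd : Function.FactorsThrough Ld ((ContinuousMap.id I).prodMap κ) := fun p q h => by
      obtain ⟨h1, h2⟩ := Prod.ext_iff.1 h
      obtain ⟨s, p⟩ := p
      obtain ⟨s', q⟩ := q
      obtain rfl : s = s' := h1
      rcases iterSusp.proj_eq_iff.1 h2 with rfl | ⟨h3, h4⟩
      · rfl
      · exact (hGB s _ (coneBoundary.isCollapsed_face h3)).trans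
          (hGB s _ (coneBoundary.isCollapsed_face h4)).symm
    let L : C(I × iterSusp (n + 1) (smash E), iterSusp (n + 1) (smash E)) := hκI.lift Ld hLd
    have hL : ∀ s p, L (s, iterSusp.proj p) = coneBoundary.toSusp E (G (s, coneBoundary.face p)) :=
      fun s p => congrArg (fun f : C(_, _) => f (s, p)) (hκI.lift_comp Ld hLd)
    refine .of_map L (fun x => ?_) (fun x => ?_) ?_
    · obtain ⟨p, rfl⟩ := hκ.surjective x
      refine (hL 0 p).trans ?_
      rw [hG0]
      rfl
    · obtain ⟨p, rfl⟩ := hκ.surjective x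
      refine (hL 1 p).trans ?_
      exact congrArg (coneBoundary.toSusp E) (hrm p).symm
    · rintro s _ rfl
      change _ = (iterSusp (n + 1) (smash E)).pt
      rw [← hκpt]
      refine (hL s _).trans (Eq.trans ?_ hκpt.symm)
      exact hGB s _ (coneBoundary.isCollapsed_face (Or.inl ⟨0, Or.inl rfl⟩))

end coneProd

/-! ### Words -/

theorem List.filter_ofFn_succAbove {α : Type*} {P : α → Bool} {n : ℕ} (f : Fin (n + 1) → α)
    (j : Fin (n + 1)) (hj : ¬ P (f j)) :
    (List.ofFn f).filter P = (List.ofFn fun k => f (j.succAbove k)).filter P := by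
  induction n with
  | zero =>
    obtain rfl : j = 0 := Fin.fin_one_eq_zero j
    simp [hj]
  | succ n ih =>
    rcases Fin.eq_zero_or_eq_succ j with rfl | ⟨j, rfl⟩
    · rw [List.ofFn_succ, List.filter_cons_of_neg hj]
      simp only [Fin.succAbove_zero]
    · rw [List.ofFn_succ, List.ofFn_succ (f := fun k => f (j.succ.succAbove k)),
        List.filter_cons, List.filter_cons, ih (fun k => f k.succ) j hj]
      simp only [Fin.succ_succAbove_zero, Fin.succ_succAbove_succ]

theorem List.filter_ofFn_of_forall_ne {α : Type*} {P : α → Bool} {n : ℕ} (f : Fin n → α)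
    (j : Fin n) (h : ∀ k, k ≠ j → ¬ P (f k)) : (List.ofFn f).filter P = [f j].filter P := by
  induction n with
  | zero => exact j.elim0
  | succ n ih =>
    rcases Fin.eq_zero_or_eq_succ j with rfl | ⟨j, rfl⟩
    · rw [List.ofFn_succ, List.filter_cons, List.filter_cons, List.filter_nil,
        List.filter_eq_nil_iff.2]
      intro a ha
      obtain ⟨k, rfl⟩ := List.mem_ofFn.1 ha
      exact h _ (Fin.succ_ne_zero k)
    · rw [List.ofFn_succ, List.filter_cons_of_neg (h 0 (Fin.succ_ne_zero j).symm)]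
      exact ih (fun k => f k.succ) j fun k hk => h _ fun h => hk (Fin.succ_injective _ h)

instance letters.t2Space {X A : PtdSpace.{u}} [T2Space X] [T2Space A] {n : ℕ} :
    ∀ k : Fin n, T2Space (letters X A n k)
  | ⟨0, _⟩ => inferInstanceAs (T2Space X)
  | ⟨_ + 1, _⟩ => inferInstanceAs (T2Space A)

namespace RelJames

variable {X A : PtdSpace.{u}} (i : PtdMap A X) {n : ℕ}

/-- The class in `J_n(X, A)` of a point of `X × A × ⋯ × A`. -/
def mk (p : KProd (letters X A n)) : RelJames i n := Quot.mk _ p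

theorem isQuotientMap_mk : IsQuotientMap (mk i : KProd (letters X A n) → RelJames i n) :=
  isQuotientMap_quot_mk

/-- The reduced word represented by a point of `J_n(X, A)`. -/
def toWord : RelJames i n → List X := Quot.lift (word i) fun _ _ h => h

theorem toWord_mk (p : KProd (letters X A n)) : toWord i (mk i p) = word i p := rfl

theorem toWord_injective : Function.Injective (toWord i : RelJames i n → List X) := by
  rintro ⟨p⟩ ⟨q⟩ h
  exact Quot.sound h

theorem toWord_incl (c : RelJames i n) : toWord i (incl i n c) = toWord i c := by
  obtain ⟨p⟩ := c
  exact word_append i p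

theorem incl_injective : Function.Injective (incl i n) := fun c c' h =>
  toWord_injective i (by rw [← toWord_incl, h, toWord_incl])

/-- The point obtained by omitting the `j`-th coordinate. If the first coordinate is omitted,
then the second one is moved from `A` to `X`. -/
def delete (j : Fin (n + 2)) (p : ∀ k, letters X A (n + 2) k) : ∀ k, letters X A (n + 1) k
  | ⟨0, _⟩ => letter i (j.succAbove 0) (p (j.succAbove 0))
  | ⟨k + 1, h⟩ => if k + 1 < (j : ℕ) then p ⟨k + 1, by omega⟩ else p ⟨k + 2, by omega⟩

theorem letter_delete (j : Fin (n + 2)) (p : ∀ k, letters X A (n + 2) k) (k : Fin (n + 1)) :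
    letter i k (delete i j p k) = letter i (j.succAbove k) (p (j.succAbove k)) := by
  obtain ⟨_ | k, hk⟩ := k
  · rfl
  · by_cases h : k + 1 < (j : ℕ)
    · have : j.succAbove ⟨k + 1, hk⟩ = ⟨k + 1, by omega⟩ :=
        Fin.succAbove_of_castSucc_lt _ _ (Fin.lt_def.2 h)
      exact (congrArg i (if_pos h)).trans (congrArg (fun m => letter i m (p m)) this).symm
    · have : j.succAbove ⟨k + 1, hk⟩ = ⟨k + 2, by omega⟩ :=
        Fin.succAbove_of_le_castSucc _ _ (Fin.le_def.2 (not_lt.1 h))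
      exact (congrArg i (if_neg h)).trans (congrArg (fun m => letter i m (p m)) this).symm

theorem word_delete (j : Fin (n + 2)) (p : KProd (letters X A (n + 2)))
    (hj : p.coord j = (letters X A (n + 2) j).pt) :
    word i (KProd.mk (delete i j p.coord)) = word i p := by
  classical
  unfold word
  simp only [KProd.coord_mk, letter_delete]
  refine (List.filter_ofFn_succAbove (fun k => letter i k (p.coord k)) j ?_).symm
  rw [hj, letter_pt]
  simp

theorem continuous_letter (k : Fin n) : Continuous (letter i k) := by
  obtain ⟨_ | k, hk⟩ := k
  · exact continuous_id
  · exact i.continuous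

theorem letter_injective (hi : Function.Injective i) (k : Fin n) :
    Function.Injective (letter i k) := by
  obtain ⟨_ | k, hk⟩ := k
  · exact Function.injective_id
  · exact hi

theorem continuous_delete (j : Fin (n + 2)) : Continuous fun p : KProd (letters X A (n + 2)) =>
    (KProd.mk (delete i j p.coord) : KProd (letters X A (n + 1))) := by
  refine KProd.continuous_mk ?_
  rintro ⟨_ | k, hk⟩
  · exact (continuous_letter i _).comp (KProd.continuous_coord _)
  · by_cases h : k + 1 < (j : ℕ)
    · exact (KProd.continuous_coord (E := letters X A (n + 2)) ⟨k + 1, by omega⟩).congr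
        fun p => by symm; exact if_pos h
    · exact (KProd.continuous_coord (E := letters X A (n + 2)) ⟨k + 2, by omega⟩).congr
        fun p => by symm; exact if_neg h

/-- The map from the fat wedge in `X × A × ⋯ × A` to `J_{n+1}(X, A)` that omits a coordinate at the
base point. -/
def ofFatWedge [T2Space X] [T2Space A] :
    PtdMap (fatWedge (letters X A (n + 2))) (RelJames i (n + 1)) where
  map :=
    { toFun := fun p => mk i (KProd.mk (delete i p.2.choose p.1.coord))
      continuous_toFun := by
        -- On each of the closed sets where a given coordinate is at the base point, this map
        -- agrees with the one that omits this coordinate.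
        let C : Fin (n + 2) → Set (fatWedge (letters X A (n + 2))) := fun j =>
          {p | p.1.coord j = (letters X A (n + 2) j).pt}
        refine (locallyFinite_of_finite C).continuous ?_ (fun j => ?_) fun j => ?_
        · exact eq_univ_of_forall fun p => mem_iUnion.2 p.2
        · exact isClosed_eq ((KProd.continuous_coord j).comp continuous_subtype_val)
            continuous_const
        · have h : Continuous fun p : fatWedge (letters X A (n + 2)) =>
              mk i (KProd.mk (delete i j p.1.coord)) :=
            (isQuotientMap_mk i).continuous.comp
              ((continuous_delete i j).comp continuous_subtype_val)
          refine h.continuousOn.congr fun p hp => toWord_injective i ?_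
          exact (word_delete i _ _ p.2.choose_spec).trans (word_delete i j _ hp).symm }
  map_pt := by
    refine toWord_injective i
      ((word_delete i _ _ (fatWedge (letters X A (n + 2))).pt.2.choose_spec).trans ?_)
    exact (congrArg (toWord i) (incl i (n + 1)).map_pt).symm.trans (toWord_incl i _)

theorem toWord_ofFatWedge [T2Space X] [T2Space A] (p : fatWedge (letters X A (n + 2))) :
    toWord i (ofFatWedge i p) = word i p.1 :=
  word_delete i _ _ p.2.choose_spec

theorem incl_ofFatWedge [T2Space X] [T2Space A] (p : fatWedge (letters X A (n + 2))) :
    incl i (n + 1) (ofFatWedge i p) = mk i p.1 :=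
  toWord_injective i (by rw [toWord_incl, toWord_ofFatWedge, toWord_mk])

theorem length_word_le (p : KProd (letters X A n)) : (word i p).length ≤ n := by
  classical
  exact (List.length_filter_le _ _).trans List.length_ofFn.le

/-- No letter is deleted if no coordinate is the base point. -/
theorem word_eq_ofFn (hi : Function.Injective i) {p : KProd (letters X A n)}
    (hp : ∀ k, p.coord k ≠ (letters X A n k).pt) :
    word i p = List.ofFn fun k => letter i k (p.coord k) := by
  classical
  refine List.filter_eq_self.2 fun x hx => ?_
  obtain ⟨k, rfl⟩ := List.mem_ofFn.1 hx
  refine decide_eq_true fun h => hp k (letter_injective i hi k ?_)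
  rw [h, letter_pt]

/-- A point of `X × A × ⋯ × A` represents a word of smaller length only if it lies in the fat
wedge. -/
theorem exists_coord_eq_pt (hi : Function.Injective i) {p : KProd (letters X A (n + 1))}
    {c : RelJames i n} (h : mk i p = incl i n c) :
    ∃ k, p.coord k = (letters X A (n + 1) k).pt := by
  by_contra! hp
  have h1 := congrArg (fun c => (toWord i c).length) h
  simp only [toWord_mk, toWord_incl, word_eq_ofFn i hi hp, List.length_ofFn] at h1
  obtain ⟨q⟩ := c
  have h2 := length_word_le i q
  change n + 1 = (word i q).length at h1
  omega

/-- The inclusion `J_{n+1}(X, A) → J_{n+2}(X, A)` is closed: over a closed subset `C` of its source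
lies the set of points `p` of the fat wedge in `X × A × ⋯ × A` with `ofFatWedge i p ∈ C`. -/
theorem isClosedEmbedding_incl [T2Space X] [T2Space A] (hi : Function.Injective i) :
    IsClosedEmbedding (incl i (n + 1)) := by
  refine .of_continuous_injective_isClosedMap (incl i (n + 1)).continuous (incl_injective i)
    fun C hC => ?_
  rw [← (isQuotientMap_mk i).isClosed_preimage]
  have hT : IsClosed {p : KProd (letters X A (n + 2)) |
      ∃ k, p.coord k = (letters X A (n + 2) k).pt} := by
    rw [ofPred_exists]
    exact isClosed_iUnion_of_finite fun k => isClosed_eq (KProd.continuous_coord k) continuous_const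
  convert hT.isClosedMap_subtype_val _ (hC.preimage (ofFatWedge i).continuous) using 1
  ext p
  constructor
  · rintro ⟨c, hc, hcp⟩
    have hp := exists_coord_eq_pt i hi hcp.symm
    refine ⟨⟨p, hp⟩, ?_, rfl⟩
    have : ofFatWedge i ⟨p, hp⟩ = c := incl_injective i ((incl_ofFatWedge i _).trans hcp.symm)
    change ofFatWedge i ⟨p, hp⟩ ∈ C
    rwa [this]
  · rintro ⟨p, hp, rfl⟩
    exact ⟨_, hp, incl_ofFatWedge i p⟩

open Classical in
theorem toWord_ofX [CompactlyCoherentSpace X] (x : X) :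
    toWord i (ofX i (n + 1) x) = [x].filter fun x => decide (x ≠ X.pt) := by
  refine (List.filter_ofFn_of_forall_ne _ 0 fun k hk => ?_).trans ?_
  · obtain ⟨k, rfl⟩ := Fin.exists_succ_eq.2 hk
    rw [KProd.coord_mk]
    have : letter i k.succ (single x k.succ) = X.pt := i.map_pt
    simp [this]
  · rw [KProd.coord_mk]
    rfl

theorem ofFatWedge_inj [T2Space X] [T2Space A] [CompactlyCoherentSpace X] (j : Fin (n + 2))
    [CompactlyCoherentSpace (letters X A (n + 2) j)] (x : letters X A (n + 2) j) :
    ofFatWedge i (fatWedge.inj _ j x) = ofX i (n + 1) (letter i j x) := by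
  classical
  refine toWord_injective i ?_
  rw [toWord_ofFatWedge, toWord_ofX]
  refine (List.filter_ofFn_of_forall_ne _ j fun k hk => ?_).trans ?_
  · change ¬ decide (letter i k ((KProd.mk (Function.update _ j x)).coord k) ≠ X.pt) = true
    rw [KProd.coord_mk, Function.update_of_ne hk, letter_pt]
    simp
  · change [letter i j ((KProd.mk (Function.update _ j x)).coord j)].filter _ = _
    rw [KProd.coord_mk, Function.update_self]

theorem map_incl {X₂ A₂ : PtdSpace.{u}} {i₂ : PtdMap A₂ X₂} (f : PtdMap X X₂) (g : PtdMap A A₂)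
    (h : f.comp i = i₂.comp g) :
    (map f g h (n + 1)).comp (incl i n) = (incl i₂ n).comp (map f g h n) := by
  refine PtdMap.ext ?_
  rintro ⟨p⟩
  refine congrArg (fun q => mk i₂ (KProd.mk q)) (funext fun k => ?_)
  rw [KProd.coord_mk]
  obtain ⟨_ | k, hk⟩ := k
  · by_cases h : 0 < n
    · exact (congrArg f (dif_pos h)).trans
        ((dif_pos h).trans (KProd.coord_mk (E := letters X₂ A₂ n) _ ⟨0, h⟩)).symm
    · refine (congrArg f (dif_neg h)).trans (f.map_pt.trans (Eq.symm ?_))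
      exact dif_neg h
  · by_cases h : k + 1 < n
    · exact (congrArg g (dif_pos h)).trans
        ((dif_pos h).trans (KProd.coord_mk (E := letters X₂ A₂ n) _ ⟨k + 1, h⟩)).symm
    · refine (congrArg g (dif_neg h)).trans (g.map_pt.trans (Eq.symm ?_))
      exact dif_neg h

end RelJames

/-! ### The relative James filtration as an attaching construction -/

namespace cone

variable {X : PtdSpace.{u}}

/-- The projection of the cone onto the suspension. -/
def toSusp : PtdMap (cone X) (susp X) where
  map := Collapse.map (ContinuousMap.id _) fun _ h => h.imp_right Or.inr
  map_pt := rfl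

theorem toSusp_eq_or {c c' : cone X} (h : toSusp c = toSusp c') : c = c' ∨ IsRim c := by
  induction c using cone.ind with
  | h t x =>
    induction c' using cone.ind with
    | h t' x' =>
      rcases Collapse.mk_eq_iff.1 h with h | ⟨h, -⟩
      · exact Or.inl (congrArg (fun p : I × X => mk p.1 p.2) h)
      · right
        rw [isRim_mk_iff]
        have h : t = 0 ∨ t = 1 ∨ x = X.pt := h
        tauto

theorem isRim_of_toSusp_eq_pt {c : cone X} (h : toSusp c = (susp X).pt) : IsRim c := by
  rcases toSusp_eq_or (c' := (cone X).pt) h with rfl | h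
  · exact isRim_pt
  · exact h

theorem toSusp_map {Y : PtdSpace.{u}} (f : PtdMap X Y) (c : cone X) :
    toSusp (map f c) = susp.map f (toSusp c) := by
  induction c using cone.ind with
  | h t x => rfl

end cone

/-- The product of a family of pointed maps, restricted to the fat wedges. -/
def fatWedge.map {n : ℕ} {E F : Fin (n + 2) → PtdSpace.{u}} (f : ∀ k, PtdMap (E k) (F k)) :
    PtdMap (fatWedge E) (fatWedge F) where
  map :=
    { toFun := fun p => ⟨KProd.map f p.1, by
        obtain ⟨k, hk⟩ := p.2
        refine ⟨k, (KProd.coord_mk _ k).trans ?_⟩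
        rw [hk, (f k).map_pt]⟩
      continuous_toFun := ((KProd.map f).continuous.comp continuous_subtype_val).subtype_mk _ }
  map_pt := Subtype.ext (congrArg KProd.mk (funext fun k =>
    (congrArg (f k) (KProd.coord_mk _ k)).trans (f k).map_pt))

section letters

variable {X A : PtdSpace.{u}}

/-- The identification of the suspensions of `X, A, …, A` with `Σ X, Σ A, …, Σ A`. -/
def letters.ofSusp : {n : ℕ} → (k : Fin n) →
    PtdMap (susp (letters X A n k)) (letters (susp X) (susp A) n k)
  | _, ⟨0, _⟩ => PtdMap.id (susp X)
  | _, ⟨_ + 1, _⟩ => PtdMap.id (susp A)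

theorem letters.ofSusp_injective {n : ℕ} (k : Fin n) :
    Function.Injective (letters.ofSusp k : PtdMap (susp (letters X A n k)) _) := by
  obtain ⟨_ | k, hk⟩ := k
  · exact Function.injective_id
  · exact Function.injective_id

theorem letters.isQuotientMap_ofSusp {n : ℕ} (k : Fin n) :
    IsQuotientMap (letters.ofSusp k : PtdMap (susp (letters X A n k)) _) := by
  obtain ⟨_ | k, hk⟩ := k
  · exact IsQuotientMap.id
  · exact IsQuotientMap.id

theorem letters.map_ofSusp {Y B : PtdSpace.{u}} (f : PtdMap X Y) (g : PtdMap A B) {n : ℕ}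
    (k : Fin n) (s : susp (letters X A n k)) :
    letters.map (susp.map f) (susp.map g) k (letters.ofSusp k s) =
      letters.ofSusp k (susp.map (letters.map f g k) s) := by
  obtain ⟨_ | k, hk⟩ := k
  · rfl
  · rfl

end letters

namespace RelJames

variable {X A : PtdSpace.{u}} (i : PtdMap (susp A) (susp X)) {n : ℕ}

/-- The map `C X × C A × ⋯ × C A → J_{n+2}(Σ X, Σ A)`. -/
def ofConeProd : PtdMap (coneProd (letters X A (n + 2))) (RelJames i (n + 2)) where
  map :=
    { toFun := fun d => mk i (KProd.mk fun k => letters.ofSusp k (cone.toSusp (d.coord k)))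
      continuous_toFun := (isQuotientMap_mk i).continuous.comp (KProd.continuous_mk fun k =>
        (letters.ofSusp k).continuous.comp (cone.toSusp.continuous.comp
          (coneProd.continuous_coord k))) }
  map_pt := by
    refine congrArg (fun p => mk i (KProd.mk p)) (funext fun k => ?_)
    rw [coneProd.coord_pt, cone.toSusp.map_pt, (letters.ofSusp k).map_pt]

theorem isQuotientMap_ofConeProd [T2Space X] [T2Space A]
    [∀ k, CompactlyCoherentSpace (letters X A (n + 2) k)] :
    IsQuotientMap (ofConeProd i (n := n)) := by
  have h1 : ∀ k : Fin (n + 2), IsQuotientMap fun p : I × letters X A (n + 2) k =>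
      letters.ofSusp k (susp.mk p.1 p.2) := fun k =>
    (letters.isQuotientMap_ofSusp k).comp (isQuotientMap_susp_mk _)
  have h2 := (isQuotientMap_mk i).comp
    (KProd.isQuotientMap_prod (fun k => ⟨_, (h1 k).continuous⟩) h1)
  refine IsQuotientMap.of_comp coneProd.isQuotientMap.continuous (ofConeProd i).continuous ?_
  convert h2 using 1
  funext a
  refine congrArg (fun p => mk i (KProd.mk p)) (funext fun k => ?_)
  rw [coneProd.coord_mk]
  rfl

theorem isRim_of_ofConeProd_eq_incl (hi : Function.Injective i)
    {d : coneProd (letters X A (n + 2))} {c : RelJames i (n + 1)}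
    (h : ofConeProd i d = incl i (n + 1) c) : ∃ k, cone.IsRim (d.coord k) := by
  obtain ⟨k, hk⟩ := exists_coord_eq_pt i hi h
  refine ⟨k, cone.isRim_of_toSusp_eq_pt (letters.ofSusp_injective k ?_)⟩
  rw [KProd.coord_mk] at hk
  rw [hk, (letters.ofSusp k).map_pt]

/-- Words of maximal length determine all their letters, and therefore the points of the product of
the cones that have no coordinate on the rim. -/
theorem ofConeProd_eq_or (hi : Function.Injective i) {d d' : coneProd (letters X A (n + 2))}
    (h : ofConeProd i d = ofConeProd i d') : d = d' ∨ (∃ k, cone.IsRim (d.coord k)) ∨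
      ∃ k, cone.IsRim (d'.coord k) := by
  by_contra! hd
  obtain ⟨hne, hd, hd'⟩ := hd
  have key : ∀ d : coneProd (letters X A (n + 2)), (∀ k, ¬ cone.IsRim (d.coord k)) →
      toWord i (ofConeProd i d) =
        List.ofFn fun k => letter i k (letters.ofSusp k (cone.toSusp (d.coord k))) := by
    intro d hd
    refine (word_eq_ofFn i hi fun k hk => hd k ?_).trans ?_
    · rw [KProd.coord_mk] at hk
      refine cone.isRim_of_toSusp_eq_pt (letters.ofSusp_injective k ?_)
      rw [hk, (letters.ofSusp k).map_pt]
    · simp only [KProd.coord_mk]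
  refine hne (coneProd.ext fun k => ?_)
  have h1 := congrArg (toWord i) h
  rw [key d hd, key d' hd'] at h1
  have h2 := congrFun (List.ofFn_injective h1) k
  exact (cone.toSusp_eq_or (letters.ofSusp_injective k (letter_injective i hi k h2))).resolve_right
    (hd k)

variable [T2Space X] [T2Space A]

/-- The map `T₁(Σ X, Σ A, …, Σ A) → J_{n+1}(Σ X, Σ A)` that omits a coordinate at the base point. -/
def ofSuspFatWedge : PtdMap (fatWedge fun k => susp (letters X A (n + 2) k))
    (RelJames i (n + 1)) :=
  (ofFatWedge i).comp (fatWedge.map letters.ofSusp)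

/-- The attaching map `Q(X, A, …, A) → J_{n+1}(Σ X, Σ A)`. -/
def ofConeBoundary : PtdMap (coneBoundary (letters X A (n + 2))) (RelJames i (n + 1)) :=
  (ofSuspFatWedge i).comp (coneBoundary.toFatWedge _)

theorem ofConeProd_toProd (z : coneBoundary (letters X A (n + 2))) :
    ofConeProd i (coneBoundary.toProd _ z) = incl i (n + 1) (ofConeBoundary i z) := by
  refine Eq.trans ?_ (incl_ofFatWedge i _).symm
  induction z using coneBoundary.ind with
  | h t x =>
    refine congrArg (fun p => mk i (KProd.mk p)) (funext fun k => ?_)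
    refine (congrArg (fun c => letters.ofSusp k (cone.toSusp c))
      (coneBoundary.coord_toProd_mk t x k)).trans (congrArg (letters.ofSusp k) ?_)
    exact (KProd.coord_mk (E := fun k => susp (letters X A (n + 2) k))
      (fun k => susp.mk (t.1 k) (x.coord k)) k).symm

/-- `J_{n+2}(Σ X, Σ A)` is obtained from `J_{n+1}(Σ X, Σ A)` by attaching `C X × C A × ⋯ × C A`
along `Q(X, A, …, A)`. -/
theorem isAttaching [∀ k, CompactlyCoherentSpace (letters X A (n + 2) k)]
    (hi : Function.Injective i) :
    IsAttaching (coneBoundary.toProd (letters X A (n + 2))) (ofConeBoundary i) (ofConeProd i)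
      (incl i (n + 1)) where
  isEmbedding := coneBoundary.isClosedEmbedding_toProd.isEmbedding
  isQuotientMap := isQuotientMap_ofConeProd i
  surjective c := by
    obtain ⟨d, hd⟩ := (isQuotientMap_ofConeProd i).surjective (incl i (n + 1) c)
    obtain ⟨z, rfl⟩ := coneBoundary.exists_toProd_eq (isRim_of_ofConeProd_eq_incl i hi hd)
    exact ⟨z, incl_injective i ((ofConeProd_toProd i z).symm.trans hd)⟩
  comm := ofConeProd_toProd i
  eq_or := by
    have key : ∀ d d' : coneProd (letters X A (n + 2)), ofConeProd i d = ofConeProd i d' →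
        (∃ k, cone.IsRim (d.coord k)) → ∃ z z', coneBoundary.toProd _ z = d ∧
          coneBoundary.toProd _ z' = d' ∧ ofConeBoundary i z = ofConeBoundary i z' := by
      intro d d' h hd
      obtain ⟨z, rfl⟩ := coneBoundary.exists_toProd_eq hd
      rw [ofConeProd_toProd] at h
      obtain ⟨z', rfl⟩ := coneBoundary.exists_toProd_eq (isRim_of_ofConeProd_eq_incl i hi h.symm)
      rw [ofConeProd_toProd] at h
      exact ⟨z, z', rfl, rfl, incl_injective i h⟩
    intro d d' h
    rcases ofConeProd_eq_or i hi h with hd | hd | hd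
    · exact Or.inl hd
    · exact Or.inr (key d d' h hd)
    · obtain ⟨z, z', h1, h2, h3⟩ := key d' d h.symm hd
      exact Or.inr ⟨z', z, h2, h1, h3.symm⟩

end RelJames

/-! ### Maps induced by families of pointed maps -/

section map

variable {n : ℕ} {E F : Fin (n + 2) → PtdSpace.{u}} (f : ∀ k, PtdMap (E k) (F k))

/-- The map of the products of cones induced by a family of pointed maps. -/
def coneProd.map : C(coneProd E, coneProd F) where
  toFun d := coneProd.mk fun k => cone.map (f k) (d.coord k)
  continuous_toFun := coneProd.continuous_mk fun k =>
    (cone.map (f k)).continuous.comp (coneProd.continuous_coord k)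

theorem coneProd.coord_map (d : coneProd E) (k : Fin (n + 2)) :
    (coneProd.map f d).coord k = cone.map (f k) (d.coord k) := coneProd.coord_mk _ k

theorem coneProd.map_contraction (t : I) (d : coneProd E) :
    coneProd.map f ((coneProd.contraction E).c (t, d)) =
      (coneProd.contraction F).c (t, coneProd.map f d) := by
  refine coneProd.ext fun k => (coneProd.coord_map f _ k).trans ?_
  refine Eq.trans ?_ (coneProd.coord_mk _ k).symm
  refine (congrArg (cone.map (f k)) (coneProd.coord_mk _ k)).trans ?_
  rw [cone.map_scale, coneProd.coord_map]

/-- The map `Q(E) → Q(F)` induced by a family of pointed maps. -/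
def coneBoundary.map : PtdMap (coneBoundary E) (coneBoundary F) where
  map :=
    { toFun := Quot.map (Prod.map id (KProd.map f)) fun a b h k => by
        have := congrArg (cone.map (f k)) (h k)
        rw [cone.map_mk, cone.map_mk] at this
        refine Eq.trans ?_ (this.trans ?_)
        · exact congrArg (cone.mk (a.1.1 k)) (KProd.coord_mk (fun k => f k (a.2.coord k)) k)
        · exact congrArg (cone.mk (b.1.1 k)) (KProd.coord_mk (fun k => f k (b.2.coord k)) k).symm
      continuous_toFun := continuous_quot_lift _ (continuous_quot_mk.comp
        (continuous_id.prodMap (KProd.map f).continuous)) }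
  map_pt := congrArg (coneBoundary.mk ⟨fun _ => 1, 0, rfl⟩) (congrArg KProd.mk (funext fun k =>
    (congrArg (f k) (KProd.coord_mk _ k)).trans (f k).map_pt))

theorem coneBoundary.toProd_map (z : coneBoundary E) :
    coneBoundary.toProd F (coneBoundary.map f z) = coneProd.map f (coneBoundary.toProd E z) := by
  induction z using coneBoundary.ind with
  | h t x =>
    refine coneProd.ext fun k => ?_
    refine Eq.trans (coneBoundary.coord_toProd_mk t (KProd.map f x) k)
      (Eq.trans ?_ (coneProd.coord_map f _ k).symm)
    rw [coneBoundary.coord_toProd_mk, cone.map_mk]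
    exact congrArg (cone.mk (t.1 k)) (KProd.coord_mk _ k)

theorem coneBoundary.toSusp_comp_map : (coneBoundary.toSusp F).comp (coneBoundary.map f) =
    (iterSusp.map (n + 1) (smash.map f)).comp (coneBoundary.toSusp E) := by
  refine PtdMap.ext fun z => ?_
  induction z using coneBoundary.ind with
  | h t x => rfl

end map

namespace RelJames

variable {X A Y B : PtdSpace.{u}} {i : PtdMap (susp A) (susp X)} {j : PtdMap (susp B) (susp Y)}
  {n : ℕ} (f : PtdMap X Y) (g : PtdMap A B) (h : (susp.map f).comp i = j.comp (susp.map g))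

theorem map_ofConeProd (d : coneProd (letters X A (n + 2))) :
    map (susp.map f) (susp.map g) h (n + 2) (ofConeProd i d) =
      ofConeProd j (coneProd.map (letters.map f g) d) := by
  refine congrArg (fun p => mk j (KProd.mk p)) (funext fun k => ?_)
  refine (congrArg (letters.map (susp.map f) (susp.map g) k)
    (KProd.coord_mk (E := letters (susp X) (susp A) (n + 2)) _ k)).trans ?_
  rw [letters.map_ofSusp, coneProd.coord_map, cone.toSusp_map]

theorem map_ofConeBoundary [T2Space X] [T2Space A] [T2Space Y] [T2Space B]
    (z : coneBoundary (letters X A (n + 2))) :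
    map (susp.map f) (susp.map g) h (n + 1) (ofConeBoundary i z) =
      ofConeBoundary j (coneBoundary.map (letters.map f g) z) := by
  refine incl_injective j ?_
  rw [← ofConeProd_toProd, coneBoundary.toProd_map, ← map_ofConeProd f g h, ofConeProd_toProd]
  exact (PtdMap.congr_apply (map_incl i (n := n + 1) (susp.map f) (susp.map g) h)
    (ofConeBoundary i z)).symm

end RelJames

/-! ### The attaching maps of the relative James construction -/

theorem PtdMap.Homotopic.postcomp {X Y Z : PtdSpace.{u}} (f : PtdMap Y Z) {g g' : PtdMap X Y}
    (h : g.Homotopic g') : (f.comp g).Homotopic (f.comp g') :=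
  h.elim fun K => ⟨PtdMap.Homotopy.postcomp f K⟩

theorem PtdMap.Homotopic.precomp {X Y Z : PtdSpace.{u}} {g g' : PtdMap Y Z}
    (h : g.Homotopic g') (f : PtdMap X Y) : (g.comp f).Homotopic (g'.comp f) :=
  ContinuousMap.HomotopicRel.precomp h f.map (by
    rintro _ rfl
    exact f.map_pt)

theorem fatWedge.map_inj {n : ℕ} {E F : Fin (n + 2) → PtdSpace.{u}} (f : ∀ k, PtdMap (E k) (F k))
    (j : Fin (n + 2)) [CompactlyCoherentSpace (E j)] [CompactlyCoherentSpace (F j)] (x : E j) :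
    fatWedge.map f (fatWedge.inj E j x) = fatWedge.inj F j (f j x) := by
  refine Subtype.ext (congrArg KProd.mk (funext fun k => ?_))
  refine (congrArg (f k) (KProd.coord_mk _ k)).trans ?_
  by_cases hk : k = j
  · subst hk
    rw [Function.update_self, Function.update_self]
  · rw [Function.update_of_ne hk, Function.update_of_ne hk, (f k).map_pt]

namespace SuspCWPair

variable (P : SuspCWPair.{u}) (n : ℕ)

instance : T2Space P.X' := IsPtdCW.t2

instance : T2Space P.A' := IsPtdCW.t2

theorem incl_injective : Function.Injective P.incl := P.isCWPairIncl.isEmbedding.injective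

theorem nonempty_pointDeform_letters (k : Fin n) :
    Nonempty (PointDeform (letters P.X' P.A' n k)) := by
  obtain ⟨_ | k, hk⟩ := k
  · exact IsPtdCW.nonempty_pointDeform P.X'
  · exact IsPtdCW.nonempty_pointDeform P.A'

theorem exists_inverse :
    ∃ r : PtdMap (P.attachDomain n) (coneBoundary (letters P.X' P.A' (n + 2))),
      (r.comp (coneBoundary.toSusp _)).Homotopic (PtdMap.id _) ∧
      ((coneBoundary.toSusp _).comp r).Homotopic (PtdMap.id _) :=
  coneBoundary.exists_toSusp_inverse fun k => (P.nonempty_pointDeform_letters (n + 2) k).some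

/-- A homotopy inverse of the projection `Q(X', A', …, A') → Σⁿ⁺¹ (X' ∧ A' ∧ ⋯ ∧ A')`. -/
def inverse : PtdMap (P.attachDomain n) (coneBoundary (letters P.X' P.A' (n + 2))) :=
  (P.exists_inverse n).choose

theorem inverse_comp_toSusp :
    ((P.inverse n).comp (coneBoundary.toSusp _)).Homotopic (PtdMap.id _) :=
  (P.exists_inverse n).choose_spec.1

theorem toSusp_comp_inverse :
    ((coneBoundary.toSusp _).comp (P.inverse n)).Homotopic (PtdMap.id _) :=
  (P.exists_inverse n).choose_spec.2

/-- The attaching map `γ : Σⁿ⁺¹ (X' ∧ A' ∧ ⋯ ∧ A') → J_{n+1}(X, A)`. -/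
def attachingMap : PtdMap (P.attachDomain n) (P.J (n + 1)) :=
  (RelJames.ofConeBoundary P.incl).comp (P.inverse n)

/-- The map to `J_{n+2}(X, A)` from the mapping cone of `Q(X', A', …, A') → J_{n+1}(X, A)`. -/
def boundaryConeToJ : PtdMap (mapCone (RelJames.ofConeBoundary P.incl (n := n))) (P.J (n + 2)) :=
  (coneProd.contraction (letters P.X' P.A' (n + 2))).coneMap (RelJames.ofConeProd_toProd P.incl)

/-- The map to `J_{n+2}(X, A)` from the mapping cone of the attaching map. -/
def coneToJ : PtdMap (mapCone (P.attachingMap n)) (P.J (n + 2)) :=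
  (P.boundaryConeToJ n).comp (mapCone.ofSource (RelJames.ofConeBoundary P.incl) (P.inverse n))

theorem isHomotopyEquivUnder_coneToJ : IsHomotopyEquivUnder (mapCone.incl (P.attachingMap n))
    (P.inclJ (n + 1)) (P.coneToJ n) := by
  have h1 : IsHomotopyEquivUnder _ (P.inclJ (n + 1)) (P.boundaryConeToJ n) :=
    (RelJames.isAttaching P.incl P.incl_injective).isHomotopyEquivUnder
      (coneProd.contraction _)
      (coneProd.nbhdDeform fun k => (P.nonempty_pointDeform_letters (n + 2) k).some)
  have h2 := mapCone.isHomotopyEquivUnder_ofSource (RelJames.ofConeBoundary P.incl (n := n))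
    (P.inverse_comp_toSusp n) (P.toSusp_comp_inverse n)
  exact h1.comp h2

theorem ofSuspFatWedge_comp_inj (j : Fin (n + 2)) :
    (RelJames.ofSuspFatWedge P.incl).comp
      (fatWedge.inj (fun k => susp (letters P.X' P.A' (n + 2) k)) j) = P.legs (n + 1) j := by
  refine PtdMap.ext fun x => ?_
  have : CompactlyCoherentSpace (letters (susp P.X') (susp P.A') (n + 2) j) := by
    obtain ⟨_ | k, hk⟩ := j
    · exact susp.compactlyCoherentSpace P.X'
    · exact susp.compactlyCoherentSpace P.A'
  refine (congrArg (RelJames.ofFatWedge P.incl) (fatWedge.map_inj letters.ofSusp j x)).trans ?_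
  refine (RelJames.ofFatWedge_inj P.incl j _).trans ?_
  obtain ⟨_ | k, hk⟩ := j
  · rfl
  · rfl

/-- The attaching map is the composite of `F : T₁(X, A, …, A) → J_{n+1}(X, A)` with the universal
Whitehead product `ρ r`. -/
theorem attachingMap_mem_whiteheadProducts :
    P.attachingMap n ∈ whiteheadProducts (E := letters P.X' P.A' (n + 2)) (P.legs (n + 1)) := by
  refine ⟨RelJames.ofSuspFatWedge P.incl, fun j => ?_,
    (coneBoundary.toFatWedge _).comp (P.inverse n), ?_, ContinuousMap.HomotopicRel.refl _⟩
  · rw [P.ofSuspFatWedge_comp_inj n j]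
    exact ContinuousMap.HomotopicRel.refl _
  · exact (P.inverse_comp_toSusp n).postcomp (coneBoundary.toFatWedge _)

namespace Hom

variable {n} {P₁ P₂ : SuspCWPair.{u}} (h : Hom P₁ P₂)

/-- The induced map `Q(X₁', A₁', …, A₁') → Q(X₂', A₂', …, A₂')`. -/
def onConeBoundary : PtdMap (coneBoundary (letters P₁.X' P₁.A' (n + 2)))
    (coneBoundary (letters P₂.X' P₂.A' (n + 2))) :=
  coneBoundary.map (letters.map h.onX' h.onA')

/-- The homotopy inverses `r₁` and `r₂` of the projections `q₁` and `q₂` are natural up to homotopy: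
`Q(h) r₁ ≃ r₂ q₂ Q(h) r₁ = r₂ S(h) q₁ r₁ ≃ r₂ S(h)`, where `Q(h)` and `S(h)` are the maps induced
by `h`. -/
theorem onConeBoundary_comp_inverse : (h.onConeBoundary.comp (P₁.inverse n)).Homotopic
    ((P₂.inverse n).comp (h.attachDomain n)) := by
  have h1 := (P₂.inverse_comp_toSusp n).precomp (h.onConeBoundary.comp (P₁.inverse n))
  have h2 := (P₁.toSusp_comp_inverse n).postcomp ((P₂.inverse n).comp (h.attachDomain n))
  have h3 : ((P₂.inverse n).comp (coneBoundary.toSusp _)).comp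
      (h.onConeBoundary.comp (P₁.inverse n)) = ((P₂.inverse n).comp (h.attachDomain n)).comp
        ((coneBoundary.toSusp _).comp (P₁.inverse n)) := by
    have := coneBoundary.toSusp_comp_map (letters.map h.onX' h.onA' (n := n + 2))
    exact congrArg (fun f => ((P₂.inverse n).comp f).comp (P₁.inverse n)) this
  rw [h3] at h1
  exact ContinuousMap.HomotopicRel.trans (ContinuousMap.HomotopicRel.symm h1) h2

/-- The mapping cone sequences are natural up to homotopy. A homotopy `K` between the two composites
`Σⁿ⁺¹ (X₁' ∧ A₁' ∧ ⋯) → Q(X₂', A₂', …)` yields the homotopy of attaching maps and, by way of the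
contraction of the product of the cones, the square of maps that joins the maps of cones. -/
theorem exists_homotopy : ∃ H : PtdMap.Homotopy ((h.J (n + 1)).comp (P₁.attachingMap n))
      ((P₂.attachingMap n).comp (h.attachDomain n)),
    ((P₂.coneToJ n).comp (mapCone.map H)).map.HomotopicRel ((h.J (n + 2)).comp (P₁.coneToJ n)).map
      (range (mapCone.incl (P₁.attachingMap n))) := by
  obtain ⟨K⟩ := h.onConeBoundary_comp_inverse (n := n)
  have h0 : (RelJames.ofConeBoundary P₂.incl).comp (h.onConeBoundary.comp (P₁.inverse n)) =
      (h.J (n + 1)).comp (P₁.attachingMap n) := PtdMap.ext fun s =>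
    (RelJames.map_ofConeBoundary h.onX' h.onA' h.comm _).symm
  refine ⟨ContinuousMap.HomotopyRel.cast (PtdMap.Homotopy.postcomp (r := _)
    (r' := (P₂.inverse n).comp (h.attachDomain n)) (RelJames.ofConeBoundary P₂.incl) K)
    (congrArg PtdMap.map h0) rfl, ?_⟩
  refine mapCone.homotopicRel_of_square (fun y => ?_)
    ⟨fun q => P₂.boundaryConeToJ n (mapCone.mk _ q.1 (K q.2)),
      (P₂.boundaryConeToJ n).continuous.comp (mapCone.continuous_mk.comp
        (continuous_fst.prodMk (K.continuous.comp continuous_snd)))⟩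
    (fun b s => ?_) (fun a b => ?_) (fun t s => ?_) fun t s => ?_
  · exact (PtdMap.congr_apply (RelJames.map_incl P₁.incl (n := n + 1) _ _ h.comm) y).symm
  · change P₂.boundaryConeToJ n (mapCone.mk _ 0 (K (b, s))) = _
    rw [mapCone.mk_zero, (P₂.boundaryConeToJ n).map_pt]
  · change P₂.boundaryConeToJ n (mapCone.mk _ a (K (b, _))) = _
    rw [K.eq_fst _ (mem_singleton _), (h.onConeBoundary.comp (P₁.inverse n)).map_pt,
      mapCone.mk_pt, (P₂.boundaryConeToJ n).map_pt]
  · change _ = P₂.boundaryConeToJ n (mapCone.mk _ t (K (0, s)))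
    rw [K.apply_zero]
    refine (RelJames.map_ofConeProd h.onX' h.onA' h.comm _).trans ?_
    refine congrArg (RelJames.ofConeProd P₂.incl) ((coneProd.map_contraction _ t _).trans ?_)
    exact congrArg (fun d => (coneProd.contraction _).c (t, d))
      (coneBoundary.toProd_map (letters.map h.onX' h.onA') (P₁.inverse n s)).symm
  · change P₂.coneToJ n (if (t : ℝ) ≤ 1 / 2 then
        mapCone.mk _ (clamp (2 * (t : ℝ))) (h.attachDomain n s)
      else mapCone.incl _ (RelJames.ofConeBoundary P₂.incl (K (clamp (2 - 2 * (t : ℝ)), s)))) =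
      P₂.boundaryConeToJ n (mapCone.mk _ _ (K (_, s)))
    split_ifs with ht
    · rw [clamp_of_one_le (r := 2 - 2 * (t : ℝ)) (by linarith), K.apply_one]
      rfl
    · rw [clamp_of_one_le (r := 2 * (t : ℝ)) (by linarith), mapCone.mk_one]
      rfl

end Hom

end SuspCWPair

end

theorem mainTheorem2 (n : ℕ) :
    ∃ (γ : ∀ P : SuspCWPair.{u}, PtdMap (P.attachDomain n) (P.J (n + 1)))
      (φ : ∀ P : SuspCWPair.{u}, PtdMap (mapCone (γ P)) (P.J (n + 2))),
      (∀ P : SuspCWPair.{u},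
        γ P ∈ whiteheadProducts (E := letters P.X' P.A' (n + 2)) (P.legs (n + 1)) ∧
        IsClosedEmbedding (P.inclJ (n + 1)) ∧
        IsHomotopyEquivUnder (mapCone.incl (γ P)) (P.inclJ (n + 1)) (φ P)) ∧
      ∀ (P₁ P₂ : SuspCWPair.{u}) (h : SuspCWPair.Hom P₁ P₂),
        (h.J (n + 2)).comp (P₁.inclJ (n + 1)) = (P₂.inclJ (n + 1)).comp (h.J (n + 1)) ∧
        ∃ H : PtdMap.Homotopy ((h.J (n + 1)).comp (γ P₁)) ((γ P₂).comp (h.attachDomain n)),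
          ((φ P₂).comp (mapCone.map H)).map.HomotopicRel ((h.J (n + 2)).comp (φ P₁)).map
            (range (mapCone.incl (γ P₁))) := by
  refine ⟨fun P => P.attachingMap n, fun P => P.coneToJ n, fun P => ⟨?_, ?_, ?_⟩,
    fun P₁ P₂ h => ⟨?_, h.exists_homotopy⟩⟩
  · exact P.attachingMap_mem_whiteheadProducts n
  · exact RelJames.isClosedEmbedding_incl P.incl P.incl_injective
  · exact P.isHomotopyEquivUnder_coneToJ n
  · exact RelJames.map_incl P₁.incl _ _ h.comm
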